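/- Let $k$ be a commutative ring containing $\mathbb{Q}$, let $p\colon E\to A$ be a morphism of (associative unital) $k$-algebras having a section $i_A\colon A\to E$ which is a morphism of $k$-algebras (a cleft extension), let $M:=\ker p$, so that $E=A\oplus M$ (identifying $A$ with $i_A(A)$), and let $K$ be a $k$-subalgebra of $A$. Unadorned tensor products are over $K$; for a $K$-algebra $C$ put $\overline{C}:=C/K$ and let $C\otimes\overline{C}^{\otimes n}\otimes$ be the cyclic tensor product. **Relative homology and Connes' sequence.** Let $(\mathfrak{X},b,B)$ be the kernel of $(E\otimes\overline{E}^{\otimes *}\otimes,b,B)\to(A\otimes\overline{A}^{\otimes *}\otimes,b,B)$, where $b$ is the Hochschild boundary and $B(x_0\otimes\cdots\otimes x_n)=\sum_{c=0}^n(-1)^{cn}\,1\otimes x_c\otimes\cdots\otimes x_n\otimes x_0\otimes\cdots\otimes x_{c-1}$. $\mathrm{HH}_*(E,M)$ is the homology of $(\mathfrak{X},b)$, and $\mathrm{HC}_*(E,M)$ is the homology of the complex whose elements of degree $n$ are the sequences $(z_0,z_1,\dots)$ with $z_j\in\mathfrak{X}_{n-2j}$, with $(Dz)_j=b z_j+B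 z_{j+1}$. In Connes' long exact sequence, $I\colon\mathrm{HH}_n(E,M)\to\mathrm{HC}_n(E,M)$ is induced by $z\mapsto(z,0,0,\dots)$, $S\colon\mathrm{HC}_n(E,M)\to\mathrm{HC}_{n-2}(E,M)$ by $(z_0,z_1,\dots)\mapsto(z_1,z_2,\dots)$, and the connecting map $B\colon\mathrm{HC}_n(E,M)\to\mathrm{HH}_{n+1}(E,M)$ by $(z_0,z_1,\dots)\mapsto B z_0$. **The small complexes.** For $v,w\ge0$ and $n=v+w$ let $X_{vw}\subseteq E\otimes\overline{E}^{\otimes n}\otimes$ be generated by the classes of tensors $x_0\otimes\cdots\otimes x_n$ with $x_0\in M$, exactly $w$ of $x_1,\dots,x_n$ in $M$ and the others in $A$. Let $m\triangledown m'$ be the product in $E$ of $m,m'\in M$, extended to $E$ by $0$ on $A$, and let $\cdot$ be the product of $E$ minus $\triangledown$. Let $\mu_j$, $\varrho_j$ be $(-1)^j$ times the replacement of $x_j\otimes x_{j+1}$ by $x_j\cdot x_{j+1}$, respectively $x_j\triangledown x_{j+1}$, for $0\le j<n$; for $j=n$ they are given by $(-1)^n (x_n\cdot x_0)\otimes x_1\otimes\cdots\otimes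 x_{n-1}$, respectively with $\triangledown$. Let $t(x_0\otimes\cdots\otimes x_n)=(-1)^{cn}x_c\otimes\cdots\otimes x_n\otimes x_0\otimes\cdots\otimes x_{c-1}$, where $x_c$ is the last entry in $M$. Put $b=\sum_{j=0}^n\mu_j$, $d'=\sum_{j=0}^{n-1}\varrho_j$, $d=d'+\varrho_n$, $N=\sum_{l=0}^w t^l$ and $\sigma'=\sum_{j=0}^{w-1}\frac{w-j}{w+1}t^j$ on $X_{vw}$. Let $\overline{X}_{vw}=X_{vw}/\mathrm{im}(\mathrm{id}-t)$; $b$ and $d$ induce $\overline{b},\overline{d}$ on $\overline{X}$, $N$ induces $\overline{N}\colon\overline{X}_{vw}\to X_{vw}$, and $\mathfrak{p}\colon X_{vw}\to\overline{X}_{vw}$ is $\frac1{w+1}$ times the quotient map. Let $$\overline{\xi}=\tfrac1{w+1}\,\mathfrak{p}\circ d'\circ\sigma'\circ d\circ\overline{N}\colon\overline{X}_{vw}\to\overline{X}_{v,w-2}\quad(w\ge2),\qquad \overline{\xi}=0\quad(w\le1).$$ Let $\widetilde{X}_{vw}=\overline{X}_{vw}\oplus\overline{X}_{v,w-1}$,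 where the total complex of $\widetilde{X}$ has the differential $(x,y)\mapsto\bigl(\overline{b}x+\overline{d}x,\ \overline{\xi}x-\overline{b}y-\overline{d}y\bigr)$. There is a short exact sequence $$0\longrightarrow\overline{X}_{*,*-1}\stackrel{i}{\longrightarrow}\widetilde{X}_{**}\stackrel{\pi}{\longrightarrow}\overline{X}_{**}\longrightarrow0,\qquad i(y)=(0,y),\quad\pi(x,y)=x,$$ split in each degree, $\overline{X}_{*,*-1}$ carrying the opposite differential. **The identifications.** Write $z\in\mathfrak{X}_n$ as $z=x+y$, where $x\in\bigoplus_w X_{n-w,w}$ is the part of tensors starting in $M$ and $y$ the part of tensors starting in $A$. Let $\Theta(z_0,z_1,\dots)$ be the class of $x_0+t(y_0)$ in $\bigoplus_w\overline{X}_{n-w,w}$, where $z_0=x_0+y_0$. For $t$-invariant $x\in X_{vw}$ put $\Upsilon(x)=(-\mathrm{id}+\overline{N}\circ\mathfrak{p})\circ\sigma'\circ d(x)\in X_{v,w-1}$ for $w\ge 1$ and $\Upsilon(x)=0$ for $w=0$. For $y$ a tensor $y_0\otimes\cdots\otimes y_{n-1}$ in $X_{n-1-u,u}$ with last entry in $M$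 at the place $c$, put $\vartheta(y)=\sum_{l=0}^{n-1-c}1\otimes\mathfrak{t}^l(y)$, where $\mathfrak{t}(y_0\otimes\cdots\otimes y_{n-1})=(-1)^{n-1}y_{n-1}\otimes y_0\otimes\cdots\otimes y_{n-2}$. For $(x,y)\in\widetilde{X}_{vw}$ let $$\Phi(x,y)=\tfrac1{w+1}\overline{N}x+\vartheta\bigl(\tfrac1{w+1}\Upsilon\overline{N}x+\overline{N}y\bigr).$$ **Proposition.** $(\mathfrak X,b)$, the complex computing $\mathrm{HC}_*(E,M)$, $\mathrm{Tot}(\overline{X},\overline{b},\overline{d})$ and $\mathrm{Tot}(\widetilde{X})$ are complexes; $S$, $B$, $I$, $\overline{\xi}$, $i$, $\pi$, $\Theta$ and $\Phi$ induce maps on homology (of degrees $-2,1,0,-2,1,0,0,0$, respectively); and $\Theta$ and $\Phi$ induce isomorphisms $$\mathrm{HC}_n(E,M)\cong \mathrm{H}_n(\mathrm{Tot}\,\overline{X}),\qquad \mathrm{H}_n(\mathrm{Tot}\,\widetilde{X})\cong\mathrm{HH}_n(E,M)$$ for all $n$. Under these identifications the maps $S\colon\mathrm{HC}_n(E,M)\to\mathrm{HC}_{n-2}(E,M)$,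 $B\colon\mathrm{HC}_n(E,M)\to\mathrm{HH}_{n+1}(E,M)$ and $I\colon\mathrm{HH}_n(E,M)\to\mathrm{HC}_n(E,M)$ are induced by $-\overline{\xi}$, $i$ and $\pi$, respectively: on homology, for all $n$, $$\Theta\circ S=-\overline{\xi}\circ\Theta,\qquad B=\Phi\circ i\circ\Theta,\qquad \Theta\circ I\circ\Phi=\pi .$$ -/

import Mathlib

open scoped TensorProduct

namespace RelCyc

section Cyc
variable {k : Type*} [CommRing k] {C : Type*} [Ring C] [Algebra k C]

/-- The relations defining `C ⊗_K C̄ ⊗_K ⋯ ⊗_K C̄ ⊗_K` (`n` factors `C̄ = C / K`, cyclic tensor product over `K`)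
as a quotient of `C ⊗_k ⋯ ⊗_k C` (`n + 1` factors): scalars in `K` may be moved from the right of
the `j`-th factor to the left of the next one, the factor following the last one being the `0`-th,
and a tensor one of whose factors other than the `0`-th lies in `K` is zero.
Indices in `Fin (n + 1)` are added cyclically. -/
def relations (K : Subalgebra k C) (n : ℕ) : Submodule k (⨂[k] _ : Fin (n + 1), C) :=
  Submodule.span k
    ({z | ∃ (x : Fin (n + 1) → C) (j : Fin (n + 1)), ∃ c ∈ K,
        z = PiTensorProduct.tprod k (Function.update x j (x j * c)) -
            PiTensorProduct.tprod k (Function.update x (j + 1) (c * x (j + 1)))} ∪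
     {z | ∃ (x : Fin (n + 1) → C) (j : Fin (n + 1)), j ≠ 0 ∧ x j ∈ K ∧
        z = PiTensorProduct.tprod k x})

/-- The degree `n` part `C ⊗ C̄^{⊗ n} ⊗` of the normalized (Hochschild and cyclic) complex of the
`K`-algebra `C`; tensor products are over `K`, the last sign `⊗` being the cyclic one. -/
abbrev Cyc (K : Subalgebra k C) (n : ℕ) : Type _ :=
  (⨂[k] _ : Fin (n + 1), C) ⧸ relations K n

variable (K : Subalgebra k C)

/-- The class `[x₀ ⊗ ⋯ ⊗ xₙ]` of a simple tensor. -/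
def cls (n : ℕ) : MultilinearMap k (fun _ : Fin (n + 1) => C) (Cyc K n) :=
  (relations K n).mkQ.compMultilinearMap (PiTensorProduct.tprod k)

variable {K} {n : ℕ}

theorem cls_bal (x : Fin (n + 1) → C) (j : Fin (n + 1)) {c : C} (hc : c ∈ K) :
    cls K n (Function.update x j (x j * c)) =
      cls K n (Function.update x (j + 1) (c * x (j + 1))) := by
  refine (Submodule.Quotient.eq _).2 (Submodule.subset_span (Or.inl ⟨x, j, c, hc, rfl⟩))

theorem cls_deg (x : Fin (n + 1) → C) {j : Fin (n + 1)} (hj : j ≠ 0) (hx : x j ∈ K) :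
    cls K n x = 0 :=
  (Submodule.Quotient.mk_eq_zero _).2 (Submodule.subset_span (Or.inr ⟨x, j, hj, hx, rfl⟩))

/-- The linear map on `Cyc K n` given by a multilinear map that is compatible with the relations. -/
def Cyc.lift {N : Type*} [AddCommGroup N] [Module k N]
    (f : MultilinearMap k (fun _ : Fin (n + 1) => C) N)
    (hbal : ∀ x j, ∀ c ∈ K, f (Function.update x j (x j * c)) =
      f (Function.update x (j + 1) (c * x (j + 1))))
    (hdeg : ∀ x j, j ≠ 0 → x j ∈ K → f x = 0) : Cyc K n →ₗ[k] N :=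
  (relations K n).liftQ (PiTensorProduct.lift f) <| by
    rw [relations, Submodule.span_le]
    rintro z (⟨x, j, c, hc, rfl⟩ | ⟨x, j, hj, hx, rfl⟩)
    · simp [hbal x j c hc]
    · simp [hdeg x j hj hx]

@[simp] theorem Cyc.lift_cls {N : Type*} [AddCommGroup N] [Module k N]
    (f : MultilinearMap k (fun _ : Fin (n + 1) => C) N) (hbal) (hdeg) (x : Fin (n + 1) → C) :
    Cyc.lift (K := K) f hbal hdeg (cls K n x) = f x := by
  simp [Cyc.lift, cls]

theorem Cyc.span_cls : Submodule.span k (Set.range (cls K n)) = ⊤ := by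
  rw [show Set.range (cls K n) = (relations K n).mkQ '' Set.range (PiTensorProduct.tprod k) by
    rw [← Set.range_comp]; rfl, Submodule.span_image, PiTensorProduct.span_tprod_eq_top,
    Submodule.map_top, Submodule.range_mkQ]

/-- The `j`-th face `x₀ ⊗ ⋯ ⊗ op(x_j, x_{j+1}) ⊗ ⋯ ⊗ x_{n+1}`; the last face (`j = n + 1`) is
`op(x_{n+1}, x₀) ⊗ x₁ ⊗ ⋯ ⊗ x_n`. -/
def face (op : C →ₗ[k] C →ₗ[k] C) (j : Fin (n + 2)) (x : Fin (n + 2) → C) : Fin (n + 1) → C :=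
  fun a => if (a : ℕ) = (j : ℕ) % (n + 1) then op (x j) (x (j + 1))
    else if (a : ℕ) < j then x a.castSucc else x a.succ

/-- The position in the `j`-th face where the product `op(x_j, x_{j+1})` stands. -/
def slot (j : Fin (n + 2)) : Fin (n + 1) := ⟨j % (n + 1), Nat.mod_lt _ n.succ_pos⟩

/-- The index of the entry of `x` that stands at position `a` of the `j`-th face, if `a ≠ slot j`. -/
def pos (j : Fin (n + 2)) (a : Fin (n + 1)) : Fin (n + 2) :=
  if (a : ℕ) < j then a.castSucc else a.succ

theorem val_succ (j : Fin (n + 1)) :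
    ((j + 1 : Fin (n + 1)) : ℕ) = if (j : ℕ) = n then 0 else (j : ℕ) + 1 := by
  rcases n with _ | n
  · have := j.isLt; split_ifs <;> omega
  rw [Fin.val_add_one]
  simp [Fin.ext_iff]

theorem slot_val (j : Fin (n + 2)) :
    ((slot j : Fin (n + 1)) : ℕ) = if (j : ℕ) = n + 1 then 0 else (j : ℕ) := by
  have := j.isLt
  simp only [slot]
  split_ifs with h
  · rw [h, Nat.mod_self]
  · rw [Nat.mod_eq_of_lt (by omega)]

theorem pos_val (j : Fin (n + 2)) (a : Fin (n + 1)) :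
    (pos j a : ℕ) = if (a : ℕ) < j then (a : ℕ) else (a : ℕ) + 1 := by
  simp only [pos]; split_ifs <;> simp

theorem succ_ne (j : Fin (n + 2)) : j + 1 ≠ j := by
  have h1 := val_succ j
  intro h
  rw [h] at h1
  split_ifs at h1 <;> omega

theorem pos_ne (j : Fin (n + 2)) {a : Fin (n + 1)} (ha : a ≠ slot j) :
    pos j a ≠ j ∧ pos j a ≠ j + 1 := by
  have h1 := val_succ j
  have h2 := slot_val j
  have h3 := pos_val j a
  have hj := j.isLt
  have ha' := a.isLt
  have : (a : ℕ) ≠ slot j := fun h => ha (Fin.ext h)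
  generalize j + 1 = j' at *
  constructor <;> intro h <;> rw [h] at h3 <;> split_ifs at * <;> omega

theorem pos_inj (j : Fin (n + 2)) {a b : Fin (n + 1)} (ha : a ≠ slot j) (hb : b ≠ slot j)
    (h : pos j a = pos j b) : a = b := by
  have h2 := slot_val j
  have h3 := pos_val j a
  have h4 := pos_val j b
  have hj := j.isLt
  have : (a : ℕ) ≠ slot j := fun h => ha (Fin.ext h)
  have : (b : ℕ) ≠ slot j := fun h => hb (Fin.ext h)
  rw [h] at h3
  apply Fin.ext
  split_ifs at * <;> omega

theorem exists_pos (j : Fin (n + 2)) {i : Fin (n + 2)} (hi : i ≠ j) (hi' : i ≠ j + 1) :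
    ∃ a, a ≠ slot j ∧ pos j a = i ∧ (a : ℕ) = if (i : ℕ) < j then (i : ℕ) else (i : ℕ) - 1 := by
  have h1 := val_succ j
  have h2 := slot_val j
  have hj := j.isLt
  have hi2 := i.isLt
  have hne : (i : ℕ) ≠ j := fun h => hi (Fin.ext h)
  have hne' : (i : ℕ) ≠ ((j + 1 : Fin (n + 2)) : ℕ) := fun h => hi' (Fin.ext h)
  clear hi'
  generalize j + 1 = j' at *
  have hlt : (if (i : ℕ) < j then (i : ℕ) else (i : ℕ) - 1) < n + 1 := by
    split_ifs at * <;> omega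
  refine ⟨⟨_, hlt⟩, ?_, ?_, rfl⟩
  · rw [Ne, Fin.ext_iff, h2]
    simp only
    split_ifs at * <;> omega
  · rw [Fin.ext_iff, pos_val]
    simp only
    split_ifs at * <;> omega

theorem face_apply (op : C →ₗ[k] C →ₗ[k] C) (j : Fin (n + 2)) (x : Fin (n + 2) → C)
    (a : Fin (n + 1)) :
    face op j x a = if a = slot j then op (x j) (x (j + 1)) else x (pos j a) := by
  simp only [face, pos, slot, Fin.ext_iff, apply_ite x]

theorem face_update_left (op : C →ₗ[k] C →ₗ[k] C) (j : Fin (n + 2)) (x : Fin (n + 2) → C) (u : C) :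
    face op j (Function.update x j u) =
      Function.update (face op j x) (slot j) (op u (x (j + 1))) := by
  funext a
  by_cases ha : a = slot j
  · subst ha; simp [face_apply]
  · simp [face_apply, ha, pos_ne j ha]

theorem face_update_right (op : C →ₗ[k] C →ₗ[k] C) (j : Fin (n + 2)) (x : Fin (n + 2) → C)
    (u : C) : face op j (Function.update x (j + 1) u) =
      Function.update (face op j x) (slot j) (op (x j) u) := by
  funext a
  by_cases ha : a = slot j
  · subst ha; simp [face_apply, (succ_ne j).symm]
  · simp [face_apply, ha, pos_ne j ha]

theorem face_update_other (op : C →ₗ[k] C →ₗ[k] C) (j : Fin (n + 2)) (x : Fin (n + 2) → C) (u : C)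
    {a : Fin (n + 1)} (ha : a ≠ slot j) : face op j (Function.update x (pos j a) u) =
      Function.update (face op j x) a u := by
  funext b
  obtain ⟨h1, h2⟩ := pos_ne j ha
  by_cases hb : b = slot j
  · subst hb; simp [face_apply, h1.symm, h2.symm, ha.symm]
  · by_cases hab : b = a
    · subst hab; simp [face_apply, hb]
    · have : pos j b ≠ pos j a := fun h => hab (pos_inj j hb ha h)
      simp [face_apply, hb, hab, this]

theorem face_other (op : C →ₗ[k] C →ₗ[k] C) (j : Fin (n + 2)) (x : Fin (n + 2) → C)
    {a : Fin (n + 1)} (ha : a ≠ slot j) : face op j x a = x (pos j a) := by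
  simp [face_apply, ha]

theorem face_slot (op : C →ₗ[k] C →ₗ[k] C) (j : Fin (n + 2)) (x : Fin (n + 2) → C) :
    face op j x (slot j) = op (x j) (x (j + 1)) := by
  simp [face_apply]

variable (K) in
/-- The `j`-th face as a multilinear map. -/
def faceMul (op : C →ₗ[k] C →ₗ[k] C) (j : Fin (n + 2)) :
    MultilinearMap k (fun _ : Fin (n + 2) => C) (Cyc K n) :=
  .mk' (fun x => cls K n (face op j x))
    (by
      intro x i u v
      by_cases hi : i = j
      · subst hi; simp [face_update_left]
      by_cases hi' : i = j + 1
      · subst hi'; simp [face_update_right]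
      obtain ⟨a, ha, rfl, -⟩ := exists_pos j hi hi'
      simp [face_update_other _ _ _ _ ha])
    (by
      intro x i c v
      by_cases hi : i = j
      · subst hi; simp [face_update_left]
      by_cases hi' : i = j + 1
      · subst hi'; simp [face_update_right]
      obtain ⟨a, ha, rfl, -⟩ := exists_pos j hi hi'
      simp [face_update_other _ _ _ _ ha])

@[simp] theorem faceMul_apply (op : C →ₗ[k] C →ₗ[k] C) (j : Fin (n + 2)) (x : Fin (n + 2) → C) :
    faceMul K op j x = cls K n (face op j x) := rfl

/-- A bilinear operation that is compatible with the multiplication by elements of `K`, such that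
`op(x, c) = e • x c` and `op(c, x) = e • c x` for `c ∈ K`. Used only to see that face maps are well defined. -/
structure Admissible (K : Subalgebra k C) (op : C →ₗ[k] C →ₗ[k] C) (e : k) : Prop where
  bal : ∀ x y, ∀ c ∈ K, op (x * c) y = op x (c * y)
  left : ∀ x y, ∀ c ∈ K, op (c * x) y = c * op x y
  right : ∀ x y, ∀ c ∈ K, op x (y * c) = op x y * c
  unit_right : ∀ x, ∀ c ∈ K, op x c = e • (x * c)
  unit_left : ∀ x, ∀ c ∈ K, op c x = e • (c * x)

theorem faceMul_bal {op : C →ₗ[k] C →ₗ[k] C} {e : k} (h : Admissible K op e) (j : Fin (n + 2))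
    (x : Fin (n + 2) → C) (i : Fin (n + 2)) (c : C) (hc : c ∈ K) :
    faceMul K op j (Function.update x i (x i * c)) =
      faceMul K op j (Function.update x (i + 1) (c * x (i + 1))) := by
  simp only [faceMul_apply]
  have key : ∀ a : Fin (n + 1), cls K n (Function.update (face op j x) a (face op j x a * c)) =
      cls K n (Function.update (face op j x) (a + 1) (c * face op j x (a + 1))) :=
    fun a => cls_bal _ _ hc
  by_cases hi : i = j
  · subst hi
    rw [face_update_left, face_update_right, h.bal _ _ _ hc]
  have hs := slot_val j
  have hj := j.isLt
  have hi2 := i.isLt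
  have hv := val_succ i
  have hvj := val_succ j
  have hne : (i : ℕ) ≠ j := fun h => hi (Fin.ext h)
  by_cases hi' : i = j + 1
  · by_cases hij : i + 1 = j
    · -- degree one
      rw [hij, face_update_left]
      subst hi'
      rw [face_update_right, h.left _ _ _ hc, h.right _ _ _ hc, ← face_slot]
      have hn : slot j + 1 = slot j := by
        have h1 := congrArg Fin.val hij
        have h2 := val_succ (slot j)
        apply Fin.ext
        clear key hij hi
        generalize slot j + 1 = s' at *
        generalize j + 1 + 1 = j'' at *
        generalize j + 1 = j' at *
        split_ifs at * <;> omega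
      have := key (slot j)
      rwa [hn] at this
    · have hij' : i + 1 ≠ j + 1 := fun h => hi (add_right_cancel h)
      obtain ⟨a, ha, hp, hav⟩ := exists_pos j hij hij'
      rw [← hp, face_update_other _ _ _ _ ha]
      subst hi'
      rw [face_update_right, h.right _ _ _ hc, ← face_slot op j, ← face_other op j x ha]
      have : a = slot j + 1 := by
        have h2 := val_succ (slot j)
        have : ((j + 1 + 1 : Fin (n + 2)) : ℕ) ≠ j := fun h => hij (Fin.ext h)
        apply Fin.ext
        clear key hij hij' hp
        generalize slot j + 1 = s' at *
        generalize j + 1 + 1 = j'' at *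
        generalize j + 1 = j' at *
        split_ifs at * <;> omega
      rw [this]
      exact key _
  · obtain ⟨a, ha, hp, hav⟩ := exists_pos j hi hi'
    have hne' : (i : ℕ) ≠ ((j + 1 : Fin (n + 2)) : ℕ) := fun h => hi' (Fin.ext h)
    by_cases hij : i + 1 = j
    · rw [hij, face_update_left, h.left _ _ _ hc, ← face_slot op j, ← hp,
        face_update_other _ _ _ _ ha, ← face_other op j x ha]
      have : slot j = a + 1 := by
        have h2 := val_succ a
        rw [hij] at hv
        apply Fin.ext
        clear key hij hi'
        generalize a + 1 = a' at *
        generalize j + 1 = j' at *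
        split_ifs at * <;> omega
      rw [this]
      exact key _
    · have hij' : i + 1 ≠ j + 1 := fun h => hi (add_right_cancel h)
      obtain ⟨b, hb, hpb, hbv⟩ := exists_pos j hij hij'
      rw [← hpb, ← hp, face_update_other _ _ _ _ ha, face_update_other _ _ _ _ hb,
        ← face_other op j x ha, ← face_other op j x hb]
      have : b = a + 1 := by
        have h2 := val_succ a
        have : ((i + 1 : Fin (n + 2)) : ℕ) ≠ j := fun h => hij (Fin.ext h)
        apply Fin.ext
        clear key hij hij' hi' hpb
        generalize a + 1 = a' at *
        generalize i + 1 = i' at *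
        generalize j + 1 = j' at *
        split_ifs at * <;> omega
      rw [this]
      exact key _

theorem cls_zero_entry (x : Fin (n + 1) → C) {j : Fin (n + 1)} (hx : x j = 0) : cls K n x = 0 :=
  (cls K n).map_coord_zero j hx

/-- A face other than the two involving `i` preserves degeneracy at `i ≠ 0`. -/
theorem cls_face_deg (op : C →ₗ[k] C →ₗ[k] C) (j i : Fin (n + 2)) (hi : i ≠ j)
    (hi' : i ≠ j + 1) (h0 : i ≠ 0) (x : Fin (n + 2) → C) (hx : x i ∈ K) :
    cls K n (face op j x) = 0 := by
  obtain ⟨a, ha, rfl, hav⟩ := exists_pos j hi hi'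
  refine cls_deg (j := a) _ ?_ (by rwa [face_other _ _ _ ha])
  have hs := slot_val j
  have hv := val_succ j
  have hj := j.isLt
  rintro rfl
  have h1 : (pos j 0 : ℕ) ≠ 0 := fun h => h0 (Fin.ext h)
  have h2 : (pos j 0 : ℕ) ≠ j := fun h => hi (Fin.ext h)
  have h3 : (pos j 0 : ℕ) ≠ ((j + 1 : Fin (n + 2)) : ℕ) := fun h => hi' (Fin.ext h)
  have h4 : (slot j : ℕ) ≠ 0 := fun h => ha (Fin.ext (by simpa using h.symm))
  have h5 := pos_val j 0
  clear hi hi' ha h0 hx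
  generalize j + 1 = j' at *
  generalize pos j 0 = q at *
  simp only [Fin.val_zero] at *
  split_ifs at * <;> omega

theorem cls_face_deg_of_zero {op : C →ₗ[k] C →ₗ[k] C} (h : Admissible K op 0)
    (j i : Fin (n + 2)) (h0 : i ≠ 0) (x : Fin (n + 2) → C) (hx : x i ∈ K) :
    cls K n (face op j x) = 0 := by
  by_cases hi : i = j
  · subst hi
    exact cls_zero_entry _ (j := slot i) (by rw [face_slot, h.unit_left _ _ hx, zero_smul])
  by_cases hi' : i = j + 1
  · subst hi'
    exact cls_zero_entry _ (j := slot j) (by rw [face_slot, h.unit_right _ _ hx, zero_smul])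
  exact cls_face_deg op j i hi hi' h0 x hx

theorem cls_face_sum_deg {op : C →ₗ[k] C →ₗ[k] C} {e : k} (h : Admissible K op e)
    (i : Fin (n + 2)) (h0 : i ≠ 0) (x : Fin (n + 2) → C) (hx : x i ∈ K) :
    ∑ j : Fin (n + 2), (-1 : k) ^ (j : ℕ) • cls K n (face op j x) = 0 := by
  obtain ⟨m, rfl⟩ : ∃ m : Fin (n + 1), i = m.succ := ⟨i.pred h0, by simp⟩
  have hm1 : m.castSucc + 1 = m.succ := by simp
  have hne : m.castSucc ≠ m.succ := by simp [Fin.ext_iff]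
  rw [← Finset.sum_subset (Finset.subset_univ {m.castSucc, m.succ}), Finset.sum_pair hne]
  · have hs1 : slot m.castSucc = m := by
      apply Fin.ext; rw [slot_val]; have := m.isLt; simp; omega
    have hs2 : slot m.succ = m + 1 := by
      apply Fin.ext; rw [slot_val, val_succ]; simp
    have f1 := face_slot op m.castSucc x
    have f2 := face_slot op m.succ x
    rw [hs1, hm1, h.unit_right _ _ hx] at f1
    rw [hs2, h.unit_left _ _ hx] at f2
    set y : Fin (n + 1) → C := Function.update (face op m.castSucc x) m (x m.castSucc) with hy
    have hy1 : y m = x m.castSucc := by simp [hy]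
    have hy2 : y (m + 1) = x (m.succ + 1) := by
      by_cases hmm : m + 1 = m
      · rw [hmm, hy1]
        congr 1
        have h1 := val_succ m
        have h2 := val_succ m.succ
        have h3 : (m.succ : ℕ) = m + 1 := rfl
        have h4 : (m.castSucc : ℕ) = m := rfl
        apply Fin.ext
        rw [hmm] at h1
        generalize m.succ + 1 = m2 at *
        generalize m.succ = m1 at *
        generalize m.castSucc = m0 at *
        split_ifs at * <;> omega
      · have hne' : m + 1 ≠ slot m.castSucc := by rwa [hs1]
        rw [hy, Function.update_of_ne hmm, face_other _ _ _ hne']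
        congr 1
        have h1 := val_succ m
        have h2 := val_succ m.succ
        have h3 : (m.succ : ℕ) = m + 1 := rfl
        have h4 : (m.castSucc : ℕ) = m := rfl
        have h5 := pos_val m.castSucc (m + 1)
        have h6 : ((m + 1 : Fin (n + 1)) : ℕ) ≠ m := fun h => hmm (Fin.ext h)
        apply Fin.ext
        clear hmm hne' hs1 hs2 f1 f2 hy hm1
        generalize pos m.castSucc (m + 1) = q at *
        generalize m.succ + 1 = m2 at *
        generalize m.succ = m1 at *
        generalize m.castSucc = m0 at *
        generalize m + 1 = m3 at *
        split_ifs at * <;> omega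
    have e1 : face op m.castSucc x = Function.update y m (e • (y m * x m.succ)) := by
      rw [hy1, ← f1, hy, Function.update_idem, Function.update_eq_self]
    have e2 : face op m.succ x =
        Function.update y (m + 1) (e • (x m.succ * y (m + 1))) := by
      rw [hy2]
      funext a
      by_cases ha : a = m + 1
      · subst ha; rw [Function.update_self, f2]
      · rw [Function.update_of_ne ha, face_other _ _ _ (by rwa [hs2])]
        by_cases ham : a = m
        · subst ham
          rw [hy1]; congr 1
          apply Fin.ext; rw [pos_val]; simp
        · rw [hy, Function.update_of_ne ham, face_other _ _ _ (by rwa [hs1])]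
          congr 1
          apply Fin.ext; rw [pos_val, pos_val]
          have : (a : ℕ) ≠ m := fun h => ham (Fin.ext h)
          simp only [Fin.val_succ, Fin.val_castSucc]
          split_ifs <;> omega
    rw [e1, e2, (cls K n).map_update_smul, (cls K n).map_update_smul, cls_bal _ _ hx,
      ← add_smul]
    simp [pow_succ]
  · intro j _ hj
    simp only [Finset.mem_insert, Finset.mem_singleton, not_or] at hj
    rw [cls_face_deg op j m.succ (fun h => hj.2 h.symm) _ h0 x hx, smul_zero]
    intro hh
    rw [← hm1] at hh
    exact hj.1 (add_right_cancel hh).symm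

/-- The alternating sum of all faces. -/
def faceSum {op : C →ₗ[k] C →ₗ[k] C} {e : k} (h : Admissible K op e) (n : ℕ) :
    Cyc K (n + 1) →ₗ[k] Cyc K n :=
  Cyc.lift (∑ j : Fin (n + 2), (-1 : k) ^ (j : ℕ) • faceMul K op j)
    (fun x i c hc => by simp only [sum_apply, smul_apply,
      faceMul_bal h _ x i c hc])
    (fun x i h0 hx => by
      simpa only [sum_apply, smul_apply, faceMul_apply] using
        cls_face_sum_deg h i h0 x hx)

/-- The `j`-th face with the sign `(-1)^j`. -/
def faceMap {op : C →ₗ[k] C →ₗ[k] C} (h : Admissible K op 0) (n : ℕ) (j : Fin (n + 2)) :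
    Cyc K (n + 1) →ₗ[k] Cyc K n :=
  Cyc.lift ((-1 : k) ^ (j : ℕ) • faceMul K op j)
    (fun x i c hc => by simp only [smul_apply, faceMul_bal h _ x i c hc])
    (fun x i h0 hx => by
      simp only [smul_apply, faceMul_apply, cls_face_deg_of_zero h j i h0 x hx,
        smul_zero])

theorem faceSum_cls {op : C →ₗ[k] C →ₗ[k] C} {e : k} (h : Admissible K op e) (n : ℕ)
    (x : Fin (n + 2) → C) : faceSum h n (cls K (n + 1) x) =
      ∑ j : Fin (n + 2), (-1 : k) ^ (j : ℕ) • cls K n (face op j x) := by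
  simp [faceSum]

theorem faceMap_cls {op : C →ₗ[k] C →ₗ[k] C} (h : Admissible K op 0) (n : ℕ) (j : Fin (n + 2))
    (x : Fin (n + 2) → C) : faceMap h n j (cls K (n + 1) x) =
      (-1 : k) ^ (j : ℕ) • cls K n (face op j x) := by
  simp [faceMap]

/-- The rotation `x_c ⊗ ⋯ ⊗ xₙ ⊗ x₀ ⊗ ⋯ ⊗ x_{c-1}`. -/
def rot {α : Type*} (c : Fin (n + 1)) (x : Fin (n + 1) → α) : Fin (n + 1) → α := fun a => x (a + c)

theorem rot_update (c : Fin (n + 1)) (x : Fin (n + 1) → C) (i : Fin (n + 1)) (u : C) :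
    rot c (Function.update x i u) = Function.update (rot c x) (i - c) u := by
  funext a
  by_cases h : a = i - c
  · subst h; simp [rot]
  · have : a + c ≠ i := fun hh => h (eq_sub_of_add_eq hh)
    simp [rot, this, h]

/-- The map `1 ⊗ x_c ⊗ ⋯ ⊗ xₙ ⊗ x₀ ⊗ ⋯ ⊗ x_{c-1}` as a multilinear map. -/
def unitRotMul (K : Subalgebra k C) (c : Fin (n + 1)) :
    MultilinearMap k (fun _ : Fin (n + 1) => C) (Cyc K (n + 1)) :=
  .mk' (fun x => cls K (n + 1) (Fin.cons 1 (rot c x)))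
    (by intro x i u v
        simp only [rot_update, Fin.cons_update (α := fun _ => C), (cls K (n + 1)).map_update_add])
    (by intro x i r v
        simp only [rot_update, Fin.cons_update (α := fun _ => C), (cls K (n + 1)).map_update_smul])

theorem cons_update' (x : Fin (n + 1) → C) (i : Fin (n + 1)) (u : C) :
    (Fin.cons 1 (Function.update x i u) : Fin (n + 2) → C) =
      Function.update (Fin.cons 1 x : Fin (n + 2) → C) i.succ u :=
  Fin.cons_update (α := fun _ => C) 1 x i u

/-- The summand `x₀ ⊗ ⋯ ⊗ xₙ ↦ (-1)^{c n} 1 ⊗ x_c ⊗ ⋯ ⊗ xₙ ⊗ x₀ ⊗ ⋯ ⊗ x_{c-1}` of the Connes operator. -/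
def unitRot (K : Subalgebra k C) (n : ℕ) (c : Fin (n + 1)) : Cyc K n →ₗ[k] Cyc K (n + 1) :=
  Cyc.lift ((-1 : k) ^ ((c : ℕ) * n) • unitRotMul K c)
    (by
      intro x j r hr
      simp only [smul_apply]
      congr 1
      change cls K (n + 1) (Fin.cons 1 (rot c _)) = cls K (n + 1) (Fin.cons 1 (rot c _))
      rw [rot_update, rot_update, cons_update', cons_update']
      have hx1 : x j = (Fin.cons 1 (rot c x) : Fin (n + 2) → C) (j - c).succ := by simp [rot]
      have hx2 : x (j + 1) = (Fin.cons 1 (rot c x) : Fin (n + 2) → C) (j + 1 - c).succ := by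
        simp [rot]
      have hj : j + 1 - c = (j - c) + 1 := by abel
      rw [hx1, cls_bal _ _ hr, hx2, hj]
      generalize j - c = a
      by_cases ha : (a : ℕ) = n
      · have ha' : a.succ + 1 = 0 := by
          apply Fin.ext; rw [val_succ]; simp [ha]
        have ha'' : a + 1 = 0 := by
          apply Fin.ext; rw [val_succ]; simp [ha]
        rw [ha', ha'']
        have := cls_bal (K := K) (Fin.cons 1 (rot c x) : Fin (n + 2) → C) 0 hr
        simpa using this
      · have : (a.succ + 1 : Fin (n + 2)) = (a + 1).succ := by
          apply Fin.ext
          rw [val_succ, Fin.val_succ, Fin.val_succ, val_succ, if_neg ha, if_neg (by omega)]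
        rw [this])
    (by
      intro x j hj hx
      have : cls K (n + 1) (Fin.cons 1 (rot c x) : Fin (n + 2) → C) = 0 :=
        cls_deg (j := (j - c).succ) _ (Fin.succ_ne_zero _) (by simpa [rot] using hx)
      simp only [smul_apply]
      change _ • cls K (n + 1) (Fin.cons 1 (rot c x)) = 0
      rw [this, smul_zero])

theorem unitRot_cls (n : ℕ) (c : Fin (n + 1)) (x : Fin (n + 1) → C) :
    unitRot K n c (cls K n x) =
      (-1 : k) ^ ((c : ℕ) * n) • cls K (n + 1) (Fin.cons 1 (rot c x)) := by
  simp [unitRot, unitRotMul]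


theorem update_map {ι : Type*} [DecidableEq ι] {α β : Type*} (f : ι → α → β) (x : ι → α) (i : ι) (u : α) :
    (fun j => f j (Function.update x i u j)) = Function.update (fun j => f j (x j)) i (f i u) := by
  funext j
  by_cases h : j = i
  · subst h; simp
  · simp [h]

/-- Compatibility of maps `f₀, …, fₙ` with the relations, so that `f₀ ⊗ ⋯ ⊗ fₙ` is well defined. -/
structure FactorCompat {D : Type*} [Ring D] [Algebra k D] (K : Subalgebra k C) (L : Subalgebra k D)
    (f : Fin (n + 1) → C →ₗ[k] D) : Prop where
  bal : ∀ c ∈ K, ∃ c' ∈ L, ∀ j x, f j (x * c) = f j x * c' ∧ f j (c * x) = c' * f j x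
  unit : ∀ c ∈ K, ∀ j, j ≠ 0 → f j c ∈ L

/-- The map `x₀ ⊗ ⋯ ⊗ xₙ ↦ f₀ x₀ ⊗ ⋯ ⊗ fₙ xₙ`. -/
def mapFactors {D : Type*} [Ring D] [Algebra k D] {L : Subalgebra k D}
    (f : Fin (n + 1) → C →ₗ[k] D) (h : FactorCompat K L f) : Cyc K n →ₗ[k] Cyc L n :=
  Cyc.lift ((cls L n).compLinearMap f)
    (by
      intro x j c hc
      obtain ⟨c', hc', h'⟩ := h.bal c hc
      simp only [MultilinearMap.compLinearMap_apply]
      rw [update_map (fun j => f j), update_map (fun j => f j), (h' _ _).1, (h' _ _).2]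
      exact cls_bal (fun j => f j (x j)) j hc')
    (fun x j hj hx => cls_deg _ hj (h.unit _ hx j hj))

theorem mapFactors_cls {D : Type*} [Ring D] [Algebra k D] {L : Subalgebra k D}
    (f : Fin (n + 1) → C →ₗ[k] D) (h : FactorCompat K L f) (x : Fin (n + 1) → C) :
    mapFactors f h (cls K n x) = cls L n (fun j => f j (x j)) :=
  Cyc.lift_cls _ _ _ x

theorem admissible_mul : Admissible K (LinearMap.mul k C) 1 where
  bal x y c _ := by simp [mul_assoc]
  left x y c _ := by simp [mul_assoc]
  right x y c _ := by simp [mul_assoc]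
  unit_right x c _ := by simp
  unit_left x c _ := by simp

end Cyc

section Homology
variable {k V W : Type*} [CommRing k] [AddCommGroup V] [Module k V] [AddCommGroup W] [Module k W]

/-- `D` is a differential of degree `-1` on the graded module with pieces `deg m ⊆ V`. -/
def IsComplex (deg : ℤ → Submodule k V) (D : V →ₗ[k] V) : Prop :=
  ∀ m, ∀ x ∈ deg m, D x ∈ deg (m - 1) ∧ D (D x) = 0

/-- The `m`-cycles. -/
def cycles (deg : ℤ → Submodule k V) (D : V →ₗ[k] V) (m : ℤ) : Submodule k V :=
  deg m ⊓ LinearMap.ker D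

/-- The `m`-boundaries. -/
def boundaries (deg : ℤ → Submodule k V) (D : V →ₗ[k] V) (m : ℤ) : Submodule k V :=
  (deg (m + 1)).map D

/-- The `m`-th homology. -/
abbrev Homology (deg : ℤ → Submodule k V) (D : V →ₗ[k] V) (m : ℤ) : Type _ :=
  cycles deg D m ⧸ (boundaries deg D m).submoduleOf (cycles deg D m)

/-- `f` carries `m`-cycles to `m'`-cycles and `m`-boundaries to `m'`-boundaries. -/
structure InducesOnHomology (deg : ℤ → Submodule k V) (D : V →ₗ[k] V) (deg' : ℤ → Submodule k W)
    (D' : W →ₗ[k] W) (f : V →ₗ[k] W) (m m' : ℤ) : Prop where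
  cycles_map : ∀ x ∈ cycles deg D m, f x ∈ cycles deg' D' m'
  boundaries_map : ∀ x ∈ boundaries deg D m, f x ∈ boundaries deg' D' m'

/-- The map `[x] ↦ [f x]` on homology. -/
def homologyMap {deg : ℤ → Submodule k V} {D : V →ₗ[k] V} {deg' : ℤ → Submodule k W}
    {D' : W →ₗ[k] W} {f : V →ₗ[k] W} {m m' : ℤ} (h : InducesOnHomology deg D deg' D' f m m') :
    Homology deg D m →ₗ[k] Homology deg' D' m' :=
  Submodule.mapQ _ _ (f.restrict h.cycles_map) fun x hx => h.boundaries_map x hx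

end Homology

/-- A cleft extension: a morphism `p : E → A` of `k`-algebras with a section `i : A → E` that is a
morphism of `k`-algebras. With `M = ker p` one has `E = i(A) ⊕ M`. -/
structure CleftExtension (k A E : Type*) [CommRing k] [Ring A] [Ring E] [Algebra k A]
    [Algebra k E] where
  p : E →ₐ[k] A
  i : A →ₐ[k] E
  p_i : ∀ a, p (i a) = a

section Cleft
variable {k A E : Type*} [CommRing k] [Ring A] [Ring E] [Algebra k A] [Algebra k E]

namespace CleftExtension
variable (e : CleftExtension k A E) (K : Subalgebra k A)

/-- The subalgebra `K` of `A` as a subalgebra of `E`. -/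
def KE : Subalgebra k E := K.map e.i

/-- The projection of `E = A ⊕ M` onto `A`. -/
def piA : E →ₗ[k] E := e.i.toLinearMap ∘ₗ e.p.toLinearMap

/-- The projection of `E = A ⊕ M` onto `M = ker p`. -/
def piM : E →ₗ[k] E := LinearMap.id - e.piA

/-- The operation `▽`, extended to `E = A ⊕ M`: the product of the components in `M`. -/
def tri : E →ₗ[k] E →ₗ[k] E := (LinearMap.mul k E).compl₁₂ e.piM e.piM

/-- The multiplication of the square zero extension on `A ⊕ M`:
`(a + m) · (a' + m') = a a' + (a m' + m a')`. -/
def dot : E →ₗ[k] E →ₗ[k] E := LinearMap.mul k E - e.tri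

theorem piA_apply (x : E) : e.piA x = e.i (e.p x) := rfl
theorem piM_apply (x : E) : e.piM x = x - e.i (e.p x) := rfl
theorem tri_apply (x y : E) : e.tri x y = e.piM x * e.piM y := rfl
theorem dot_apply (x y : E) : e.dot x y = x * y - e.piM x * e.piM y := rfl

variable {K}

theorem piA_of_mem {c : E} (hc : c ∈ e.KE K) : e.piA c = c := by
  obtain ⟨a, -, rfl⟩ := hc
  simp [piA_apply, e.p_i]

theorem piM_of_mem {c : E} (hc : c ∈ e.KE K) : e.piM c = 0 := by
  obtain ⟨a, -, rfl⟩ := hc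
  simp [piM_apply, e.p_i]

theorem piA_mul {c : E} (hc : c ∈ e.KE K) (x : E) :
    e.piA (x * c) = e.piA x * c ∧ e.piA (c * x) = c * e.piA x := by
  obtain ⟨a, -, rfl⟩ := hc
  simp [piA_apply, e.p_i]

theorem piM_mul {c : E} (hc : c ∈ e.KE K) (x : E) :
    e.piM (x * c) = e.piM x * c ∧ e.piM (c * x) = c * e.piM x := by
  obtain ⟨a, -, rfl⟩ := hc
  simp [piM_apply, e.p_i, sub_mul, mul_sub]

theorem p_piM (x : E) : e.p (e.piM x) = 0 := by simp [piM_apply, e.p_i]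

theorem piM_of_p {x : E} (hx : e.p x = 0) : e.piM x = x := by simp [piM_apply, hx]
theorem piA_of_p {x : E} (hx : e.p x = 0) : e.piA x = 0 := by simp [piA_apply, hx]
theorem piM_of_i {x : E} (hx : x ∈ e.i.range) : e.piM x = 0 := by
  obtain ⟨a, rfl⟩ := hx
  simp [piM_apply, e.p_i]
theorem piA_of_i {x : E} (hx : x ∈ e.i.range) : e.piA x = x := by
  obtain ⟨a, rfl⟩ := hx
  simp [piA_apply, e.p_i]

variable (K)

theorem admissible_tri : Admissible (e.KE K) e.tri 0 where
  bal x y c hc := by simp [tri_apply, e.piM_mul hc, mul_assoc]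
  left x y c hc := by simp [tri_apply, e.piM_mul hc, mul_assoc]
  right x y c hc := by simp [tri_apply, e.piM_mul hc, mul_assoc]
  unit_right x c hc := by simp [tri_apply, e.piM_of_mem hc]
  unit_left x c hc := by simp [tri_apply, e.piM_of_mem hc]

theorem admissible_dot : Admissible (e.KE K) e.dot 1 where
  bal x y c hc := by simp [dot_apply, e.piM_mul hc, mul_assoc]
  left x y c hc := by simp [dot_apply, e.piM_mul hc, mul_assoc, mul_sub]
  right x y c hc := by simp [dot_apply, e.piM_mul hc, mul_assoc, sub_mul]
  unit_right x c hc := by simp [dot_apply, e.piM_of_mem hc]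
  unit_left x c hc := by simp [dot_apply, e.piM_of_mem hc]

/-- The Hochschild boundary `x₀ ⊗ ⋯ ⊗ x_{n+1} ↦
∑_{j ≤ n} (-1)^j x₀ ⊗ ⋯ ⊗ x_j x_{j+1} ⊗ ⋯ ⊗ x_{n+1} + (-1)^{n+1} x_{n+1} x₀ ⊗ x₁ ⊗ ⋯ ⊗ x_n` of `E`. -/
def hochschild (n : ℕ) : Cyc (e.KE K) (n + 1) →ₗ[k] Cyc (e.KE K) n := faceSum admissible_mul n

/-- The map `E ⊗ Ē^{⊗ n} ⊗ → A ⊗ Ā^{⊗ n} ⊗` induced by `p`. -/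
def proj (n : ℕ) : Cyc (e.KE K) n →ₗ[k] Cyc K n :=
  mapFactors (fun _ => e.p.toLinearMap)
    { bal := by
        rintro c ⟨a, ha, rfl⟩
        exact ⟨a, ha, fun j x => by simp [e.p_i]⟩
      unit := by
        rintro c ⟨a, ha, rfl⟩ j -
        simpa [e.p_i] using ha }

/-- `x₀ ⊗ ⋯ ⊗ xₙ ↦ π₀ x₀ ⊗ ⋯ ⊗ πₙ xₙ`, where `πⱼ = πM` if `j ∈ S` and `πⱼ = πA` otherwise -/
def patProj {n : ℕ} (S : Finset (Fin (n + 1))) : Cyc (e.KE K) n →ₗ[k] Cyc (e.KE K) n :=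
  mapFactors (fun j => if j ∈ S then e.piM else e.piA)
    { bal := by
        refine fun c hc => ⟨c, hc, fun j x => ?_⟩
        split_ifs
        exacts [e.piM_mul hc x, e.piA_mul hc x]
      unit := by
        intro c hc j _
        split_ifs
        · rw [e.piM_of_mem hc]; exact zero_mem _
        · rwa [e.piA_of_mem hc] }

/-- `x₀ ⊗ ⋯ ⊗ xₙ ↦ πA x₀ ⊗ x₁ ⊗ ⋯ ⊗ xₙ`: the component `y` of `z = (x, y)`, where `x` starts with an
entry in `M` and `y` with an entry in `A`. -/
def zeroProjA (n : ℕ) : Cyc (e.KE K) n →ₗ[k] Cyc (e.KE K) n :=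
  mapFactors (fun j => if j = 0 then e.piA else LinearMap.id)
    { bal := by
        refine fun c hc => ⟨c, hc, fun j x => ?_⟩
        split_ifs
        exacts [e.piA_mul hc x, ⟨rfl, rfl⟩]
      unit := by
        intro c hc j hj
        simpa [hj] using hc }

/-- The identity for `j < c`, `πM` for `j = c` and `πA` for `j > c`: applied to all the factors, these
pick out the part of a tensor whose last entry in `M` is the `c`-th. -/
def lastM {n : ℕ} (c j : Fin (n + 1)) : E →ₗ[k] E :=
  if j < c then LinearMap.id else if j = c then e.piM else e.piA

theorem lastM_mul {n : ℕ} (l j : Fin (n + 1)) {c : E} (hc : c ∈ e.KE K) (x : E) :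
    e.lastM l j (x * c) = e.lastM l j x * c ∧ e.lastM l j (c * x) = c * e.lastM l j x := by
  unfold lastM
  split_ifs
  exacts [⟨rfl, rfl⟩, e.piM_mul hc x, e.piA_mul hc x]

/-- The projection on the tensors whose last entry in `M` is the `c`-th. -/
def lastProj {n : ℕ} (c : Fin (n + 1)) : Cyc (e.KE K) n →ₗ[k] Cyc (e.KE K) n :=
  mapFactors (e.lastM c)
    { bal := fun r hr => ⟨r, hr, fun j x => e.lastM_mul K c j hr x⟩
      unit := by
        intro r hr j _
        unfold lastM
        split_ifs
        · exact hr
        · rw [e.piM_of_mem hr]; exact zero_mem _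
        · rwa [e.piA_of_mem hr] }

/-- The summand of `t` belonging to the tensors whose last entry in `M` is the `c`-th, without sign. -/
def rotTermMul {n : ℕ} (c : Fin (n + 1)) :
    MultilinearMap k (fun _ : Fin (n + 1) => E) (Cyc (e.KE K) n) :=
  .mk' (fun x => cls (e.KE K) n (rot c fun j => e.lastM c j (x j)))
    (by intro x i u v
        simp only [update_map (fun j => e.lastM c j), rot_update, map_add,
          (cls (e.KE K) n).map_update_add])
    (by intro x i r v
        simp only [update_map (fun j => e.lastM c j), rot_update, map_smul,
          (cls (e.KE K) n).map_update_smul])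

/-- The summand of `t` belonging to the tensors whose last entry in `M` is the `c`-th. -/
def rotTerm {n : ℕ} (c : Fin (n + 1)) : Cyc (e.KE K) n →ₗ[k] Cyc (e.KE K) n :=
  Cyc.lift ((-1 : k) ^ ((c : ℕ) * n) • e.rotTermMul K c)
    (by
      intro x j r hr
      simp only [smul_apply]
      congr 1
      change cls (e.KE K) n (rot c _) = cls (e.KE K) n (rot c _)
      rw [update_map (fun j => e.lastM c j), update_map (fun j => e.lastM c j), rot_update,
        rot_update, (e.lastM_mul K _ _ hr _).1, (e.lastM_mul K _ _ hr _).2]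
      have := cls_bal (rot c fun j => e.lastM c j (x j)) (j - c) hr
      have h2 : j - c + 1 = j + 1 - c := by abel
      rw [h2] at this
      simpa [rot] using this)
    (by
      intro x j hj hx
      simp only [smul_apply]
      change _ • cls (e.KE K) n (rot c _) = 0
      by_cases h : j = c
      · subst h
        rw [cls_zero_entry _ (j := 0), smul_zero]
        simp [rot, lastM, e.piM_of_mem hx]
      · rw [cls_deg (j := j - c) _ (sub_ne_zero.2 h), smul_zero]
        simp only [rot, sub_add_cancel, lastM, h, if_false]
        split_ifs
        · exact hx
        · rwa [e.piA_of_mem hx])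

theorem rotTerm_cls {n : ℕ} (c : Fin (n + 1)) (x : Fin (n + 1) → E) :
    e.rotTerm K c (cls (e.KE K) n x) =
      (-1 : k) ^ ((c : ℕ) * n) • cls (e.KE K) n (rot c fun j => e.lastM c j (x j)) := by
  simp [rotTerm, rotTermMul]

/-- The operator `t`: if the entries of `x₀ ⊗ ⋯ ⊗ xₙ` are in `A` or in `M` and the last one in `M` is
`x_c`, then `t(x₀ ⊗ ⋯ ⊗ xₙ) = (-1)^{c n} x_c ⊗ ⋯ ⊗ xₙ ⊗ x₀ ⊗ ⋯ ⊗ x_{c-1}`. -/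
def t (n : ℕ) : Cyc (e.KE K) n →ₗ[k] Cyc (e.KE K) n := ∑ c : Fin (n + 1), e.rotTerm K c

/-- `x` has entries in `M` at the places in `S`, which contains `0`, and entries in `A` elsewhere. -/
structure VerySimple {n : ℕ} (S : Finset (Fin (n + 1))) (x : Fin (n + 1) → E) : Prop where
  zero_mem : 0 ∈ S
  mem_M : ∀ j ∈ S, e.p (x j) = 0
  mem_A : ∀ j ∉ S, x j ∈ e.i.range

/-- `X_{v,w}`, with `n = v + w`: the part of `E ⊗ Ē^{⊗ n} ⊗` generated by the tensors `x₀ ⊗ ⋯ ⊗ xₙ` with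
`x₀ ∈ M`, exactly `w` of `x₁, …, xₙ` in `M`, and the others in `A`. -/
def X (n w : ℕ) : Submodule k (Cyc (e.KE K) n) :=
  Submodule.span k {z | ∃ (S : Finset (Fin (n + 1))) (x : Fin (n + 1) → E),
    e.VerySimple S x ∧ S.card = w + 1 ∧ z = cls (e.KE K) n x}

variable {K}

theorem cls_mem_X {n w : ℕ} {S : Finset (Fin (n + 1))} {x : Fin (n + 1) → E}
    (h : e.VerySimple S x) (hS : S.card = w + 1) : cls (e.KE K) n x ∈ e.X K n w :=
  Submodule.subset_span ⟨S, x, h, hS, rfl⟩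

theorem X_le {n w : ℕ} {P : Submodule k (Cyc (e.KE K) n)}
    (h : ∀ (S : Finset (Fin (n + 1))) (x : Fin (n + 1) → E), e.VerySimple S x →
      S.card = w + 1 → cls (e.KE K) n x ∈ P) : e.X K n w ≤ P := by
  rw [X, Submodule.span_le]
  rintro z ⟨S, x, hx, hS, rfl⟩
  exact h S x hx hS

theorem t_cls {n : ℕ} {S : Finset (Fin (n + 1))} {x : Fin (n + 1) → E} (h : e.VerySimple S x)
    {c : Fin (n + 1)} (hc : c ∈ S) (hc' : ∀ j, c < j → j ∉ S) :
    e.t K n (cls (e.KE K) n x) = (-1 : k) ^ ((c : ℕ) * n) • cls (e.KE K) n (rot c x) := by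
  rw [t, LinearMap.sum_apply, Finset.sum_eq_single c]
  · rw [rotTerm_cls]
    congr 3
    funext j
    unfold lastM
    split_ifs with h1 h2
    · rfl
    · subst h2; exact e.piM_of_p (h.mem_M _ hc)
    · exact e.piA_of_i (h.mem_A _ (hc' _ (lt_of_le_of_ne (not_lt.1 h1) (Ne.symm h2))))
  · intro b _ hb
    rw [rotTerm_cls]
    rcases lt_or_gt_of_ne hb with hlt | hlt
    · rw [cls_zero_entry _ (j := c - b), smul_zero]
      simp [rot, lastM, not_lt.2 hlt.le, hb.symm, e.piA_of_p (h.mem_M _ hc)]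
    · rw [cls_zero_entry _ (j := 0), smul_zero]
      simp [rot, lastM, e.piM_of_i (h.mem_A _ (hc' _ hlt))]
  · simp

theorem VerySimple.rot {n : ℕ} {S : Finset (Fin (n + 1))} {x : Fin (n + 1) → E}
    (h : e.VerySimple S x) {c : Fin (n + 1)} (hc : c ∈ S) :
    e.VerySimple (S.image (· - c)) (rot c x) where
  zero_mem := Finset.mem_image.2 ⟨c, hc, sub_self c⟩
  mem_M j hj := by
    obtain ⟨s, hs, rfl⟩ := Finset.mem_image.1 hj
    simpa [RelCyc.rot] using h.mem_M s hs
  mem_A j hj := h.mem_A _ fun hh => hj (Finset.mem_image.2 ⟨j + c, hh, add_sub_cancel_right j c⟩)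

theorem card_rot {n : ℕ} (S : Finset (Fin (n + 1))) (c : Fin (n + 1)) :
    (S.image (· - c)).card = S.card :=
  Finset.card_image_of_injective _ (sub_left_injective)

theorem VerySimple.exists_last {n : ℕ} {S : Finset (Fin (n + 1))} {x : Fin (n + 1) → E}
    (h : e.VerySimple S x) : ∃ c ∈ S, ∀ j, c < j → j ∉ S :=
  ⟨S.max' ⟨0, h.zero_mem⟩, S.max'_mem _, fun j hj hS => absurd (S.le_max' j hS) (not_le.2 hj)⟩

theorem t_mem {n w : ℕ} {z : Cyc (e.KE K) n} (hz : z ∈ e.X K n w) : e.t K n z ∈ e.X K n w := by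
  suffices e.X K n w ≤ (e.X K n w).comap (e.t K n) from this hz
  refine e.X_le fun S x h hS => ?_
  obtain ⟨c, hc, hc'⟩ := h.exists_last
  rw [Submodule.mem_comap, e.t_cls h hc hc']
  exact Submodule.smul_mem _ _ (e.cls_mem_X (h.rot e hc) (by rw [card_rot, hS]))

/-- The places of the `j`-th face that come from entries at places in `S`. -/
def faceSet {n : ℕ} (j : Fin (n + 2)) (S : Finset (Fin (n + 2))) : Finset (Fin (n + 1)) :=
  Finset.univ.filter fun a => if a = slot j then j ∈ S ∨ j + 1 ∈ S else pos j a ∈ S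

theorem mem_faceSet {n : ℕ} {j : Fin (n + 2)} {S : Finset (Fin (n + 2))} {a : Fin (n + 1)} :
    a ∈ faceSet j S ↔ if a = slot j then j ∈ S ∨ j + 1 ∈ S else pos j a ∈ S := by
  simp [faceSet]

theorem card_faceSet {n : ℕ} (j : Fin (n + 2)) (S : Finset (Fin (n + 2))) :
    (faceSet j S).card + (if j ∈ S ∧ j + 1 ∈ S then 1 else 0) = S.card := by
  have h1 : (faceSet j S).card = (S \ {j, j + 1}).card + if j ∈ S ∨ j + 1 ∈ S then 1 else 0 := by
    have : (S \ {j, j + 1}).card =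
        (Finset.univ.filter fun a => a ≠ slot j ∧ pos j a ∈ S).card := by
      symm
      refine Finset.card_bij (fun a _ => pos j a) ?_ ?_ ?_
      · intro a ha
        simp only [Finset.mem_filter, Finset.mem_univ, true_and] at ha
        have := pos_ne j ha.1
        simp [ha.2, this.1, this.2]
      · intro a ha b hb hab
        simp only [Finset.mem_filter, Finset.mem_univ, true_and] at ha hb
        exact pos_inj j ha.1 hb.1 hab
      · intro b hb
        simp only [Finset.mem_sdiff, Finset.mem_insert, Finset.mem_singleton, not_or] at hb
        obtain ⟨a, ha, hp, -⟩ := exists_pos j hb.2.1 hb.2.2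
        exact ⟨a, by simp [ha, hp, hb.1], hp⟩
    rw [this]
    by_cases h : j ∈ S ∨ j + 1 ∈ S
    · rw [if_pos h, ← Finset.card_insert_of_notMem (a := slot j) (by simp)]
      congr 1
      ext a
      by_cases ha : a = slot j <;> simp [mem_faceSet, ha, h]
    · rw [if_neg h, add_zero]
      congr 1
      ext a
      by_cases ha : a = slot j <;> simp [mem_faceSet, ha, h]
  have h2 : S.card = (S \ {j, j + 1}).card + (S ∩ {j, j + 1}).card :=
    (Finset.card_sdiff_add_card_inter S {j, j + 1}).symm
  rw [h1, h2, add_assoc]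
  congr 1
  have hne := succ_ne j
  by_cases ha : j ∈ S <;> by_cases hb : j + 1 ∈ S
  · have : S ∩ {j, j + 1} = {j, j + 1} := by
      rw [Finset.inter_eq_right]; intro x; simp; rintro (rfl | rfl) <;> assumption
    simp [this, ha, hb, Finset.card_pair hne.symm]
  · have : S ∩ {j, j + 1} = {j} := by
      ext x; simp; constructor
      · rintro ⟨h, rfl | rfl⟩ <;> [rfl; exact absurd h hb]
      · rintro rfl; exact ⟨ha, Or.inl rfl⟩
    simp [this, ha, hb]
  · have : S ∩ {j, j + 1} = {j + 1} := by
      ext x; simp; constructor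
      · rintro ⟨h, rfl | rfl⟩ <;> [exact absurd h ha; rfl]
      · rintro rfl; exact ⟨hb, Or.inr rfl⟩
    simp [this, ha, hb]
  · have : S ∩ {j, j + 1} = ∅ := by
      ext x; simp; rintro h; constructor <;> rintro rfl <;> contradiction
    simp [this, ha, hb]

theorem zero_mem_faceSet {n : ℕ} (j : Fin (n + 2)) {S : Finset (Fin (n + 2))} (h : 0 ∈ S) :
    0 ∈ faceSet j S := by
  rw [mem_faceSet]
  have h1 := slot_val j
  split_ifs with h0
  · rw [← h0] at h1
    by_cases hj : (j : ℕ) = n + 1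
    · right
      have : j + 1 = 0 := by apply Fin.ext; rw [val_succ, if_pos hj]; rfl
      rwa [this]
    · left
      rw [if_neg hj] at h1
      have : j = 0 := Fin.ext h1.symm
      rwa [this]
  · have h2 : (slot j : ℕ) ≠ 0 := fun h => h0 (Fin.ext h.symm)
    have : pos j 0 = 0 := by
      have h3 : (j : ℕ) ≠ 0 := by rintro h; rw [h] at h1; simp at h1; exact h2 (by simp [h1])
      apply Fin.ext; rw [pos_val, if_pos (by simpa using Nat.pos_of_ne_zero h3)]; rfl
    rwa [this]

variable {n : ℕ} {S : Finset (Fin (n + 2))} {x : Fin (n + 2) → E}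

/-- `x · y` is zero if both entries are in `M`, and otherwise the face is very simple -/
theorem VerySimple.face_dot (h : e.VerySimple S x) (j : Fin (n + 2)) :
    e.VerySimple (faceSet j S) (face e.dot j x) where
  zero_mem := zero_mem_faceSet j h.zero_mem
  mem_M a ha := by
    rw [mem_faceSet] at ha
    rw [face_apply]
    split_ifs at * with h1
    · rcases ha with ha | ha <;> simp [dot_apply, p_piM, h.mem_M _ ha]
    · exact h.mem_M _ ha
  mem_A a ha := by
    rw [mem_faceSet] at ha
    rw [face_apply]
    split_ifs at * with h1
    · push Not at ha
      have h2 := h.mem_A _ ha.1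
      have h3 := h.mem_A _ ha.2
      rw [dot_apply, e.piM_of_i h2, zero_mul, sub_zero]
      exact mul_mem h2 h3
    · exact h.mem_A _ ha

theorem VerySimple.face_dot_zero (h : e.VerySimple S x) (j : Fin (n + 2))
    (hj : j ∈ S ∧ j + 1 ∈ S) : cls (e.KE K) n (face e.dot j x) = 0 := by
  refine cls_zero_entry _ (j := slot j) ?_
  rw [face_slot, dot_apply, e.piM_of_p (h.mem_M _ hj.1), e.piM_of_p (h.mem_M _ hj.2), sub_self]

theorem VerySimple.face_tri (h : e.VerySimple S x) (j : Fin (n + 2)) (hj : j ∈ S ∧ j + 1 ∈ S) :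
    e.VerySimple (faceSet j S) (face e.tri j x) where
  zero_mem := zero_mem_faceSet j h.zero_mem
  mem_M a ha := by
    rw [mem_faceSet] at ha
    rw [face_apply]
    split_ifs at * with h1
    · simp [tri_apply, p_piM]
    · exact h.mem_M _ ha
  mem_A a ha := by
    rw [mem_faceSet] at ha
    rw [face_apply]
    split_ifs at * with h1
    · exact absurd (Or.inl hj.1) ha
    · exact h.mem_A _ ha

theorem VerySimple.face_tri_zero (h : e.VerySimple S x) (j : Fin (n + 2))
    (hj : ¬ (j ∈ S ∧ j + 1 ∈ S)) : cls (e.KE K) n (face e.tri j x) = 0 := by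
  refine cls_zero_entry _ (j := slot j) ?_
  rw [face_slot, tri_apply]
  by_cases h1 : j ∈ S
  · rw [e.piM_of_i (h.mem_A _ fun h2 => hj ⟨h1, h2⟩), mul_zero]
  · rw [e.piM_of_i (h.mem_A _ h1), zero_mul]

variable (K)

/-- `∑_j μ_j`, where `μ_j` is the `j`-th signed face for the multiplication of the square zero extension. -/
def bFull (n : ℕ) : Cyc (e.KE K) (n + 1) →ₗ[k] Cyc (e.KE K) n := faceSum (e.admissible_dot K) n

/-- `ϱ_j`, the `j`-th signed face for `▽`. -/
def rho (n : ℕ) (j : Fin (n + 2)) : Cyc (e.KE K) (n + 1) →ₗ[k] Cyc (e.KE K) n :=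
  faceMap (e.admissible_tri K) n j

variable {K}

theorem bFull_mem {n w : ℕ} {z : Cyc (e.KE K) (n + 1)} (hz : z ∈ e.X K (n + 1) w) :
    e.bFull K n z ∈ e.X K n w := by
  suffices e.X K (n + 1) w ≤ (e.X K n w).comap (e.bFull K n) from this hz
  refine e.X_le fun S x h hS => ?_
  rw [Submodule.mem_comap, bFull, faceSum_cls]
  refine Submodule.sum_mem _ fun j _ => Submodule.smul_mem _ _ ?_
  by_cases hj : j ∈ S ∧ j + 1 ∈ S
  · rw [h.face_dot_zero e j hj]; exact zero_mem _
  · refine e.cls_mem_X (h.face_dot e j) ?_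
    have := card_faceSet j S
    rw [if_neg hj] at this
    omega

theorem rho_mem {n w : ℕ} (j : Fin (n + 2)) {z : Cyc (e.KE K) (n + 1)}
    (hz : z ∈ e.X K (n + 1) (w + 1)) : e.rho K n j z ∈ e.X K n w := by
  suffices e.X K (n + 1) (w + 1) ≤ (e.X K n w).comap (e.rho K n j) from this hz
  refine e.X_le fun S x h hS => ?_
  rw [Submodule.mem_comap, rho, faceMap_cls]
  refine Submodule.smul_mem _ _ ?_
  by_cases hj : j ∈ S ∧ j + 1 ∈ S
  · refine e.cls_mem_X (h.face_tri e j hj) ?_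
    have := card_faceSet j S
    rw [if_pos hj] at this
    omega
  · rw [h.face_tri_zero e j hj]; exact zero_mem _

/-! ### Rotation of faces -/

theorem val_sub {n : ℕ} (a b : Fin (n + 1)) :
    ((a - b : Fin (n + 1)) : ℕ) = if (b : ℕ) ≤ a then (a : ℕ) - b else (a : ℕ) + (n + 1) - b := by
  rw [Fin.val_sub]
  have := a.isLt
  have := b.isLt
  split_ifs with h
  · rw [show n + 1 - (b : ℕ) + a = (a - b) + (n + 1) by omega, Nat.add_mod_right,
      Nat.mod_eq_of_lt (by omega)]
  · rw [Nat.mod_eq_of_lt (by omega)]; omega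

theorem val_add {n : ℕ} (a b : Fin (n + 1)) :
    ((a + b : Fin (n + 1)) : ℕ) =
      if (a : ℕ) + b < n + 1 then (a : ℕ) + b else (a : ℕ) + b - (n + 1) := by
  rw [Fin.val_add]
  have := a.isLt
  have := b.isLt
  split_ifs with h
  · rw [Nat.mod_eq_of_lt h]
  · rw [Nat.mod_eq_sub_mod (by omega), Nat.mod_eq_of_lt (by omega)]

/-- Rotating and then taking a face is taking a face and then rotating. -/
theorem face_rot {n : ℕ} (op : E →ₗ[k] E →ₗ[k] E) (c j : Fin (n + 2)) (x : Fin (n + 2) → E)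
    (d : Fin (n + 1)) (hd : (d : ℕ) = if (j : ℕ) < c then (c : ℕ) - 1 else (c : ℕ) % (n + 1)) :
    face op (j - c) (rot c x) = rot d (face op j x) := by
  have hd' : (d : ℕ) = if (j : ℕ) < c then (c : ℕ) - 1 else if (c : ℕ) = n + 1 then 0 else c := by
    rw [hd]
    have := c.isLt
    split_ifs with h1 h2
    · rfl
    · rw [h2, Nat.mod_self]
    · exact Nat.mod_eq_of_lt (by omega)
  clear hd
  have e1 : j - c + c = j := by abel
  have e2 : j - c + 1 + c = j + 1 := by abel
  have hs := slot_val j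
  have hs' := slot_val (j - c)
  have hv := val_sub j c
  have hj := j.isLt
  have hc := c.isLt
  have hslot : slot (j - c) + d = slot j := by
    have := val_add (slot (j - c)) d
    apply Fin.ext
    clear e1 e2
    generalize slot (j - c) + d = q at *
    generalize j - c = jc at *
    split_ifs at * <;> omega
  funext a
  show _ = face op j x (a + d)
  by_cases ha : a = slot (j - c)
  · subst ha
    rw [face_slot, hslot, face_slot]
    simp only [rot, e1, e2]
  · have ha' : a + d ≠ slot j := fun h => ha (add_right_cancel (h.trans hslot.symm))
    rw [face_other _ _ _ ha, face_other _ _ _ ha']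
    show x (pos (j - c) a + c) = x (pos j (a + d))
    congr 1
    have h1 := pos_val (j - c) a
    have h2 := pos_val j (a + d)
    have h3 := val_add (pos (j - c) a) c
    have h4 := val_add a d
    have h5 : (a : ℕ) ≠ slot (j - c) := fun h => ha (Fin.ext h)
    have h6 : ((a + d : Fin (n + 1)) : ℕ) ≠ slot j := fun h => ha' (Fin.ext h)
    have h7 := a.isLt
    apply Fin.ext
    clear e1 e2 ha ha' hslot
    generalize pos j (a + d) = q1 at *
    generalize a + d = ad at *
    generalize pos (j - c) a + c = q2 at *
    generalize pos (j - c) a = q3 at *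
    generalize j - c = jc at *
    split_ifs at * <;> omega

end CleftExtension

end Cleft

section Complexes

variable {k A E : Type*} [CommRing k] [Ring A] [Ring E] [Algebra k A] [Algebra k E]

namespace CleftExtension

variable (e : CleftExtension k A E) {K : Subalgebra k A}

theorem neg_one_pow_even_add (a b m : ℕ) (h : a = b + 2 * m) : (-1 : k) ^ a = (-1) ^ b := by
  subst h; simp [pow_add, pow_mul]

/-- The class of a face, cyclically rotated to start at its last entry in `M`. -/
theorem VerySimple.t_face {n : ℕ} {S : Finset (Fin (n + 2))} {x : Fin (n + 2) → E}
    {op : E →ₗ[k] E →ₗ[k] E} {c j : Fin (n + 2)} (hc : c ∈ S)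
    (hc' : ∀ j, c < j → j ∉ S) (hcj : ¬ ((j : ℕ) = n + 1 ∧ (c : ℕ) = n + 1))
    (hf : e.VerySimple (faceSet j S) (face op j x)) :
    (-1 : k) ^ (j : ℕ) • e.t K n (cls (e.KE K) n (face op j x)) =
      (-1 : k) ^ ((c : ℕ) * (n + 1)) • (-1 : k) ^ ((j - c : Fin (n + 2)) : ℕ) •
        cls (e.KE K) n (face op (j - c) (RelCyc.rot c x)) := by
  have hjlt := j.isLt
  have hclt := c.isLt
  obtain ⟨d, hd⟩ : ∃ d : Fin (n + 1),
      (d : ℕ) = if (j : ℕ) < c then (c : ℕ) - 1 else (c : ℕ) % (n + 1) := by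
    have hlt : (if (j : ℕ) < c then (c : ℕ) - 1 else (c : ℕ) % (n + 1)) < n + 1 := by
      split_ifs
      · omega
      · exact Nat.mod_lt _ n.succ_pos
    exact ⟨⟨_, hlt⟩, rfl⟩
  have hd' : (d : ℕ) = if (j : ℕ) < c then (c : ℕ) - 1 else c := by
    rw [hd]
    split_ifs with h1
    · rfl
    · exact Nat.mod_eq_of_lt (by omega)
  have hs := slot_val j
  have hv := val_succ j
  have h1 : d ∈ faceSet j S := by
    rw [mem_faceSet]
    split_ifs with h
    · rw [← h] at hs
      by_cases hjc : (j : ℕ) < c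
      · right
        have : j + 1 = c := by
          apply Fin.ext
          clear h hf
          generalize j + 1 = j' at *
          split_ifs at * <;> omega
        rwa [this]
      · by_cases hjn : (j : ℕ) = n + 1
        · right
          have : j + 1 = c := by
            apply Fin.ext
            clear h hf
            generalize j + 1 = j' at *
            split_ifs at * <;> omega
          rwa [this]
        · left
          have : j = c := by
            apply Fin.ext
            split_ifs at * <;> omega
          rwa [this]
    · have : pos j d = c := by
        have h2 : (d : ℕ) ≠ slot j := fun hh => h (Fin.ext hh)
        have h3 := pos_val j d
        apply Fin.ext
        generalize pos j d = q at *
        split_ifs at * <;> omega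
      rwa [this]
  have h2 : ∀ a, d < a → a ∉ faceSet j S := by
    intro a ha hmem
    rw [Fin.lt_def] at ha
    rw [mem_faceSet] at hmem
    have halt := a.isLt
    split_ifs at hmem with h
    · rw [← h] at hs
      rcases hmem with hm | hm
      · refine hc' _ ?_ hm
        rw [Fin.lt_def]
        split_ifs at * <;> omega
      · refine hc' _ ?_ hm
        rw [Fin.lt_def]
        clear hm h hf
        generalize j + 1 = j' at *
        split_ifs at * <;> omega
    · refine hc' _ ?_ hmem
      have h2 : (a : ℕ) ≠ slot j := fun hh => h (Fin.ext hh)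
      have h3 := pos_val j a
      rw [Fin.lt_def]
      clear hmem
      generalize pos j a = q at *
      split_ifs at * <;> omega
  rw [e.t_cls hf h1 h2, ← face_rot op c j x d hd, smul_smul, smul_smul, ← pow_add, ← pow_add]
  congr 1
  have hsub := val_sub j c
  rw [hsub]
  by_cases hjc : (j : ℕ) < c
  · rw [if_pos hjc] at hd'
    symm
    rw [if_neg (by omega)]
    refine neg_one_pow_even_add _ _ (n + 1) ?_
    have hc1 : (c : ℕ) = d + 1 := by omega
    rw [hc1]
    have : (j : ℕ) + (n + 1 + 1) - (d + 1) = (j + (n + 1)) - d := by omega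
    rw [this]
    have : (j + (n + 1)) - (d : ℕ) + d = j + (n + 1) := by omega
    ring_nf at this ⊢
    omega
  · rw [if_neg hjc] at hd'
    rw [if_pos (by omega), hd']
    congr 1
    have : (c : ℕ) * (n + 1) = c * n + c := by ring
    omega

theorem bFull_t {n w : ℕ} {z : Cyc (e.KE K) (n + 1)} (hz : z ∈ e.X K (n + 1) w) :
    e.bFull K n (e.t K (n + 1) z) = e.t K n (e.bFull K n z) := by
  suffices e.X K (n + 1) w ≤ LinearMap.eqLocus (e.bFull K n ∘ₗ e.t K (n + 1))
    (e.t K n ∘ₗ e.bFull K n) from this hz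
  refine e.X_le fun S x h hS => ?_
  rw [LinearMap.mem_eqLocus, LinearMap.comp_apply, LinearMap.comp_apply]
  obtain ⟨c, hc, hc'⟩ := h.exists_last
  rw [e.t_cls h hc hc', map_smul, bFull, faceSum_cls, faceSum_cls, map_sum,
    ← Equiv.sum_comp (Equiv.subRight c), Finset.smul_sum]
  refine Finset.sum_congr rfl fun j _ => ?_
  rw [map_smul, Equiv.subRight_apply]
  by_cases hj : j ∈ S ∧ j + 1 ∈ S
  · rw [h.face_dot_zero e j hj, (h.rot e hc).face_dot_zero e (j - c)
      ⟨Finset.mem_image_of_mem _ hj.1, Finset.mem_image.2 ⟨j + 1, hj.2, by abel⟩⟩]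
    simp
  · refine (VerySimple.t_face e hc hc' ?_ (h.face_dot e j)).symm
    rintro ⟨h1, h2⟩
    have e1 : j = c := Fin.ext (h1.trans h2.symm)
    have e2 : j + 1 = 0 := by apply Fin.ext; rw [val_succ, if_pos h1]; rfl
    exact hj ⟨e1 ▸ hc, e2 ▸ h.zero_mem⟩

theorem rho_sum_t {n w : ℕ} {z : Cyc (e.KE K) (n + 1)} (hz : z ∈ e.X K (n + 1) w) :
    ∑ j, e.rho K n j (e.t K (n + 1) z) =
      e.t K n (∑ j : Fin (n + 1), e.rho K n j.castSucc z) + e.rho K n (Fin.last _) z := by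
  suffices e.X K (n + 1) w ≤ LinearMap.eqLocus ((∑ j, e.rho K n j) ∘ₗ e.t K (n + 1))
    (e.t K n ∘ₗ (∑ j : Fin (n + 1), e.rho K n j.castSucc) + e.rho K n (Fin.last _)) by
    simpa using this hz
  refine e.X_le fun S x h hS => ?_
  rw [LinearMap.mem_eqLocus, LinearMap.comp_apply, LinearMap.add_apply, LinearMap.comp_apply]
  obtain ⟨c, hc, hc'⟩ := h.exists_last
  rw [e.t_cls h hc hc', map_smul, LinearMap.sum_apply, LinearMap.sum_apply, map_sum,
    ← Equiv.sum_comp (Equiv.subRight c), Finset.smul_sum, Fin.sum_univ_castSucc]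
  simp only [rho, faceMap_cls, map_smul, Equiv.subRight_apply]
  congr 1
  · refine Finset.sum_congr rfl fun j _ => ?_
    by_cases hj : j.castSucc ∈ S ∧ j.castSucc + 1 ∈ S
    · refine (VerySimple.t_face e hc hc' ?_ (h.face_tri e _ hj)).symm
      rintro ⟨h1, -⟩
      simp only [Fin.val_castSucc] at h1
      omega
    · rw [h.face_tri_zero e _ hj, (h.rot e hc).face_tri_zero e (j.castSucc - c) ?_]
      · simp
      · rintro ⟨h1, h2⟩
        simp only [Finset.mem_image, sub_left_inj, exists_eq_right] at h1
        obtain ⟨s, hs, hs'⟩ := Finset.mem_image.1 h2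
        have : s = j.castSucc + 1 := by
          have := congrArg (· + c) hs'
          simp only [sub_add_cancel] at this
          rw [this]; abel
        exact hj ⟨h1, this ▸ hs⟩
  · by_cases hl : c = Fin.last _
    · subst hl
      rw [sub_self]
      have := face_rot e.tri (Fin.last (n + 1)) (Fin.last (n + 1)) x 0 (by simp)
      rw [sub_self] at this
      rw [this]
      have h0 : ∀ y : Fin (n + 1) → E, RelCyc.rot 0 y = y := fun y => by funext a; simp [RelCyc.rot]
      rw [h0, smul_smul]
      congr 1
      simp only [Fin.val_last, Fin.val_zero, pow_zero, mul_one]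
      rw [pow_mul, ← pow_mul, ← sq, pow_two, pow_mul]
      rcases neg_one_pow_eq_or k (n + 1) with h | h <;> simp [h]
    · have hlS : Fin.last (n + 1) ∉ S := hc' _ (lt_of_le_of_ne (Fin.le_last c) hl)
      rw [h.face_tri_zero e _ fun hh => hlS hh.1,
        (h.rot e hc).face_tri_zero e (Fin.last (n + 1) - c) ?_]
      · simp
      · rintro ⟨h1, h2⟩
        simp only [Finset.mem_image, sub_left_inj, exists_eq_right] at h1
        exact hlS h1

theorem t_pow_cls {n w : ℕ} {S : Finset (Fin (n + 1))} {x : Fin (n + 1) → E}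
    (h : e.VerySimple S x) (hS : S.card = w + 1) (l : ℕ) (hl : l ≤ w) :
    ∃ c ∈ S, (S.filter (· < c)).card + l = w ∧ (e.t K n ^ (l + 1)) (cls (e.KE K) n x) =
      (-1 : k) ^ ((c : ℕ) * n) • cls (e.KE K) n (RelCyc.rot c x) := by
  induction l with
  | zero =>
    obtain ⟨c, hc, hc'⟩ := h.exists_last
    refine ⟨c, hc, ?_, by rw [zero_add, pow_one, e.t_cls h hc hc']⟩
    have : S.filter (· < c) = S.erase c := by
      ext a
      simp only [Finset.mem_filter, Finset.mem_erase]
      refine ⟨fun ha => ⟨ha.2.ne, ha.1⟩, fun ha => ⟨ha.2, lt_of_le_of_ne ?_ ha.1⟩⟩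
      by_contra hh
      exact hc' a (not_le.1 hh) ha.2
    rw [this, Finset.card_erase_of_mem hc, hS]
    rfl
  | succ l ih =>
    obtain ⟨c, hc, hcard, ht⟩ := ih (by omega)
    have hne : (S.filter (· < c)).Nonempty := Finset.card_pos.1 (by omega)
    set c' := (S.filter (· < c)).max' hne with hc'def
    have hc'mem := (S.filter (· < c)).max'_mem hne
    rw [← hc'def, Finset.mem_filter] at hc'mem
    have hmax : ∀ s ∈ S, s < c → s ≤ c' := fun s hs hsc =>
      (S.filter (· < c)).le_max' s (Finset.mem_filter.2 ⟨hs, hsc⟩)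
    have hval := val_sub c' c
    have hlt : (c' : ℕ) < c := hc'mem.2
    rw [if_neg (by omega)] at hval
    refine ⟨c', hc'mem.1, ?_, ?_⟩
    · have : S.filter (· < c') = (S.filter (· < c)).erase c' := by
        ext a
        simp only [Finset.mem_filter, Finset.mem_erase]
        refine ⟨fun ha => ⟨ha.2.ne, ha.1, ha.2.trans hc'mem.2⟩, fun ha => ⟨ha.2.1, lt_of_le_of_ne ?_ ha.1⟩⟩
        exact hmax _ ha.2.1 ha.2.2
      rw [this, Finset.card_erase_of_mem (Finset.mem_filter.2 hc'mem)]
      have := Finset.card_pos.2 hne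
      omega
    · rw [pow_succ', Module.End.mul_apply, ht, map_smul, e.t_cls (h.rot e hc)
        (c := c' - c) (Finset.mem_image_of_mem _ hc'mem.1) ?_, smul_smul, ← pow_add]
      · have : RelCyc.rot (c' - c) (RelCyc.rot c x) = RelCyc.rot c' x := by
          funext a; simp [RelCyc.rot, add_assoc]
        rw [this]
        congr 1
        obtain ⟨m, hm⟩ : ∃ m, n * (n + 1) = 2 * m := by
          obtain ⟨m, hm⟩ := Nat.even_mul_succ_self n
          exact ⟨m, by rw [hm]; ring⟩
        refine neg_one_pow_even_add _ _ m ?_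
        rw [← hm, hval, ← add_mul]
        have : (c : ℕ) + (c' + (n + 1) - c) = c' + (n + 1) := by have := c.isLt; omega
        rw [this]; ring
      · rintro a ha hmem
        obtain ⟨s, hs, rfl⟩ := Finset.mem_image.1 hmem
        rw [Fin.lt_def, hval] at ha
        have hvs := val_sub s c
        have h1 := s.isLt
        have h2 := c.isLt
        have h3 : (s : ℕ) < c → (s : ℕ) ≤ c' := fun hh => hmax s hs hh
        rw [hvs] at ha
        split_ifs at * <;> omega

theorem t_pow_eq {n w : ℕ} {z : Cyc (e.KE K) n} (hz : z ∈ e.X K n w) :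
    (e.t K n ^ (w + 1)) z = z := by
  suffices e.X K n w ≤ LinearMap.eqLocus (e.t K n ^ (w + 1)) LinearMap.id from this hz
  refine e.X_le fun S x h hS => ?_
  rw [LinearMap.mem_eqLocus, LinearMap.id_apply]
  obtain ⟨c, hc, hcard, ht⟩ := e.t_pow_cls (K := K) h hS w le_rfl
  have hc0 : c = 0 := by
    by_contra hne
    have : 0 ∈ S.filter (· < c) := Finset.mem_filter.2 ⟨h.zero_mem, Fin.pos_of_ne_zero hne⟩
    have := Finset.card_pos.2 ⟨_, this⟩
    omega
  subst hc0
  rw [ht]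
  simp only [Fin.val_zero, zero_mul, pow_zero, one_smul]
  congr 1
  funext a
  simp [RelCyc.rot]

/-! ### The double complexes -/

variable (K)

/-- The operator `t` on `X_{v,w}`. -/
def tX (n w : ℕ) : e.X K n w →ₗ[k] e.X K n w := (e.t K n).restrict fun _ hz => e.t_mem hz

/-- `b = ∑_{j=0}^n μ_j : X_{v,w} → X_{v-1,w}`. -/
def bX (n w : ℕ) : e.X K (n + 1) w →ₗ[k] e.X K n w :=
  (e.bFull K n).restrict fun _ hz => e.bFull_mem hz

/-- `ϱ_j : X_{v,w} → X_{v,w-1}`. -/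
def rhoX (n w : ℕ) (j : Fin (n + 2)) : e.X K (n + 1) (w + 1) →ₗ[k] e.X K n w :=
  (e.rho K n j).restrict fun _ hz => e.rho_mem j hz

/-- `d' = ∑_{j=0}^{n-1} ϱ_j : X_{v,w} → X_{v,w-1}`. -/
def dPrimeX (n w : ℕ) : e.X K (n + 1) (w + 1) →ₗ[k] e.X K n w :=
  ∑ j : Fin (n + 1), e.rhoX K n w j.castSucc

/-- `d = d' + ϱ_n : X_{v,w} → X_{v,w-1}`. -/
def dX (n w : ℕ) : e.X K (n + 1) (w + 1) →ₗ[k] e.X K n w :=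
  e.dPrimeX K n w + e.rhoX K n w (Fin.last (n + 1))

/-- `N = ∑_{l=0}^w t^l`. -/
def NX (n w : ℕ) : e.X K n w →ₗ[k] e.X K n w := ∑ l ∈ Finset.range (w + 1), e.tX K n w ^ l

/-- `X̄_{v,w} = X_{v,w} / im (id - t)`, with `n = v + w`. -/
def Xbar (n w : ℕ) : Type _ := e.X K n w ⧸ LinearMap.range (LinearMap.id - e.tX K n w)

instance (n w : ℕ) : AddCommGroup (e.Xbar K n w) :=
  inferInstanceAs (AddCommGroup (e.X K n w ⧸ LinearMap.range (LinearMap.id - e.tX K n w)))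

instance (n w : ℕ) : Module k (e.Xbar K n w) :=
  inferInstanceAs (Module k (e.X K n w ⧸ LinearMap.range (LinearMap.id - e.tX K n w)))

/-- The quotient map `X_{v,w} → X̄_{v,w}`. -/
def toBar (n w : ℕ) : e.X K n w →ₗ[k] e.Xbar K n w :=
  (LinearMap.range (LinearMap.id - e.tX K n w)).mkQ

theorem bX_t (n w : ℕ) (z : e.X K (n + 1) w) :
    e.bX K n w (e.tX K (n + 1) w z) = e.tX K n w (e.bX K n w z) :=
  Subtype.ext (e.bFull_t z.2)

theorem dX_sub_t (n w : ℕ) (z : e.X K (n + 1) (w + 1)) :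
    e.dX K n w (z - e.tX K (n + 1) (w + 1) z) =
      e.dPrimeX K n w z - e.tX K n w (e.dPrimeX K n w z) := by
  have h1 : ∀ z : e.X K (n + 1) (w + 1), e.dX K n w z = ∑ j, e.rhoX K n w j z := fun z => by
    rw [dX, LinearMap.add_apply, dPrimeX, LinearMap.sum_apply]
    exact (Fin.sum_univ_castSucc fun j => e.rhoX K n w j z).symm
  have h2 : e.dX K n w (e.tX K (n + 1) (w + 1) z) =
      e.tX K n w (e.dPrimeX K n w z) + e.rhoX K n w (Fin.last (n + 1)) z := by
    rw [h1]
    apply Subtype.ext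
    have := e.rho_sum_t z.2
    simpa [dPrimeX, rhoX, tX] using this
  rw [map_sub, h2, dX, LinearMap.add_apply]
  abel

theorem NX_t (n w : ℕ) (z : e.X K n w) : e.NX K n w (e.tX K n w z) = e.NX K n w z := by
  have h : (e.tX K n w ^ (w + 1)) z = z := by
    apply Subtype.ext
    have : ∀ l : ℕ, (((e.tX K n w ^ l) z : e.X K n w) : Cyc (e.KE K) n) = (e.t K n ^ l) z := by
      intro l
      induction l with
      | zero => simp
      | succ l ih => rw [pow_succ', pow_succ', Module.End.mul_apply, Module.End.mul_apply, ← ih]; rfl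
    rw [this, e.t_pow_eq z.2]
  have h3 : ∀ l, (e.tX K n w ^ l) (e.tX K n w z) = (e.tX K n w ^ (l + 1)) z := fun l => by
    rw [pow_succ, Module.End.mul_apply]
  simp only [NX, LinearMap.sum_apply, h3]
  rw [Finset.sum_range_succ, h, Finset.sum_range_succ' _ w]
  simp

/-- The map `b̄ : X̄_{v,w} → X̄_{v-1,w}` induced by `b`. -/
def bBar (n w : ℕ) : e.Xbar K (n + 1) w →ₗ[k] e.Xbar K n w :=
  Submodule.mapQ _ _ (e.bX K n w) <| by
    rintro _ ⟨z, rfl⟩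
    exact ⟨e.bX K n w z, by simp [bX_t]⟩

/-- The map `d̄ : X̄_{v,w} → X̄_{v,w-1}` induced by `d`. -/
def dBar (n w : ℕ) : e.Xbar K (n + 1) (w + 1) →ₗ[k] e.Xbar K n w :=
  Submodule.mapQ _ _ (e.dX K n w) <| by
    rintro _ ⟨z, rfl⟩
    exact ⟨e.dPrimeX K n w z, by
      simpa only [LinearMap.sub_apply, LinearMap.id_apply] using (e.dX_sub_t K n w z).symm⟩

/-- The map `N̄ : X̄_{v,w} → X_{v,w}` induced by `N`. -/
def NBar (n w : ℕ) : e.Xbar K n w →ₗ[k] e.X K n w :=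
  Submodule.liftQ _ (e.NX K n w) <| by
    rintro _ ⟨z, rfl⟩
    simp [NX_t]

/-- `σ' = ∑_{j=0}^{w-1} (w - j) / (w + 1) t^j`. -/
def sigma' [Algebra ℚ k] (n w : ℕ) : e.X K n w →ₗ[k] e.X K n w :=
  ∑ j ∈ Finset.range w, algebraMap ℚ k (((w : ℚ) - j) / (w + 1)) • e.tX K n w ^ j

/-- `𝔭 : X_{v,w} → X̄_{v,w}`, the quotient map divided by `w + 1`. -/
def pp [Algebra ℚ k] (n w : ℕ) : e.X K n w →ₗ[k] e.Xbar K n w :=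
  algebraMap ℚ k (1 / ((w : ℚ) + 1)) • e.toBar K n w

/-- `ξ̄ = 1 / (w + 1) 𝔭 ∘ d' ∘ σ' ∘ d ∘ N̄ : X̄_{v,w} → X̄_{v,w-2}` for `w ≥ 2`
(written here with `w + 2` in place of `w`). -/
def xiBar [Algebra ℚ k] (n w : ℕ) : e.Xbar K (n + 2) (w + 2) →ₗ[k] e.Xbar K n w :=
  algebraMap ℚ k (1 / ((w : ℚ) + 2 + 1)) •
    (e.pp K n w ∘ₗ e.dPrimeX K n w ∘ₗ e.sigma' K (n + 1) (w + 1) ∘ₗ e.dX K (n + 1) (w + 1) ∘ₗ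
      e.NBar K (n + 2) (w + 2))

/-- `Υ = (-id + N̄ ∘ 𝔭) ∘ σ' ∘ d : X_{v,w} → X_{v,w-1}` for `w ≥ 1`
(written here with `w + 1` in place of `w`). -/
def Upsilon [Algebra ℚ k] (n w : ℕ) : e.X K (n + 1) (w + 1) →ₗ[k] e.X K n w :=
  (-LinearMap.id + e.NBar K n w ∘ₗ e.pp K n w) ∘ₗ e.sigma' K n w ∘ₗ e.dX K n w

/-! ### Total complexes and the maps of Connes sequence -/

/-- The ambient product of all the `E ⊗ Ē^{⊗ n} ⊗`. -/
abbrev RelTot : Type _ := ∀ n : ℕ, Cyc (e.KE K) n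

/-- The degree `m` part of the relative complex: the kernel of `E ⊗ Ē^{⊗ m} ⊗ → A ⊗ Ā^{⊗ m} ⊗`,
which is zero for `m < 0`. -/
def relDeg (m : ℤ) : Submodule k (e.RelTot K) :=
  Submodule.pi {n : ℕ | (n : ℤ) ≠ m} (fun _ => ⊥) ⊓
    Submodule.pi Set.univ (fun n => LinearMap.ker (e.proj K n))

/-- The Hochschild boundary. With `relDeg`, its homology is `HH_*(E, M)`. -/
def relb : e.RelTot K →ₗ[k] e.RelTot K :=
  LinearMap.pi fun n => e.hochschild K n ∘ₗ LinearMap.proj (n + 1)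

/-- The Connes operator `B(x₀ ⊗ ⋯ ⊗ xₙ) = ∑_c (-1)^{c n} 1 ⊗ x_c ⊗ ⋯ ⊗ xₙ ⊗ x₀ ⊗ ⋯ ⊗ x_{c-1}`. -/
def connesB (n : ℕ) : Cyc (e.KE K) n →ₗ[k] Cyc (e.KE K) (n + 1) :=
  ∑ c : Fin (n + 1), unitRot (e.KE K) n c

/-- The Connes operator on the product of all degrees. -/
def relB : e.RelTot K →ₗ[k] e.RelTot K :=
  LinearMap.pi fun n => match n with
    | 0 => 0
    | n + 1 => e.connesB K n ∘ₗ LinearMap.proj n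

/-- Sequences `z = (z₀, z₁, …)`; the column `j` is `z_j`. -/
abbrev BCTot : Type _ := ℕ → e.RelTot K

/-- The degree `m` part of the total complex of `BC`: sequences with `z_j` of degree `m - 2 j`. -/
def bcDeg (m : ℤ) : Submodule k (e.BCTot K) :=
  Submodule.pi Set.univ fun j : ℕ => e.relDeg K (m - 2 * j)

/-- The differential `(D z)_j = b z_j + B z_{j+1}`. With `bcDeg`, its homology is `HC_*(E, M)`. -/
def bcD : e.BCTot K →ₗ[k] e.BCTot K :=
  LinearMap.pi fun j => e.relb K ∘ₗ LinearMap.proj j + e.relB K ∘ₗ LinearMap.proj (j + 1)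

/-- `I`: the inclusion of the column `0`. -/
def mapI : e.RelTot K →ₗ[k] e.BCTot K := LinearMap.single k (fun _ : ℕ => e.RelTot K) 0

/-- `S`: the quotient map that deletes the column `0`, followed by the shift of the columns. -/
def mapS : e.BCTot K →ₗ[k] e.BCTot K := LinearMap.pi fun j => LinearMap.proj (j + 1)

/-- The map `z ↦ B z₀`, which induces the connecting map `HC_n → HH_{n+1}` of the exact sequence with
maps `I` and `S`; see `snake`. -/
def mapB : e.BCTot K →ₗ[k] e.RelTot K := e.relB K ∘ₗ LinearMap.proj 0

/-- A cycle `z` has, under `S`, a preimage `z'` with zero column `0`, and then `D z' = I (B z₀)`: the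
connecting map is `[z] ↦ [B z₀]`. -/
theorem snake (z z' : e.BCTot K) (hz' : e.mapS K z' = z) (h0 : z' 0 = 0) (hz : e.bcD K z = 0) :
    e.bcD K z' = e.mapI K (e.mapB K z) := by
  subst hz'
  funext j
  cases j with
  | zero => simp [bcD, mapI, mapB, mapS, h0]
  | succ j =>
    have := congrFun hz j
    simpa [bcD, mapI, mapS] using this

/-- The ambient product of all the `X̄_{v,w}`, indexed by `n = v + w` and `w`. -/
abbrev BarTot : Type _ := ∀ n w : ℕ, e.Xbar K n w

/-- The degree `m` part of `Tot X̄`; only the finitely many `w ≤ m` give nonzero modules `X̄_{v,w}`. -/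
def barDeg (m : ℤ) : Submodule k (e.BarTot K) :=
  Submodule.pi {n : ℕ | (n : ℤ) ≠ m} fun _ => ⊥

/-- The component in `X̄_{v,w}`, `n = v + w`. -/
def barComp (n w : ℕ) : e.BarTot K →ₗ[k] e.Xbar K n w := LinearMap.proj w ∘ₗ LinearMap.proj n

/-- The differential `b̄ + d̄` of `Tot X̄`. -/
def barD : e.BarTot K →ₗ[k] e.BarTot K :=
  LinearMap.pi fun n => LinearMap.pi fun w =>
    e.bBar K n w ∘ₗ e.barComp K (n + 1) w + e.dBar K n w ∘ₗ e.barComp K (n + 1) (w + 1)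

/-- The map given by `ξ̄` on `Tot X̄`, of degree `-2`; it is zero on `X̄_{v,w}` for `w ≤ 1`. -/
def barXi [Algebra ℚ k] : e.BarTot K →ₗ[k] e.BarTot K :=
  LinearMap.pi fun n => LinearMap.pi fun w => e.xiBar K n w ∘ₗ e.barComp K (n + 2) (w + 2)

/-- `X̃_{v,w} = X̄_{v,w} ⊕ X̄_{v,w-1}`, in total form. -/
abbrev TildeTot : Type _ := e.BarTot K × e.BarTot K

/-- The degree `m` part of `Tot X̃`: `Tot_m X̄ ⊕ Tot_{m-1} X̄`. -/
def tildeDeg (m : ℤ) : Submodule k (e.TildeTot K) := (e.barDeg K m).prod (e.barDeg K (m - 1))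

/-- The differential `(x, y) ↦ (b̄ x + d̄ x, ξ̄ x - b̄ y - d̄ y)` of `Tot X̃`. -/
def tildeD [Algebra ℚ k] : e.TildeTot K →ₗ[k] e.TildeTot K :=
  (e.barD K ∘ₗ LinearMap.fst k _ _).prod
    (e.barXi K ∘ₗ LinearMap.fst k _ _ - e.barD K ∘ₗ LinearMap.snd k _ _)

/-- The inclusion `i : y ↦ (0, y)`. -/
def mapi : e.BarTot K →ₗ[k] e.TildeTot K := LinearMap.inr k _ _

/-- The projection `π : (x, y) ↦ x`. -/
def mappi : e.TildeTot K →ₗ[k] e.BarTot K := LinearMap.fst k _ _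

/-! ### The comparison maps -/

theorem patProj_mem {n w : ℕ} {S : Finset (Fin (n + 1))} (h0 : 0 ∈ S) (hS : S.card = w + 1)
    (z : Cyc (e.KE K) n) : e.patProj K S z ∈ e.X K n w := by
  suffices (⊤ : Submodule k (Cyc (e.KE K) n)) ≤ (e.X K n w).comap (e.patProj K S) from
    this Submodule.mem_top
  rw [← Cyc.span_cls, Submodule.span_le]
  rintro _ ⟨x, rfl⟩
  refine (?_ : e.patProj K S (cls (e.KE K) n x) ∈ e.X K n w)
  rw [patProj, mapFactors_cls]
  refine e.cls_mem_X ⟨h0, fun j hj => ?_, fun j hj => ?_⟩ hS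
  · simp [hj, p_piM]
  · simp only [hj, if_false]
    exact ⟨e.p (x j), rfl⟩

/-- The projection of `E ⊗ Ē^{⊗ n} ⊗` on `X_{v,w}`. -/
def toX (n w : ℕ) : Cyc (e.KE K) n →ₗ[k] e.X K n w :=
  LinearMap.codRestrict _
    (∑ S ∈ Finset.univ.filter fun S : Finset (Fin (n + 1)) => 0 ∈ S ∧ S.card = w + 1,
      e.patProj K S)
    (fun z => by
      rw [LinearMap.sum_apply]
      refine Submodule.sum_mem _ fun S hS => ?_
      rw [Finset.mem_filter] at hS
      exact e.patProj_mem K hS.2.1 hS.2.2 z)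

/-- The first component `(x, y) ↦ x + t y` of `θ̂`, followed by the projection on `X_{v,w}`, where
`(x, y)` is the decomposition in tensors that start with an entry in `M` and in `A`. -/
def theta (n w : ℕ) : Cyc (e.KE K) n →ₗ[k] e.X K n w :=
  e.toX K n w ∘ₗ (LinearMap.id + e.t K n ∘ₗ e.zeroProjA K n)

/-- The comparison map `Θ : z ↦ [x₀ + t y₀]` from the total complex of `BC` to `Tot X̄`,
where `z₀ = (x₀, y₀)`. -/
def mapTheta : e.BCTot K →ₗ[k] e.BarTot K :=
  LinearMap.pi fun n => LinearMap.pi fun w =>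
    e.toBar K n w ∘ₗ e.theta K n w ∘ₗ LinearMap.proj n ∘ₗ LinearMap.proj 0

/-- The second component `y ↦ ∑_{l=0}^{n-c} 1 ⊗ 𝔱^l(y)` of `ϑ̂`, where `c` is the place of the last entry
of `y = y₀ ⊗ ⋯ ⊗ yₙ` that is in `M` and `𝔱(y) = (-1)^n yₙ ⊗ y₀ ⊗ ⋯ ⊗ y_{n-1}`. -/
def vartheta (n : ℕ) : Cyc (e.KE K) n →ₗ[k] Cyc (e.KE K) (n + 1) :=
  ∑ c : Fin (n + 1), ∑ l ∈ Finset.univ.filter fun l : Fin (n + 1) => (l : ℕ) ≤ n - c,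
    unitRot (e.KE K) n (-l) ∘ₗ e.lastProj K c

/-- The first component `1 / (w + 1) N̄ x` of `Ψ(x, y)`. -/
def psiFst [Algebra ℚ k] (n w : ℕ) : e.TildeTot K →ₗ[k] e.X K n w :=
  algebraMap ℚ k (1 / ((w : ℚ) + 1)) • (e.NBar K n w ∘ₗ e.barComp K n w ∘ₗ LinearMap.fst k _ _)

/-- The second component `1 / (w + 2) Υ N̄ x_{w+1} + N̄ y_w` of `Ψ(x, y)`, in `X_{v,w}`. -/
def psiSnd [Algebra ℚ k] (n w : ℕ) : e.TildeTot K →ₗ[k] e.X K n w :=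
  algebraMap ℚ k (1 / ((w : ℚ) + 1 + 1)) • (e.Upsilon K n w ∘ₗ e.NBar K (n + 1) (w + 1) ∘ₗ
      e.barComp K (n + 1) (w + 1) ∘ₗ LinearMap.fst k _ _) +
    e.NBar K n w ∘ₗ e.barComp K n w ∘ₗ LinearMap.snd k _ _

/-- The comparison map `Φ = ϑ̂ ∘ Ψ` from `Tot X̃` to the relative Hochschild complex. -/
def mapPhi [Algebra ℚ k] : e.TildeTot K →ₗ[k] e.RelTot K :=
  LinearMap.pi fun n =>
    (∑ w ∈ Finset.range (n + 1), (e.X K n w).subtype ∘ₗ e.psiFst K n w) +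
    match n with
    | 0 => 0
    | n + 1 => e.vartheta K n ∘ₗ
        ∑ w ∈ Finset.range (n + 1), (e.X K n w).subtype ∘ₗ e.psiSnd K n w

end CleftExtension

end Complexes

end RelCyc

/-! The Hochschild complex of the pair is almost contracted by `vartheta` onto the tensors that
start with an entry in `M`. Let `ι` include the product of the `X_{vw}`, let `T` be the operator `t`
on all relative tensors, and let `λ` be the signed last face formed with the `M`-component of the
last entry (`lastFace`). Then `b ϑ + ϑ b = id - ι T + ϑ ι λ` (`hochschild_vartheta`). To prove it,
put a unit in front of a sum of consecutive rotations of a tensor. The two outer faces telescope to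
`x - t x`, and the inner faces give `ϑ` of the faces of `x`. The exception is the last face when the
last entry of `x` lies in `M`; this is the correction `ϑ ι λ`. The powers of `t` visit every place
of `M` once, so the same sums give `B = ϑ ι N T` (`connesB_eq_sum_vartheta`).

The rest is algebra with operators. An element `ι v + ϑ ι u` determines `v` and `u`
(`BaseModel.eq_zero_of_add`). So the relations between `δ = b + d`, `δ' = b + d'`, `t` and `N`, such
as `δ (1 - t) = (1 - t) δ'` and `δ' N = N δ`, follow from `b² = 0`, `bB + Bb = 0` and the homotopy
formula by comparing components. Because `k` contains `ℚ`, there is an operator `σ` with `(1 - t) σ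
= 1 - N / (w + 1)` and `N σ = σ N = 0`. With `u = N̄ x / (w + 1)`, the map `Φ` becomes `Φ(x, y) = ι
u + ϑ ι (N̄ y - σ δ u)`. It is injective, intertwines `b` with the differential of `X̃`
(`Model.b_Φ`), and has the inverse `Ω` up to homotopy (`Model.sub_Ω_Φ`, `Model.sub_Φ_Ω`).

Cyclic homology enters through `B Φ(x, y) = Φ(0, x)` (`Model.B_Φ`). It makes `Ξ x = (Φ(x, 0), -Φ(ξ̄
x, 0), Φ(ξ̄² x, 0), …)` a chain map with `Θ Ξ = id` and `S Ξ = -Ξ ξ̄`. A cycle killed by `Θ` is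
filled in column by column (`Model.exists_of_Θ_eq_zero`), so `Ξ` inverts `Θ` on homology. The
formulas for `S` and `B` are then read off on cycles of the form `Ξ x`; the one for `I` already
holds on chains. -/

namespace RelCyc

/-! ### Rotations of a tensor behind a unit, and their Hochschild boundary. -/

section Rotation
variable {k : Type*} [CommRing k] {C : Type*} [Ring C] [Algebra k C] {n : ℕ}

/-- Rotations are indexed by natural numbers up to `n + 1` rather than by `Fin (n + 1)`, so that
consecutive ones fill intervals `Ioc c (n + 1)`. The value `n + 1` stands for the full rotation. -/
theorem ofNat_val {r : ℕ} (hr : r ≤ n + 1) :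
    ((Fin.ofNat (n + 1) r : Fin (n + 1)) : ℕ) = if r = n + 1 then 0 else r := by
  simp only [Fin.ofNat]
  split_ifs with h
  · rw [h, Nat.mod_self]
  · rw [Nat.mod_eq_of_lt (by omega)]

/-- The signed class `(-1)^{r n} x_r ⊗ ⋯ ⊗ xₙ ⊗ x₀ ⊗ ⋯ ⊗ x_{r-1}`. -/
def rotCls (K : Subalgebra k C) (x : Fin (n + 1) → C) (r : ℕ) : Cyc K n :=
  (-1 : k) ^ (r * n) • cls K n (rot (Fin.ofNat (n + 1) r) x)

/-- The signed class `(-1)^{r n} 1 ⊗ x_r ⊗ ⋯ ⊗ xₙ ⊗ x₀ ⊗ ⋯ ⊗ x_{r-1}`. -/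
def unitRotCls (K : Subalgebra k C) (x : Fin (n + 1) → C) (r : ℕ) : Cyc K (n + 1) :=
  (-1 : k) ^ (r * n) • cls K (n + 1) (Fin.cons 1 (rot (Fin.ofNat (n + 1) r) x))

theorem sum_add_right {G : Type*} [AddCommMonoid G] (f : Fin (n + 1) → G) (c : Fin (n + 1)) :
    ∑ j, f j = ∑ j, f (j + c) :=
  (Equiv.sum_comp (Equiv.addRight c) f).symm

theorem face_zero_cons_one (y : Fin (n + 1) → C) :
    face (LinearMap.mul k C) 0 (Fin.cons 1 y : Fin (n + 2) → C) = y := by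
  funext a
  rw [face_apply]
  have hs := slot_val (n := n) 0
  have hp := pos_val (n := n) 0 a
  simp only [Fin.val_zero] at hs
  split_ifs with h
  · subst h
    have h0 : slot (n := n) 0 = 0 := Fin.ext (by rw [hs]; simp)
    have h1 : (0 : Fin (n + 2)) + 1 = (0 : Fin (n + 1)).succ := by simp
    rw [h1, h0]
    simp
  · have : pos (n := n) 0 a = a.succ := Fin.ext (by rw [hp]; simp)
    rw [this, Fin.cons_succ]

/-- The last face multiplies the last entry by the unit and puts it in front, which is one more
rotation. Together with the zeroth face, which deletes the unit, this makes the boundary of a sum of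
rotations telescope. -/
theorem face_last_cons_one (y : Fin (n + 1) → C) :
    face (LinearMap.mul k C) (Fin.last (n + 1)) (Fin.cons 1 y : Fin (n + 2) → C) =
      rot (Fin.last n) y := by
  funext a
  rw [face_apply]
  have hs := slot_val (n := n) (Fin.last (n + 1))
  have hp := pos_val (n := n) (Fin.last (n + 1)) a
  simp only [Fin.val_last, if_true] at hs
  have ha := a.isLt
  have hl := CleftExtension.val_add a (Fin.last n)
  simp only [Fin.val_last] at hl
  split_ifs with h
  · subst h
    have h0 : slot (n := n) (Fin.last (n + 1)) = 0 := Fin.ext hs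
    have h1 : Fin.last (n + 1) + 1 = 0 := by simp
    rw [h1, h0, ← Fin.succ_last]
    simp [rot]
  · have ha0 : (a : ℕ) ≠ 0 := fun hh => h (Fin.ext (by rw [hs, hh]))
    have : pos (n := n) (Fin.last (n + 1)) a = (a + Fin.last n).succ := by
      apply Fin.ext
      rw [hp, Fin.val_succ, hl]
      simp only [Fin.val_last]
      split_ifs <;> omega
    rw [this, Fin.cons_succ, rot]

theorem face_inner_cons_one (i : Fin (n + 1)) (y : Fin (n + 2) → C) :
    face (LinearMap.mul k C) i.castSucc.succ (Fin.cons 1 y : Fin (n + 3) → C) =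
      Fin.cons 1 (face (LinearMap.mul k C) i.castSucc y) := by
  have hi := i.isLt
  have hs := slot_val i.castSucc
  have hs' := slot_val (n := n + 1) i.castSucc.succ
  simp only [Fin.val_castSucc, Fin.val_succ] at hs hs'
  rw [if_neg (by omega)] at hs hs'
  funext a
  refine Fin.cases ?_ (fun a => ?_) a
  · rw [face_apply, if_neg (fun h => by rw [← h] at hs'; simp at hs'), Fin.cons_zero]
    have : pos (n := n + 1) i.castSucc.succ 0 = 0 := by
      apply Fin.ext; rw [pos_val]; simp
    rw [this, Fin.cons_zero]
  · rw [face_apply, Fin.cons_succ (α := fun _ => C), Fin.cons_succ (α := fun _ => C), face_apply]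
    have hiff : a.succ = slot (n := n + 1) i.castSucc.succ ↔ a = slot i.castSucc := by
      rw [Fin.ext_iff, Fin.ext_iff, hs, hs', Fin.val_succ]; omega
    simp only [hiff]
    split_ifs with h
    · have : i.castSucc.succ + 1 = (i.castSucc + 1).succ := by
        apply Fin.ext
        rw [val_succ, Fin.val_succ, Fin.val_succ, val_succ, Fin.val_castSucc]
        rw [if_neg (by omega), if_neg (by omega)]
      rw [this, Fin.cons_succ]
    · have : pos (n := n + 1) i.castSucc.succ a.succ = (pos i.castSucc a).succ := by
        apply Fin.ext
        rw [pos_val, Fin.val_succ (pos _ _), pos_val]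
        simp only [Fin.val_succ, Fin.val_castSucc]
        split_ifs <;> omega
      rw [this, Fin.cons_succ]

theorem rot_rot {α : Type*} (c d : Fin (n + 1)) (x : Fin (n + 1) → α) : rot c (rot d x) = rot (c + d) x := by
  funext a; simp [rot, add_assoc]

theorem neg_one_pow_congr {a b : ℕ} (h : a % 2 = b % 2) : (-1 : k) ^ a = (-1) ^ b := by
  rw [neg_one_pow_eq_pow_mod_two, h, ← neg_one_pow_eq_pow_mod_two]

theorem mul_succ_mod_two (m : ℕ) : (m * (m + 1)) % 2 = 0 :=
  Nat.even_iff.1 (Nat.even_mul_succ_self m)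

/-- The sign of the full rotation is `(-1) ^ ((n + 1) * n) = 1`. -/
theorem rotCls_period (K : Subalgebra k C) (x : Fin (n + 1) → C) :
    rotCls K x (n + 1) = rotCls K x 0 := by
  have h : (Fin.ofNat (n + 1) (n + 1) : Fin (n + 1)) = Fin.ofNat (n + 1) 0 := by
    apply Fin.ext; simp [Fin.ofNat]
  rw [rotCls, rotCls, h]
  congr 1
  refine neg_one_pow_congr ?_
  have := mul_succ_mod_two n
  rw [mul_comm, this]; simp

theorem sign_last_face (n r : ℕ) (hr : 1 ≤ r) :
    (-1 : k) ^ (r * n) * (-1) ^ (n + 1) = - (-1) ^ ((r - 1) * n) := by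
  obtain ⟨s, rfl⟩ : ∃ s, r = s + 1 := ⟨r - 1, by omega⟩
  rw [Nat.add_sub_cancel, ← pow_add, show (s + 1) * n + (n + 1) = s * n + (2 * n + 1) by ring,
    pow_add, pow_succ, pow_mul]
  simp

/-- Degree zero is separate because a tensor with one factor has no faces. -/
theorem boundary_unitRotCls_zero (K : Subalgebra k C) (x : Fin 1 → C) {r : ℕ} (h1 : 1 ≤ r) (hr : r ≤ 1) :
    faceSum (admissible_mul (K := K)) 0 (unitRotCls K x r) = rotCls K x r - rotCls K x (r - 1) := by
  obtain rfl : r = 1 := by omega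
  rw [unitRotCls, map_smul, faceSum_cls, Fin.sum_univ_two]
  have h0 := face_zero_cons_one (k := k) (rot (Fin.ofNat (0 + 1) 1) x)
  have hl := face_last_cons_one (k := k) (rot (Fin.ofNat (0 + 1) 1) x)
  have : (1 : Fin (0 + 2)) = Fin.last (0 + 1) := rfl
  rw [h0, this, hl]
  have h2 : rot (Fin.last 0) (rot (Fin.ofNat (0 + 1) 1) x) = rot (Fin.ofNat (0 + 1) 1) x := by
    funext a; simp [rot, Subsingleton.elim (α := Fin 1) _ a]
  rw [h2]
  simp [rotCls]

/-- The outer faces give the two rotations. An inner face multiplies `x_j` with `x_{j+1}`; if this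
happens before the `r`-th entry, the starting place moves down to `r - 1`. The index `j = r - 1` is
missing because there the unit separates the two factors. -/
theorem boundary_unitRotCls (K : Subalgebra k C) (x : Fin (n + 2) → C) {r : ℕ} (h1 : 1 ≤ r)
    (hr : r ≤ n + 2) :
    faceSum (admissible_mul (K := K)) (n + 1) (unitRotCls K x r) = rotCls K x r - rotCls K x (r - 1) -
      ∑ j : Fin (n + 2), (-1 : k) ^ (j : ℕ) •
        (if (j : ℕ) + 1 < r then unitRotCls K (face (LinearMap.mul k C) j x) (r - 1)
         else if r ≤ j then unitRotCls K (face (LinearMap.mul k C) j x) r else 0) := by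
  have hcv := ofNat_val (n := n + 1) hr
  have hcv' := ofNat_val (n := n + 1) (r := r - 1) (by omega)
  rw [unitRotCls, map_smul, faceSum_cls, Fin.sum_univ_succ, Fin.sum_univ_castSucc,
    face_zero_cons_one, Fin.succ_last, face_last_cons_one, rot_rot]
  have hlast : Fin.last (n + 1) + Fin.ofNat (n + 1 + 1) r = Fin.ofNat (n + 1 + 1) (r - 1) := by
    have := CleftExtension.val_add (Fin.last (n + 1)) (Fin.ofNat (n + 1 + 1) r)
    rw [Fin.val_last, hcv] at this
    apply Fin.ext
    rw [this, hcv']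
    split_ifs <;> omega
  rw [hlast, smul_add, smul_add, smul_smul, smul_smul]
  have hsign := sign_last_face (k := k) (n + 1) r h1
  rw [Fin.val_last, hsign, Fin.val_zero, pow_zero, mul_one, sum_add_right _ (Fin.ofNat (n + 2) r),
    Fin.sum_univ_castSucc (f := fun j : Fin (n + 2) => (-1 : k) ^ ((j + Fin.ofNat (n + 2) r : Fin (n + 2)) : ℕ) • _)]
  set c : Fin (n + 2) := Fin.ofNat (n + 1 + 1) r with hc
  -- After the faces are indexed by their position in the rotated tensor, the last position is the
  -- one interrupted by the unit, and its summand on the right is zero.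
  have hl2 : ((Fin.last (n + 1) + c : Fin (n + 2)) : ℕ) = r - 1 := by
    rw [hlast, hcv', if_neg (by omega)]
  rw [if_neg (by omega : ¬ ((Fin.last (n + 1) + c : Fin (n + 2)) : ℕ) + 1 < r),
    if_neg (by omega : ¬ r ≤ ((Fin.last (n + 1) + c : Fin (n + 2)) : ℕ)), smul_zero, add_zero]
  have hinner : (-1 : k) ^ (r * (n + 1)) • ∑ i : Fin (n + 1), (-1 : k) ^ (i.castSucc.succ : ℕ) •
      cls K (n + 1) (face (LinearMap.mul k C) i.castSucc.succ (Fin.cons 1 (rot c x))) =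
      - ∑ i : Fin (n + 1), (-1 : k) ^ ((i.castSucc + c : Fin (n + 2)) : ℕ) •
        (if ((i.castSucc + c : Fin (n + 2)) : ℕ) + 1 < r then
          unitRotCls K (face (LinearMap.mul k C) (i.castSucc + c) x) (r - 1)
         else if r ≤ ((i.castSucc + c : Fin (n + 2)) : ℕ) then
          unitRotCls K (face (LinearMap.mul k C) (i.castSucc + c) x) r else 0) := by
    rw [Finset.smul_sum, ← Finset.sum_neg_distrib]
    refine Finset.sum_congr rfl fun i _ => ?_
    rw [face_inner_cons_one]
    have hadd := CleftExtension.val_add i.castSucc c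
    have hi := i.isLt
    rw [Fin.val_castSucc, hcv] at hadd
    have hsub : i.castSucc + c - c = i.castSucc := add_sub_cancel_right _ _
    generalize i.castSucc + c = j at *
    by_cases hj : (j : ℕ) + 1 < r
    · rw [if_pos hj]
      have hdv := ofNat_val (n := n) (r := r - 1) (by omega)
      have := CleftExtension.face_rot (LinearMap.mul k C) c j x (Fin.ofNat (n + 1) (r - 1)) (by
        rw [hdv, hcv]
        by_cases hrn : r = n + 2
        · simp [hrn]
        · rw [if_neg (show ¬ r - 1 = n + 1 by omega), if_neg (show ¬ r = n + 1 + 1 by omega),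
            if_pos (show (j : ℕ) < r by omega)])
      rw [hsub] at this
      rw [this, unitRotCls, smul_smul, smul_smul, ← neg_smul, ← pow_add, ← pow_add]
      congr 1
      -- In this case the cyclic index has wrapped around once.
      have e : (j : ℕ) + (n + 2) = i + r := by split_ifs at * <;> omega
      have e2 : ((-1 : k)) ^ (r * (n + 1) + (i.castSucc.succ : ℕ)) =
          (-1) ^ ((j : ℕ) + (r - 1) * n + 1) := by
        refine neg_one_pow_congr ?_
        obtain ⟨s, rfl⟩ : ∃ s, r = s + 1 := ⟨r - 1, by omega⟩
        rw [Nat.add_sub_cancel, Fin.val_succ, Fin.val_castSucc]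
        have : (s + 1) * (n + 1) = s * n + s + n + 1 := by ring
        rw [this]
        omega
      rw [e2, pow_succ]; ring
    · rw [if_neg hj, if_pos (by split_ifs at * <;> omega)]
      have hjl := j.isLt
      have hdv := ofNat_val (n := n) (r := r) (by split_ifs at * <;> omega)
      have := CleftExtension.face_rot (LinearMap.mul k C) c j x (Fin.ofNat (n + 1) r) (by
        rw [if_neg (by rw [hcv]; split_ifs at * <;> omega), hcv]
        rw [if_neg (by split_ifs at * <;> omega)]
        rfl)
      rw [hsub] at this
      rw [this, unitRotCls, smul_smul, smul_smul, ← neg_smul, ← pow_add, ← pow_add]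
      congr 1
      have e : (j : ℕ) = i + r := by split_ifs at * <;> omega
      have e2 : ((-1 : k)) ^ (r * (n + 1) + (i.castSucc.succ : ℕ)) =
          (-1) ^ ((j : ℕ) + r * n + 1) := by
        refine neg_one_pow_congr ?_
        rw [Fin.val_succ, Fin.val_castSucc]
        have : r * (n + 1) = r * n + r := by ring
        rw [this]
        omega
      rw [e2, pow_succ]; ring
  rw [hinner, rotCls, rotCls, neg_smul]
  abel

/-- The boundary of a sum of consecutive rotations. -/
theorem boundary_sum_unitRotCls (K : Subalgebra k C) (x : Fin (n + 2) → C) {c : ℕ} (hc : c ≤ n + 2) :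
    faceSum (admissible_mul (K := K)) (n + 1) (∑ r ∈ Finset.Ioc c (n + 2), unitRotCls K x r) =
      rotCls K x (n + 2) - rotCls K x c - ∑ j : Fin (n + 2), (-1 : k) ^ (j : ℕ) •
        ∑ r ∈ Finset.Ioc (if (j : ℕ) < c then c - 1 else c) (n + 1),
          unitRotCls K (face (LinearMap.mul k C) j x) r := by
  rw [map_sum, Finset.sum_congr rfl fun r hr => boundary_unitRotCls K x (by
    rw [Finset.mem_Ioc] at hr; omega) (Finset.mem_Ioc.1 hr).2, Finset.sum_sub_distrib]
  congr 1
  · induction hc using Nat.decreasingInduction with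
    | self => simp
    | of_succ m hm ih =>
      have : Finset.Ioc m (n + 2) = insert (m + 1) (Finset.Ioc (m + 1) (n + 2)) := by
        ext a; simp only [Finset.mem_Ioc, Finset.mem_insert]; omega
      rw [this, Finset.sum_insert (by simp), ih, Nat.add_sub_cancel]
      abel
  · rw [Finset.sum_comm]
    refine Finset.sum_congr rfl fun j _ => ?_
    rw [← Finset.smul_sum]
    congr 1
    have hj := j.isLt
    have h1 : ∀ r, (if (j : ℕ) + 1 < r then unitRotCls K (face (LinearMap.mul k C) j x) (r - 1)
         else if r ≤ j then unitRotCls K (face (LinearMap.mul k C) j x) r else 0) =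
        (if (j : ℕ) + 1 < r then unitRotCls K (face (LinearMap.mul k C) j x) (r - 1) else 0) +
        (if r ≤ (j : ℕ) then unitRotCls K (face (LinearMap.mul k C) j x) r else 0) := by
      intro r
      split_ifs
      · omega
      all_goals simp
    rw [Finset.sum_congr rfl fun r _ => h1 r, Finset.sum_add_distrib, ← Finset.sum_filter,
      ← Finset.sum_filter]
    -- The substitution `r ↦ r - 1` moves the first kind of terms to `j < r`, so that the two kinds
    -- together fill one interval. Its lower end is `c - 1` or `c`, the place to which the `c`-th
    -- entry moves in the `j`-th face.
    have h2 : ∑ r ∈ Finset.Ioc c (n + 2) with (j : ℕ) + 1 < r,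
        unitRotCls K (face (LinearMap.mul k C) j x) (r - 1) =
        ∑ r ∈ Finset.Ioc (if (j : ℕ) < c then c - 1 else c) (n + 1) with (j : ℕ) < r,
          unitRotCls K (face (LinearMap.mul k C) j x) r := by
      refine Finset.sum_nbij' (· - 1) (· + 1) ?_ ?_ ?_ ?_ ?_
      · intro a; simp only [Finset.mem_filter, Finset.mem_Ioc]; split_ifs <;> omega
      · intro a; simp only [Finset.mem_filter, Finset.mem_Ioc]; split_ifs <;> omega
      · intro a; simp only [Finset.mem_filter, Finset.mem_Ioc]; omega
      · intro a; simp only [Finset.mem_filter, Finset.mem_Ioc]; omega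
      · intro a _; rfl
    have h3 : (Finset.Ioc c (n + 2)).filter (fun r => r ≤ (j : ℕ)) =
        (Finset.Ioc (if (j : ℕ) < c then c - 1 else c) (n + 1)).filter (fun r => ¬ (j : ℕ) < r) := by
      ext a; simp only [Finset.mem_filter, Finset.mem_Ioc]; split_ifs <;> omega
    rw [h2, h3, Finset.sum_filter_add_sum_filter_not]

end Rotation

/-! ### The simplicial identities and `b² = 0`. -/

section Boundary
variable {k : Type*} [CommRing k] {C : Type*} [Ring C] [Algebra k C] {n : ℕ}

theorem face_inner_apply (op : C →ₗ[k] C →ₗ[k] C) (j : Fin (n + 2)) (x : Fin (n + 2) → C)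
    (hj : (j : ℕ) < n + 1) (a : Fin (n + 1)) :
    face op j x a = if (a : ℕ) < j then x a.castSucc
      else if (a : ℕ) = j then op (x a.castSucc) (x a.succ) else x a.succ := by
  rw [face, Nat.mod_eq_of_lt hj]
  split_ifs with h1 h2 h2
  · omega
  · have e1 : j = a.castSucc := Fin.ext h1.symm
    subst e1
    simp
  · rfl
  · rfl

theorem face_last_apply (op : C →ₗ[k] C →ₗ[k] C) (j : Fin (n + 2)) (x : Fin (n + 2) → C)
    (hj : (j : ℕ) = n + 1) (a : Fin (n + 1)) :
    face op j x a = if (a : ℕ) = 0 then op (x (Fin.last _)) (x 0) else x a.castSucc := by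
  obtain rfl : j = Fin.last _ := Fin.ext hj
  have := a.isLt
  rw [face, Fin.val_last, Nat.mod_self, if_pos this]
  simp

/-- The cyclic last face obeys the same identity as the others. Associativity is needed only where
the two products share a factor. -/
theorem face_face (x : Fin (n + 3) → C) {i j : Fin (n + 2)} (hij : i ≤ j) :
    face (LinearMap.mul k C) i (face (LinearMap.mul k C) j.succ x) =
      face (LinearMap.mul k C) j (face (LinearMap.mul k C) i.castSucc x) := by
  rw [Fin.le_def] at hij
  have hjl := j.isLt
  funext a
  have hal := a.isLt
  have hi' : (i.castSucc : ℕ) < n + 1 + 1 := by simp; omega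
  by_cases hj : (j : ℕ) < n + 1
  · have hj' : (j.succ : ℕ) < n + 1 + 1 := by simpa using hj
    rw [face_inner_apply _ i _ (by omega), face_inner_apply _ j _ hj]
    simp only [face_inner_apply _ _ _ hj', face_inner_apply _ _ _ hi', Fin.val_castSucc,
      Fin.val_succ, LinearMap.mul_apply', Fin.succ_castSucc]
    split_ifs <;> first | rfl | omega | (rw [mul_assoc])
  · have hj' : (j.succ : ℕ) = n + 1 + 1 := by rw [Fin.val_succ]; omega
    by_cases hi : (i : ℕ) < n + 1
    · rw [face_inner_apply _ i _ hi, face_last_apply _ j _ (by omega)]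
      simp only [face_last_apply _ _ _ hj', face_inner_apply _ _ _ hi', Fin.val_castSucc,
        LinearMap.mul_apply', Fin.val_last, Fin.val_zero]
      have h3 : ¬ n + 1 < (i : ℕ) := by omega
      have h4 : ¬ n + 1 = (i : ℕ) := by omega
      by_cases ha : a = 0
      · subst ha
        rcases Nat.eq_zero_or_pos (i : ℕ) with h0 | h0
        · obtain rfl : i = 0 := Fin.ext h0
          simp [mul_assoc]
        · simp [h0, h3, h4]
      · have ha' : (a : ℕ) ≠ 0 := fun h => ha (Fin.ext h)
        split_ifs <;> first | contradiction | rfl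
    · rw [face_last_apply _ i _ (by omega), face_last_apply _ j _ (by omega)]
      simp only [face_last_apply _ _ _ hj', face_inner_apply _ _ _ hi', Fin.val_castSucc,
        LinearMap.mul_apply', Fin.val_last, Fin.val_zero]
      split_ifs <;> first | rfl | omega | simp_all [mul_assoc]

/-- The pairs `(i, j)` with `i < j` are matched with the remaining ones by `(i, j) ↦ (j - 1, i)`,
which changes the parity of the sign. -/
theorem sum_alternating_eq_zero {G : Type*} [AddCommGroup G] [Module k G]
    (f : Fin (n + 2) → Fin (n + 3) → G)
    (h : ∀ i j : Fin (n + 2), i ≤ j → f i j.succ = f j i.castSucc) :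
    ∑ j : Fin (n + 3), (-1 : k) ^ (j : ℕ) • ∑ i : Fin (n + 2), (-1 : k) ^ (i : ℕ) • f i j = 0 := by
  simp only [Finset.smul_sum, smul_smul]
  rw [Finset.sum_comm, ← Finset.sum_product']
  have hsplit := Finset.sum_filter_add_sum_filter_not (Finset.univ ×ˢ Finset.univ)
    (fun q : Fin (n + 2) × Fin (n + 3) => (q.1 : ℕ) < q.2)
    (fun q => ((-1 : k) ^ (q.2 : ℕ) * (-1) ^ (q.1 : ℕ)) • f q.1 q.2)
  rw [← hsplit, add_eq_zero_iff_eq_neg, ← Finset.sum_neg_distrib]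
  refine Finset.sum_bij' (fun q hq => (q.2.pred (by
      rintro h0; simp [h0] at hq), q.1.castSucc))
    (fun q hq => (q.2.castLT (by have := q.1.isLt; simp at hq; omega), q.1.succ)) ?_ ?_ ?_ ?_ ?_
  · rintro ⟨i, j⟩ hq
    simp at hq ⊢
    omega
  · rintro ⟨i, j⟩ hq
    simp at hq ⊢
    omega
  · rintro ⟨i, j⟩ hq
    simp
  · rintro ⟨i, j⟩ hq
    simp
  · rintro ⟨i, j⟩ hq
    simp only [Finset.mem_filter, Finset.mem_product, Finset.mem_univ, true_and] at hq
    obtain ⟨m, rfl⟩ : ∃ m : Fin (n + 2), j = m.succ :=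
      ⟨j.pred (by rintro rfl; simp at hq), by simp⟩
    simp only [Fin.pred_succ, Fin.val_castSucc, Fin.val_succ] at hq ⊢
    rw [h i m (by rw [Fin.le_def]; omega), ← neg_smul]
    congr 1
    ring

theorem faceSum_mul_sq (K : Subalgebra k C) (z : Cyc K (n + 2)) :
    faceSum (admissible_mul (K := K)) n (faceSum (admissible_mul (K := K)) (n + 1) z) = 0 := by
  suffices (⊤ : Submodule k (Cyc K (n + 2))) ≤ LinearMap.ker
    (faceSum (admissible_mul (K := K)) n ∘ₗ faceSum (admissible_mul (K := K)) (n + 1)) from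
      this Submodule.mem_top
  rw [← Cyc.span_cls, Submodule.span_le]
  rintro _ ⟨x, rfl⟩
  rw [SetLike.mem_coe, LinearMap.mem_ker, LinearMap.comp_apply, faceSum_cls, map_sum]
  simp only [map_smul, faceSum_cls]
  exact sum_alternating_eq_zero _ fun i j hij => by rw [face_face x hij]

end Boundary

theorem ofNat_coe {n : ℕ} (c : Fin (n + 1)) : (Fin.ofNat (n + 1) (c : ℕ) : Fin (n + 1)) = c :=
  Fin.ext (Nat.mod_eq_of_lt c.isLt)

theorem cls_update_add {k : Type*} [CommRing k] {C : Type*} [Ring C] [Algebra k C] {K : Subalgebra k C}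
    {n : ℕ} (x : Fin (n + 1) → C) (j : Fin (n + 1)) (u v : C) (h : x j = u + v) :
    cls K n x = cls K n (Function.update x j u) + cls K n (Function.update x j v) := by
  rw [← (cls K n).map_update_add, ← h, Function.update_eq_self]

theorem lift_le {k : Type*} [CommRing k] {C : Type*} [Ring C] [Algebra k C] {K : Subalgebra k C}
    {n : ℕ} {P : Submodule k (Cyc K n)} (h : ∀ x, cls K n x ∈ P) (z : Cyc K n) : z ∈ P := by
  have : (⊤ : Submodule k (Cyc K n)) ≤ P := by
    rw [← Cyc.span_cls, Submodule.span_le]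
    rintro _ ⟨x, rfl⟩
    exact h x
  exact this Submodule.mem_top

/-! ### Tensors with a last entry in `M`: the operators `t`, `ϑ` and `B` as sums of rotations. -/

section
variable {k A E : Type*} [CommRing k] [Ring A] [Ring E] [Algebra k A] [Algebra k E]

namespace CleftExtension
variable (e : CleftExtension k A E) {K : Subalgebra k A}

/-- The last entry of `x` that need not be in `A` is the `c`-th, and it is in `M`. -/
structure LastAt {n : ℕ} (x : Fin (n + 1) → E) (c : Fin (n + 1)) : Prop where
  mem_M : e.p (x c) = 0
  mem_A : ∀ j, c < j → x j ∈ e.i.range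

variable {e}

/-- The entries before the `c`-th stay arbitrary. The relative complex is therefore spanned by `n +
1` families of tensors, one for each `c`, and the remaining pattern of entries in `A` and `M` plays
no role in formulas for `t` and `ϑ`. -/
theorem lastAt_lastM {n : ℕ} (x : Fin (n + 1) → E) (c : Fin (n + 1)) :
    e.LastAt (fun j => e.lastM c j (x j)) c where
  mem_M := by simp [lastM, e.p_piM]
  mem_A j hj := by
    simp only [lastM, not_lt.2 hj.le, hj.ne', if_false]
    exact ⟨e.p (x j), rfl⟩

namespace LastAt

variable {n : ℕ}

theorem lastM_self {x : Fin (n + 1) → E} {c : Fin (n + 1)} (h : e.LastAt x c) :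
    (fun j => e.lastM c j (x j)) = x := by
  funext j
  unfold lastM
  split_ifs with h1 h2
  · rfl
  · subst h2; exact e.piM_of_p h.mem_M
  · exact e.piA_of_i (h.mem_A j (lt_of_le_of_ne (not_lt.1 h1) (Ne.symm h2)))

/-- Two different candidates for the last place of `M` disagree at the larger one: there an entry of
`M` is projected to `A`, or an entry of `A` to `M`. -/
theorem lastM_ne {x : Fin (n + 1) → E} {c : Fin (n + 1)} (h : e.LastAt x c) {b : Fin (n + 1)}
    (hb : b ≠ c) : e.lastM b (max b c) (x (max b c)) = 0 := by
  rcases lt_or_gt_of_ne hb with hlt | hlt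
  · rw [max_eq_right hlt.le]
    simp [lastM, not_lt.2 hlt.le, hb.symm, e.piA_of_p h.mem_M]
  · rw [max_eq_left hlt.le]
    simp [lastM, e.piM_of_i (h.mem_A _ hlt)]

theorem lastProj_cls {x : Fin (n + 1) → E} {c : Fin (n + 1)} (h : e.LastAt x c) (b : Fin (n + 1)) :
    e.lastProj K b (cls (e.KE K) n x) = if b = c then cls (e.KE K) n x else 0 := by
  rw [lastProj, mapFactors_cls]
  split_ifs with hb
  · subst hb; rw [h.lastM_self]
  · exact cls_zero_entry _ (h.lastM_ne hb)

theorem t_cls {x : Fin (n + 1) → E} {c : Fin (n + 1)} (h : e.LastAt x c) :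
    e.t K n (cls (e.KE K) n x) = rotCls (e.KE K) x c := by
  rw [t, LinearMap.sum_apply, Finset.sum_eq_single c]
  · rw [rotTerm_cls, h.lastM_self, rotCls, ofNat_coe]
  · intro b _ hb
    rw [rotTerm_cls, cls_zero_entry _ (j := max b c - b), smul_zero]
    simpa [rot] using h.lastM_ne hb
  · simp

theorem vartheta_cls {x : Fin (n + 1) → E} {c : Fin (n + 1)} (h : e.LastAt x c) :
    e.vartheta K n (cls (e.KE K) n x) =
      ∑ r ∈ Finset.Ioc (c : ℕ) (n + 1), unitRotCls (e.KE K) x r := by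
  simp only [vartheta, LinearMap.sum_apply, LinearMap.comp_apply, h.lastProj_cls]
  rw [Finset.sum_eq_single c (fun b _ hb => by simp [hb]) (by simp)]
  simp only [if_true]
  have hcl := c.isLt
  -- The `l`-th power of the backward rotation starts at the place `r = n + 1 - l`. In particular `l
  -- = 0` corresponds to the full rotation `r = n + 1`, not to `r = 0`.
  refine Finset.sum_bij' (fun l _ => n + 1 - (l : ℕ)) (fun r _ => Fin.ofNat (n + 1) (n + 1 - r))
    ?_ ?_ ?_ ?_ ?_
  · intro l hl
    simp only [Finset.mem_filter, Finset.mem_univ, true_and] at hl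
    rw [Finset.mem_Ioc]; omega
  · intro r hr
    rw [Finset.mem_Ioc] at hr
    simp only [Finset.mem_filter, Finset.mem_univ, true_and]
    rw [ofNat_val (by omega), if_neg (by omega)]; omega
  · intro l _
    have := l.isLt
    apply Fin.ext
    rw [ofNat_val (by omega), if_neg (by omega)]; omega
  · intro r hr
    rw [Finset.mem_Ioc] at hr
    rw [ofNat_val (by omega), if_neg (by omega)]; omega
  · intro l _
    have hl := l.isLt
    rw [unitRot_cls, unitRotCls]
    have hneg : ((-l : Fin (n + 1)) : ℕ) = if (l : ℕ) = 0 then 0 else n + 1 - l := by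
      have h0 := val_sub 0 l
      rw [zero_sub, Fin.val_zero] at h0
      rw [h0]
      split_ifs <;> omega
    have : (Fin.ofNat (n + 1) (n + 1 - (l : ℕ)) : Fin (n + 1)) = -l := by
      apply Fin.ext
      rw [ofNat_val (by omega), hneg]
      split_ifs <;> omega
    rw [this]
    congr 1
    refine neg_one_pow_congr ?_
    rw [hneg]
    split_ifs with h0
    · rw [h0]
      have := mul_succ_mod_two n
      rw [Nat.sub_zero, mul_comm (n + 1), this]; simp
    · rfl

/-- `M` is an ideal and `A` a subalgebra, so a face only shifts the last place of `M`. The case `j =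
c = n + 1`, in which the last entry of `M` is absorbed into the zeroth place, is excluded because no
`d : Fin (n + 1)` has the value `n + 1`. -/
theorem face_mul {x : Fin (n + 2) → E} {c : Fin (n + 2)} (h : e.LastAt x c) {j : Fin (n + 2)}
    {d : Fin (n + 1)} (hd : (d : ℕ) = if (j : ℕ) < c then (c : ℕ) - 1 else c) :
    e.LastAt (face (LinearMap.mul k E) j x) d := by
  have hjl := j.isLt
  have hcl := c.isLt
  have hA : ∀ a : Fin (n + 2), (c : ℕ) < a → x a ∈ e.i.range := fun a ha => h.mem_A a ha
  have hM : ∀ a : Fin (n + 2), (a : ℕ) = c → e.p (x a) = 0 := fun a ha => by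
    rw [Fin.ext ha]; exact h.mem_M
  by_cases hjn : (j : ℕ) < n + 1
  · constructor
    · rw [face_inner_apply _ _ _ hjn]
      split_ifs at * with h1 h2 h2
      all_goals first
        | omega
        | exact hM _ (by simp only [Fin.val_succ, Fin.val_castSucc]; omega)
        | (rw [LinearMap.mul_apply', map_mul, hM d.succ (by rw [Fin.val_succ]; omega), mul_zero])
        | (rw [LinearMap.mul_apply', map_mul, hM d.castSucc (by rw [Fin.val_castSucc]; omega),
            zero_mul])
    · intro a ha
      rw [Fin.lt_def] at ha
      rw [face_inner_apply _ _ _ hjn]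
      split_ifs at * with h1 h2 h2
      · omega
      all_goals first
        | omega
        | exact hA _ (by simp only [Fin.val_succ, Fin.val_castSucc]; omega)
        | exact mul_mem (hA _ (by simp only [Fin.val_castSucc]; omega))
            (hA _ (by simp only [Fin.val_succ]; omega))
  · rw [if_neg (by omega)] at hd
    constructor
    · rw [face_last_apply _ _ _ (by omega)]
      split_ifs with h0
      · rw [LinearMap.mul_apply', map_mul, hM 0 (by rw [Fin.val_zero]; omega), mul_zero]
      · exact hM _ (by rw [Fin.val_castSucc]; omega)
    · intro a ha
      rw [Fin.lt_def] at ha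
      rw [face_last_apply _ _ _ (by omega), if_neg (by omega)]
      exact hA _ (by rw [Fin.val_castSucc]; omega)

theorem exists_face_index (c j : Fin (n + 2)) (hj : ¬ ((j : ℕ) = n + 1 ∧ (c : ℕ) = n + 1)) :
    ∃ d : Fin (n + 1), (d : ℕ) = if (j : ℕ) < c then (c : ℕ) - 1 else c := by
  have hjl := j.isLt
  have hcl := c.isLt
  have hlt : (if (j : ℕ) < c then (c : ℕ) - 1 else c) < n + 1 := by split_ifs <;> omega
  exact ⟨⟨_, hlt⟩, rfl⟩

end LastAt

variable (K)

theorem cls_sum_lastProj {n : ℕ} (x : Fin (n + 1) → E) :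
    cls (e.KE K) n x = ∑ c, e.lastProj K c (cls (e.KE K) n x) +
      cls (e.KE K) n fun j => e.piA (x j) := by
  -- The tensors that keep the first `m` entries and project the others to `A` interpolate between
  -- the two ends. Splitting the `m`-th entry into its components produces exactly the part whose
  -- last place in `M` is `m`.
  have key : ∀ m : ℕ, m ≤ n + 1 → cls (e.KE K) n (fun j => if (j : ℕ) < m then x j else e.piA (x j)) =
      ∑ c ∈ Finset.univ.filter (fun c : Fin (n + 1) => (c : ℕ) < m),
        e.lastProj K c (cls (e.KE K) n x) + cls (e.KE K) n fun j => e.piA (x j) := by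
    intro m
    induction m with
    | zero => simp
    | succ m ih =>
      intro hm
      have hset : Finset.univ.filter (fun c : Fin (n + 1) => (c : ℕ) < m + 1) =
          insert ⟨m, hm⟩ (Finset.univ.filter (fun c : Fin (n + 1) => (c : ℕ) < m)) := by
        ext a
        simp only [Finset.mem_filter, Finset.mem_univ, true_and, Finset.mem_insert, Fin.ext_iff]
        omega
      rw [hset, Finset.sum_insert (by simp), add_assoc, ← ih (by omega)]
      rw [cls_update_add _ ⟨m, hm⟩ (e.piM (x ⟨m, hm⟩)) (e.piA (x ⟨m, hm⟩))
        (by simp [piM])]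
      congr 1
      · rw [lastProj, mapFactors_cls]
        congr 1
        funext j
        by_cases hj : j = ⟨m, hm⟩
        · subst hj; simp [lastM]
        · have : (j : ℕ) ≠ m := fun h => hj (Fin.ext h)
          rw [Function.update_of_ne hj]
          simp only [lastM, hj, Fin.lt_def, if_false]
          by_cases h1 : (j : ℕ) < m
          · simp [h1, (by omega : (j : ℕ) < m + 1)]
          · rw [if_neg (by omega), if_neg h1]
      · congr 1
        funext j
        by_cases hj : j = ⟨m, hm⟩
        · subst hj; simp
        · have : (j : ℕ) ≠ m := fun h => hj (Fin.ext h)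
          rw [Function.update_of_ne hj]
          by_cases h1 : (j : ℕ) < m
          · simp [h1, (by omega : (j : ℕ) < m + 1)]
          · rw [if_neg (by omega), if_neg h1]
  have := key (n + 1) le_rfl
  have h1 : (fun j : Fin (n + 1) => if (j : ℕ) < n + 1 then x j else e.piA (x j)) = x := by
    funext j; rw [if_pos j.isLt]
  have h2 : Finset.univ.filter (fun c : Fin (n + 1) => (c : ℕ) < n + 1) = Finset.univ := by
    ext a; simp [Nat.lt_succ_iff.1 a.isLt]
  rwa [h1, h2] at this

variable (e) in
/-- The map `A ⊗ Ā^{⊗ n} ⊗ → E ⊗ Ē^{⊗ n} ⊗` induced by the section. -/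
def incl (n : ℕ) : Cyc K n →ₗ[k] Cyc (e.KE K) n :=
  mapFactors (fun _ => e.i.toLinearMap)
    { bal := fun c hc => ⟨e.i c, ⟨c, hc, rfl⟩, fun j x => by simp⟩
      unit := fun c hc j _ => ⟨c, hc, rfl⟩ }

/-- What the projections `lastProj` leave out is the tensor of all `A`-components, which is `incl`
applied to `proj`. -/
theorem eq_sum_lastProj {n : ℕ} {z : Cyc (e.KE K) n} (hz : z ∈ LinearMap.ker (e.proj K n)) :
    z = ∑ c, e.lastProj K c z := by
  have : ∀ z : Cyc (e.KE K) n, z = ∑ c, e.lastProj K c z + e.incl K n (e.proj K n z) := by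
    intro z
    refine lift_le (P := LinearMap.eqLocus LinearMap.id
      ((∑ c, e.lastProj K c) + e.incl K n ∘ₗ e.proj K n)) (fun x => ?_) z |>.trans ?_
    · rw [LinearMap.mem_eqLocus]
      simp only [LinearMap.id_apply, LinearMap.add_apply, LinearMap.sum_apply, LinearMap.comp_apply]
      rw [proj, mapFactors_cls, incl, mapFactors_cls]
      exact cls_sum_lastProj K x
    · simp
  have h2 := this z
  rwa [LinearMap.mem_ker.1 hz, map_zero, add_zero] at h2

/-- The kernel of `proj` is generated by the tensors that have a last entry in `M`. -/
theorem ker_proj_le {n : ℕ} {P : Submodule k (Cyc (e.KE K) n)}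
    (h : ∀ x c, e.LastAt x c → cls (e.KE K) n x ∈ P) : LinearMap.ker (e.proj K n) ≤ P := by
  intro z hz
  rw [eq_sum_lastProj K hz]
  refine Submodule.sum_mem _ fun c _ => ?_
  refine lift_le (P := P.comap (e.lastProj K c)) (fun x => ?_) z
  rw [Submodule.mem_comap, lastProj, mapFactors_cls]
  exact h _ c (lastAt_lastM x c)

theorem cls_mem_ker_proj {n : ℕ} {x : Fin (n + 1) → E} {c : Fin (n + 1)} (h : e.p (x c) = 0) :
    cls (e.KE K) n x ∈ LinearMap.ker (e.proj K n) := by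
  rw [LinearMap.mem_ker, proj, mapFactors_cls]
  exact cls_zero_entry _ (j := c) h

theorem unitRotCls_mem_ker_proj {n : ℕ} {x : Fin (n + 1) → E} {c : Fin (n + 1)} (h : e.p (x c) = 0)
    (r : ℕ) : unitRotCls (e.KE K) x r ∈ LinearMap.ker (e.proj K (n + 1)) := by
  refine Submodule.smul_mem _ _ (cls_mem_ker_proj K (c := (c - Fin.ofNat (n + 1) r).succ) ?_)
  simpa [rot] using h

theorem hochschild_mem_ker_proj {n : ℕ} {z : Cyc (e.KE K) (n + 1)}
    (hz : z ∈ LinearMap.ker (e.proj K (n + 1))) :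
    e.hochschild K n z ∈ LinearMap.ker (e.proj K n) := by
  refine ker_proj_le K (P := (LinearMap.ker (e.proj K n)).comap (e.hochschild K n)) (fun x c h => ?_) hz
  rw [Submodule.mem_comap, hochschild, faceSum_cls]
  refine Submodule.sum_mem _ fun j _ => Submodule.smul_mem _ _ ?_
  by_cases hj : (j : ℕ) = n + 1 ∧ (c : ℕ) = n + 1
  · refine cls_mem_ker_proj K (c := 0) ?_
    rw [face_last_apply _ _ _ hj.1]
    have : Fin.last (n + 1) = c := Fin.ext hj.2.symm
    simp [this, h.mem_M]
  · obtain ⟨d, hd⟩ := LastAt.exists_face_index c j hj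
    exact cls_mem_ker_proj K (h.face_mul hd).mem_M

/-- With the trivial rotation counted as the full one, `B` is the case `c = 0` of the interval sums
that describe `ϑ`. Hence `boundary_sum_unitRotCls` serves both `bB + Bb = 0` and the homotopy
formula. -/
theorem connesB_cls {n : ℕ} (x : Fin (n + 1) → E) : e.connesB K n (cls (e.KE K) n x) =
    ∑ r ∈ Finset.Ioc 0 (n + 1), unitRotCls (e.KE K) x r := by
  rw [connesB, LinearMap.sum_apply]
  refine Finset.sum_bij' (fun l _ => if (l : ℕ) = 0 then n + 1 else (l : ℕ))
    (fun r _ => Fin.ofNat (n + 1) r) ?_ ?_ ?_ ?_ ?_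
  · intro l _
    have := l.isLt
    rw [Finset.mem_Ioc]; split_ifs <;> omega
  · simp
  · intro l _
    have := l.isLt
    apply Fin.ext
    rw [ofNat_val (by split_ifs <;> omega)]
    split_ifs <;> omega
  · intro r hr
    rw [Finset.mem_Ioc] at hr
    rw [ofNat_val hr.2]
    split_ifs <;> omega
  · intro l _
    rw [unitRot_cls, unitRotCls]
    have hl := l.isLt
    have : (Fin.ofNat (n + 1) (if (l : ℕ) = 0 then n + 1 else (l : ℕ)) : Fin (n + 1)) = l := by
      apply Fin.ext
      rw [ofNat_val (by split_ifs <;> omega)]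
      split_ifs <;> omega
    rw [this]
    congr 1
    refine neg_one_pow_congr ?_
    split_ifs with h0
    · have := mul_succ_mod_two n
      rw [h0, mul_comm (n + 1), this]; simp
    · rfl

theorem connesB_mem_ker_proj {n : ℕ} {z : Cyc (e.KE K) n}
    (hz : z ∈ LinearMap.ker (e.proj K n)) :
    e.connesB K n z ∈ LinearMap.ker (e.proj K (n + 1)) := by
  refine ker_proj_le K (P := (LinearMap.ker (e.proj K (n + 1))).comap (e.connesB K n))
    (fun x c h => ?_) hz
  rw [Submodule.mem_comap, connesB_cls]
  exact Submodule.sum_mem _ fun r _ => unitRotCls_mem_ker_proj K h.mem_M r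

theorem vartheta_mem_ker_proj {n : ℕ} (z : Cyc (e.KE K) n) :
    e.vartheta K n z ∈ LinearMap.ker (e.proj K (n + 1)) := by
  refine lift_le (P := (LinearMap.ker (e.proj K (n + 1))).comap (e.vartheta K n)) (fun x => ?_) z
  rw [Submodule.mem_comap]
  simp only [vartheta, LinearMap.sum_apply, LinearMap.comp_apply]
  refine Submodule.sum_mem _ fun c _ => Submodule.sum_mem _ fun l _ => ?_
  rw [lastProj, mapFactors_cls, unitRot_cls]
  refine Submodule.smul_mem _ _ (cls_mem_ker_proj K (c := (c + l).succ) ?_)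
  simpa [rot] using (lastAt_lastM x c).mem_M

theorem hochschild_connesB_zero (z : Cyc (e.KE K) 0) :
    e.hochschild K 0 (e.connesB K 0 z) = 0 := by
  refine lift_le (P := LinearMap.ker (e.hochschild K 0 ∘ₗ e.connesB K 0)) (fun x => ?_) z
  rw [LinearMap.mem_ker, LinearMap.comp_apply, connesB_cls]
  have : Finset.Ioc 0 (0 + 1) = {1} := rfl
  rw [this, Finset.sum_singleton, hochschild, boundary_unitRotCls_zero _ _ le_rfl le_rfl]
  exact sub_eq_zero.2 (rotCls_period _ x)

theorem hochschild_connesB {n : ℕ} (z : Cyc (e.KE K) (n + 1)) :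
    e.hochschild K (n + 1) (e.connesB K (n + 1) z) + e.connesB K n (e.hochschild K n z) = 0 := by
  refine lift_le (P := LinearMap.ker (e.hochschild K (n + 1) ∘ₗ e.connesB K (n + 1) +
    e.connesB K n ∘ₗ e.hochschild K n)) (fun x => ?_) z
  rw [LinearMap.mem_ker, LinearMap.add_apply, LinearMap.comp_apply, LinearMap.comp_apply,
    connesB_cls, hochschild, boundary_sum_unitRotCls _ _ (Nat.zero_le _), hochschild, faceSum_cls,
    map_sum, rotCls_period]
  simp [connesB_cls]

theorem hochschild_vartheta_zero {z : Cyc (e.KE K) 0} (hz : z ∈ LinearMap.ker (e.proj K 0)) :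
    e.hochschild K 0 (e.vartheta K 0 z) = z - e.t K 0 z := by
  refine ker_proj_le K (P := LinearMap.eqLocus (e.hochschild K 0 ∘ₗ e.vartheta K 0)
    (LinearMap.id - e.t K 0)) (fun x c h => ?_) hz
  rw [LinearMap.mem_eqLocus, LinearMap.comp_apply, LinearMap.sub_apply, h.vartheta_cls, h.t_cls]
  have hc : (c : ℕ) = 0 := by have := c.isLt; omega
  rw [hc]
  have : Finset.Ioc 0 (0 + 1) = {1} := rfl
  rw [this, Finset.sum_singleton, hochschild, boundary_unitRotCls_zero _ _ le_rfl le_rfl]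
  congr 1
  rw [rotCls_period, rotCls]
  simp only [zero_mul, pow_zero, one_smul, LinearMap.id_apply]
  congr 1
  funext a
  simp [rot]

/-- The unit at place zero has no component in `M`, so it cannot be the last entry of `M`. Any
proper rotation moves it to a nonzero place, where the tensor is degenerate. The same argument gives
`vartheta_unitRot`. -/
theorem t_unitRot (n : ℕ) (c : Fin (n + 1)) (z : Cyc (e.KE K) n) :
    e.t K (n + 1) (unitRot (e.KE K) n c z) = 0 := by
  refine lift_le (P := LinearMap.ker (e.t K (n + 1) ∘ₗ unitRot (e.KE K) n c)) (fun x => ?_) z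
  rw [LinearMap.mem_ker, LinearMap.comp_apply, unitRot_cls, map_smul, t, LinearMap.sum_apply]
  rw [Finset.sum_eq_zero, smul_zero]
  intro d _
  rw [rotTerm_cls]
  by_cases hd : d = 0
  · subst hd
    rw [cls_zero_entry _ (j := 0), smul_zero]
    simp [rot, lastM, e.piM_of_mem (one_mem (e.KE K))]
  · rw [cls_deg (j := -d) _ (neg_ne_zero.2 hd), smul_zero]
    simp [rot, lastM, Fin.pos_of_ne_zero hd, one_mem]

theorem vartheta_unitRot (n : ℕ) (c : Fin (n + 1)) (z : Cyc (e.KE K) n) :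
    e.vartheta K (n + 1) (unitRot (e.KE K) n c z) = 0 := by
  refine lift_le (P := LinearMap.ker (e.vartheta K (n + 1) ∘ₗ unitRot (e.KE K) n c))
    (fun x => ?_) z
  rw [LinearMap.mem_ker, LinearMap.comp_apply, unitRot_cls, map_smul]
  simp only [vartheta, LinearMap.sum_apply, LinearMap.comp_apply]
  rw [Finset.sum_eq_zero, smul_zero]
  intro d _
  refine Finset.sum_eq_zero fun l _ => ?_
  rw [lastProj, mapFactors_cls, unitRot_cls]
  by_cases hd : d = 0
  · subst hd
    rw [cls_zero_entry _ (j := (0 + l).succ), smul_zero]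
    simp [rot, lastM, e.piM_of_mem (one_mem (e.KE K))]
  · rw [cls_deg (j := (0 + l).succ) _ (Fin.succ_ne_zero _), smul_zero]
    simp [rot, lastM, Fin.pos_of_ne_zero hd, one_mem]

theorem t_connesB (n : ℕ) (z : Cyc (e.KE K) n) : e.t K (n + 1) (e.connesB K n z) = 0 := by
  rw [connesB, LinearMap.sum_apply, map_sum]
  exact Finset.sum_eq_zero fun c _ => t_unitRot K n c z

theorem t_vartheta (n : ℕ) (z : Cyc (e.KE K) n) : e.t K (n + 1) (e.vartheta K n z) = 0 := by
  simp only [vartheta, LinearMap.sum_apply, map_sum, LinearMap.comp_apply]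
  exact Finset.sum_eq_zero fun c _ => Finset.sum_eq_zero fun l _ => t_unitRot K n _ _

theorem vartheta_vartheta (n : ℕ) (z : Cyc (e.KE K) n) :
    e.vartheta K (n + 1) (e.vartheta K n z) = 0 := by
  conv_lhs => enter [2]; simp only [vartheta, LinearMap.sum_apply, LinearMap.comp_apply]
  simp only [map_sum]
  exact Finset.sum_eq_zero fun c _ => Finset.sum_eq_zero fun l _ => vartheta_unitRot K n _ _

end CleftExtension
end

/-! ### The homotopy formula for `ϑ` and the factorization of `B`. -/

section
variable {k A E : Type*} [CommRing k] [Ring A] [Ring E] [Algebra k A] [Algebra k E]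

namespace CleftExtension
variable (e : CleftExtension k A E) (K : Subalgebra k A)

/-- The product of the component in `M` of the first factor with the second factor. -/
def mulM : E →ₗ[k] E →ₗ[k] E := (LinearMap.mul k E).compl₁₂ e.piM LinearMap.id

theorem mulM_apply (x y : E) : e.mulM x y = e.piM x * y := rfl

variable {n : ℕ}

/-- The operation `mulM` is in general not `Admissible`, because the unit rules hold with different
scalars on the two sides. Its last face is still well defined: the right factor is the zeroth entry,
which is not taken modulo `K`. These update rules serve to check that. -/
theorem face_last_update_castSucc (op : E →ₗ[k] E →ₗ[k] E) (x : Fin (n + 2) → E) (i : Fin (n + 1))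
    (u : E) : face op (Fin.last (n + 1)) (Function.update x i.castSucc u) =
      Function.update (face op (Fin.last (n + 1)) x) i
        (if i = 0 then op (x (Fin.last _)) u else u) := by
  funext a
  rw [face_last_apply _ _ _ (Fin.val_last _)]
  have h1 : Fin.last (n + 1) ≠ i.castSucc := (Fin.castSucc_lt_last i).ne'
  have h0 : (0 : Fin (n + 2)) = i.castSucc ↔ i = 0 := by
    rw [Fin.ext_iff, Fin.ext_iff]; simp [eq_comm]
  by_cases ha : a = i
  · subst ha
    by_cases h : a = 0
    · subst h; simp
    · have : (a : ℕ) ≠ 0 := fun hh => h (Fin.ext hh)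
      simp [h]
  · rw [Function.update_of_ne ha, face_last_apply _ _ _ (Fin.val_last _)]
    by_cases h : a = 0
    · subst h
      have : (0 : Fin (n + 2)) ≠ i.castSucc := fun hh => ha (h0.1 hh).symm
      simp [this, h1]
    · simp [h, ha]

theorem face_last_update_last (op : E →ₗ[k] E →ₗ[k] E) (x : Fin (n + 2) → E) (u : E) :
    face op (Fin.last (n + 1)) (Function.update x (Fin.last (n + 1)) u) =
      Function.update (face op (Fin.last (n + 1)) x) 0 (op u (x 0)) := by
  funext a
  rw [face_last_apply _ _ _ (Fin.val_last _)]
  by_cases h : a = 0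
  · subst h; simp
  · rw [Function.update_of_ne h, face_last_apply _ _ _ (Fin.val_last _)]
    simp [h]

theorem face_last_zero (op : E →ₗ[k] E →ₗ[k] E) (x : Fin (n + 2) → E) :
    face op (Fin.last (n + 1)) x 0 = op (x (Fin.last _)) (x 0) := by
  rw [face_last_apply _ _ _ (Fin.val_last _)]; simp

/-- The signed last face for the multiplication by the component in `M` of the last entry:
`x₀ ⊗ ⋯ ⊗ x_{n+1} ↦ (-1)^{n+1} πM x_{n+1} x₀ ⊗ x₁ ⊗ ⋯ ⊗ xₙ`. -/
def lastFace (n : ℕ) : Cyc (e.KE K) (n + 1) →ₗ[k] Cyc (e.KE K) n :=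
  Cyc.lift ((-1 : k) ^ (n + 1) • faceMul (e.KE K) e.mulM (Fin.last (n + 1)))
    (by
      intro x i c hc
      simp only [smul_apply, faceMul_apply]
      congr 1
      have h0 := face_last_zero e.mulM x
      have hleft : ∀ x y, e.mulM (c * x) y = c * e.mulM x y := fun x y => by
        simp only [mulM_apply, (e.piM_mul hc x).2, mul_assoc]
      have hbal : ∀ x y, e.mulM (x * c) y = e.mulM x (c * y) := fun x y => by
        simp only [mulM_apply, (e.piM_mul hc x).1, mul_assoc]
      have hright : ∀ x y, e.mulM x (y * c) = e.mulM x y * c := fun x y => by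
        simp only [mulM_apply, mul_assoc]
      refine Fin.lastCases ?_ (fun i => ?_) i
      · have h1 : Fin.last (n + 1) + 1 = (0 : Fin (n + 1)).castSucc := by simp
        rw [face_last_update_last, h1, face_last_update_castSucc, if_pos rfl, hbal]
        rfl
      · have hl : face e.mulM (Fin.last (n + 1)) (Function.update x i.castSucc (x i.castSucc * c)) =
            Function.update (face e.mulM (Fin.last (n + 1)) x) i
              (face e.mulM (Fin.last (n + 1)) x i * c) := by
          rw [face_last_update_castSucc]
          congr 1
          split_ifs with hi
          · subst hi; rw [hright, h0]; rfl
          · have : (i : ℕ) ≠ 0 := fun hh => hi (Fin.ext hh)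
            rw [face_last_apply _ _ _ (Fin.val_last _), if_neg this]
        rw [hl, cls_bal _ _ hc]
        congr 1
        by_cases hi : (i : ℕ) = n
        · have h1 : i.castSucc + 1 = Fin.last (n + 1) := by
            apply Fin.ext; rw [val_succ, Fin.val_castSucc, if_neg (by omega), Fin.val_last, hi]
          have h2 : i + 1 = 0 := by
            apply Fin.ext; rw [val_succ, if_pos hi]; rfl
          rw [h1, h2, face_last_update_last, hleft, h0]
        · have h1 : i.castSucc + 1 = (i + 1).castSucc := by
            apply Fin.ext
            rw [val_succ, Fin.val_castSucc, Fin.val_castSucc, val_succ, if_neg hi,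
              if_neg (by have := i.isLt; omega)]
          have h2 : ((i + 1 : Fin (n + 1)) : ℕ) ≠ 0 := by rw [val_succ, if_neg hi]; omega
          have h3 : i + 1 ≠ 0 := fun h => h2 (by rw [h]; rfl)
          rw [h1, face_last_update_castSucc, if_neg h3, face_last_apply _ _ _ (Fin.val_last _),
            if_neg h2])
    (by
      intro x j hj hx
      simp only [smul_apply, faceMul_apply]
      revert hj hx
      refine Fin.lastCases ?_ (fun i => ?_) j
      · intro _ hx
        rw [cls_zero_entry _ (j := 0), smul_zero]
        rw [face_last_zero, mulM_apply, e.piM_of_mem hx, zero_mul]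
      · intro hi hx
        have hi' : (i : ℕ) ≠ 0 := fun h => hi (Fin.ext h)
        rw [cls_deg (j := i) _ (fun h => hi' (by rw [h]; rfl)), smul_zero]
        rwa [face_last_apply _ _ _ (Fin.val_last _), if_neg hi'])

theorem lastFace_cls (x : Fin (n + 2) → E) : e.lastFace K n (cls (e.KE K) (n + 1) x) =
    (-1 : k) ^ (n + 1) • cls (e.KE K) n (face e.mulM (Fin.last (n + 1)) x) :=
  Cyc.lift_cls _ _ _ x

variable {e}

theorem lastFace_cls_of_mem_A {x : Fin (n + 2) → E} (h : x (Fin.last _) ∈ e.i.range) :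
    e.lastFace K n (cls (e.KE K) (n + 1) x) = 0 := by
  rw [lastFace_cls, cls_zero_entry _ (j := 0), smul_zero]
  rw [face_last_zero, mulM_apply, e.piM_of_i h, zero_mul]

theorem lastFace_cls_of_mem_M {x : Fin (n + 2) → E} (h : e.p (x (Fin.last _)) = 0) :
    e.lastFace K n (cls (e.KE K) (n + 1) x) =
      (-1 : k) ^ (n + 1) • cls (e.KE K) n (face (LinearMap.mul k E) (Fin.last (n + 1)) x) := by
  rw [lastFace_cls]
  congr 2
  funext a
  rw [face_last_apply _ _ _ (Fin.val_last _), face_last_apply _ _ _ (Fin.val_last _), mulM_apply,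
    e.piM_of_p h, LinearMap.mul_apply']

/-- The end terms of the telescoping sum are `x` and `t x`. For every face that leaves the last
entry of `M` at the expected place, the remaining interval sum is `ϑ` of that face, and it cancels
against `ϑ b`. Only the face in which this entry passes to place zero contributes a correction. -/
theorem hochschild_vartheta {z : Cyc (e.KE K) (n + 1)}
    (hz : z ∈ LinearMap.ker (e.proj K (n + 1))) :
    e.hochschild K (n + 1) (e.vartheta K (n + 1) z) + e.vartheta K n (e.hochschild K n z) =
      z - e.t K (n + 1) z + e.vartheta K n (e.lastFace K n z) := by
  refine ker_proj_le K (P := LinearMap.eqLocus (e.hochschild K (n + 1) ∘ₗ e.vartheta K (n + 1) +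
    e.vartheta K n ∘ₗ e.hochschild K n) (LinearMap.id - e.t K (n + 1) +
      e.vartheta K n ∘ₗ e.lastFace K n)) (fun x c h => ?_) hz
  rw [LinearMap.mem_eqLocus]
  simp only [LinearMap.add_apply, LinearMap.comp_apply, LinearMap.sub_apply, LinearMap.id_apply]
  rw [h.vartheta_cls, h.t_cls]
  simp only [hochschild]
  rw [boundary_sum_unitRotCls _ _ (by have := c.isLt; omega), faceSum_cls, map_sum,
    rotCls_period]
  have h0 : rotCls (e.KE K) x 0 = cls (e.KE K) (n + 1) x := by
    rw [rotCls, zero_mul, pow_zero, one_smul]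
    congr 1
    funext a
    simp [rot]
  have hface : ∀ j : Fin (n + 2), ¬ ((j : ℕ) = n + 1 ∧ (c : ℕ) = n + 1) →
      e.vartheta K n ((-1 : k) ^ (j : ℕ) • cls (e.KE K) n (face (LinearMap.mul k E) j x)) =
      (-1 : k) ^ (j : ℕ) • ∑ r ∈ Finset.Ioc (if (j : ℕ) < c then (c : ℕ) - 1 else c) (n + 1),
        unitRotCls (e.KE K) (face (LinearMap.mul k E) j x) r := by
    intro j hj
    obtain ⟨d, hd⟩ := LastAt.exists_face_index c j hj
    rw [map_smul, (h.face_mul hd).vartheta_cls, hd]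
  -- If `c = n + 1`, the interval is empty and `ϑ` of the last face is entirely the correction.
  -- Otherwise the last entry is in `A` and the correction is zero.
  have hlast : e.vartheta K n ((-1 : k) ^ ((Fin.last (n + 1) : Fin (n + 2)) : ℕ) •
      cls (e.KE K) n (face (LinearMap.mul k E) (Fin.last (n + 1)) x)) =
      (-1 : k) ^ ((Fin.last (n + 1) : Fin (n + 2)) : ℕ) •
        ∑ r ∈ Finset.Ioc (if ((Fin.last (n + 1) : Fin (n + 2)) : ℕ) < c then (c : ℕ) - 1 else c)
          (n + 1), unitRotCls (e.KE K) (face (LinearMap.mul k E) (Fin.last (n + 1)) x) r +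
      e.vartheta K n (e.lastFace K n (cls (e.KE K) (n + 1) x)) := by
    by_cases hc : c = Fin.last (n + 1)
    · subst hc
      rw [lastFace_cls_of_mem_M K h.mem_M]
      simp
    · rw [lastFace_cls_of_mem_A K (h.mem_A _ (lt_of_le_of_ne (Fin.le_last c) hc)), map_zero,
        add_zero]
      exact hface _ fun hh => hc (Fin.ext hh.2)
  rw [h0, Fin.sum_univ_castSucc, Fin.sum_univ_castSucc (n := n + 1) (f := fun j => e.vartheta K n
      ((-1 : k) ^ (j : ℕ) • cls (e.KE K) n (face (LinearMap.mul k E) j x))), hlast,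
    Finset.sum_congr rfl fun j _ => (hface j.castSucc fun hh => by
      have := j.isLt
      rw [Fin.val_castSucc] at hh
      omega).symm]
  abel

/-- The summand of `ϑ x` that starts at `r > c` ends with `x_{r-1}`, which lies in `A` unless `r = c
+ 1`. In that one summand `x_c` is multiplied by the unit and put in front, which gives the rotation
to the place `c`. -/
theorem lastFace_vartheta {z : Cyc (e.KE K) n} (hz : z ∈ LinearMap.ker (e.proj K n)) :
    e.lastFace K n (e.vartheta K n z) = - e.t K n z := by
  refine ker_proj_le K (P := LinearMap.eqLocus (e.lastFace K n ∘ₗ e.vartheta K n)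
    (- e.t K n)) (fun x c h => ?_) hz
  have hcl := c.isLt
  rw [LinearMap.mem_eqLocus, LinearMap.comp_apply, LinearMap.neg_apply, h.vartheta_cls, h.t_cls,
    map_sum, Finset.sum_eq_single ((c : ℕ) + 1)]
  · have hcv := ofNat_val (n := n) (r := c + 1) (by omega)
    have hl : Fin.last n + Fin.ofNat (n + 1) (c + 1) = c := by
      have := val_add (Fin.last n) (Fin.ofNat (n + 1) (c + 1))
      rw [Fin.val_last, hcv] at this
      apply Fin.ext
      rw [this]
      split_ifs <;> omega
    rw [unitRotCls, map_smul, lastFace_cls_of_mem_M, face_last_cons_one, rot_rot, hl, smul_smul,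
      sign_last_face _ _ (by omega), Nat.add_sub_cancel, neg_smul, rotCls, ofNat_coe]
    rw [← Fin.succ_last, Fin.cons_succ, rot, hl]
    exact h.mem_M
  · intro r hr hrc
    rw [Finset.mem_Ioc] at hr
    have hcv := ofNat_val (n := n) (r := r) hr.2
    rw [unitRotCls, map_smul, lastFace_cls_of_mem_A, smul_zero]
    rw [← Fin.succ_last, Fin.cons_succ, rot]
    refine h.mem_A _ ?_
    have := val_add (Fin.last n) (Fin.ofNat (n + 1) r)
    rw [Fin.val_last, hcv] at this
    rw [Fin.lt_def, this]
    split_ifs <;> omega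
  · intro hh
    rw [Finset.mem_Ioc] at hh
    omega

theorem connesB_rotCls (x : Fin (n + 1) → E) (c : Fin (n + 1)) :
    e.connesB K n (rotCls (e.KE K) x c) = e.connesB K n (cls (e.KE K) n x) := by
  rw [rotCls, ofNat_coe, map_smul, connesB, LinearMap.sum_apply, LinearMap.sum_apply,
    Finset.smul_sum, sum_add_right (fun d => unitRot (e.KE K) n d (cls (e.KE K) n x)) c]
  refine Finset.sum_congr rfl fun d _ => ?_
  rw [unitRot_cls, unitRot_cls, rot_rot, smul_smul, ← pow_add]
  congr 1
  refine neg_one_pow_congr ?_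
  have h := val_add d c
  rw [h]
  split_ifs
  · rw [add_mul, add_comm]
  · have h1 : (d + c - (n + 1) : ℕ) * n + n * (n + 1) = c * n + d * n := by
      rw [mul_comm n, ← add_mul, ← add_mul]; congr 1; omega
    have h2 := mul_succ_mod_two n
    omega

theorem connesB_t {z : Cyc (e.KE K) n} (hz : z ∈ LinearMap.ker (e.proj K n)) :
    e.connesB K n (e.t K n z) = e.connesB K n z := by
  refine ker_proj_le K (P := LinearMap.eqLocus (e.connesB K n ∘ₗ e.t K n)
    (e.connesB K n)) (fun x c h => ?_) hz
  rw [LinearMap.mem_eqLocus, LinearMap.comp_apply, h.t_cls, connesB_rotCls]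

/-- In the tensor rotated to start at `c`, the entry `x_{c'}` stands at the place `n + 1 + c' - c`.
So `c'` is the preceding place of `M`: `ϑ` covers the rotations strictly after it up to `c`, and `t`
continues from it. -/
theorem vartheta_t_rotCls (x : Fin (n + 1) → E) {c : ℕ} (hc : c ≤ n + 1) {c' : ℕ} (hc' : c' < c)
    (h : e.LastAt (rot (Fin.ofNat (n + 1) c) x) (Fin.ofNat (n + 1) (n + 1 + c' - c))) :
    e.vartheta K n (rotCls (e.KE K) x c) =
      ∑ r ∈ Finset.Ioc c' c, unitRotCls (e.KE K) x r ∧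
    e.t K n (rotCls (e.KE K) x c) = rotCls (e.KE K) x c' := by
  have hv := ofNat_val (n := n) (r := n + 1 + c' - c) (by omega)
  rw [if_neg (by omega)] at hv
  constructor
  · rw [rotCls, map_smul, h.vartheta_cls, hv, Finset.smul_sum]
    refine Finset.sum_nbij' (fun r => r + c - (n + 1)) (fun r => r + (n + 1) - c) ?_ ?_ ?_ ?_ ?_
    · intro r; simp only [Finset.mem_Ioc]; omega
    · intro r; simp only [Finset.mem_Ioc]; omega
    · intro r; simp only [Finset.mem_Ioc]; omega
    · intro r; simp only [Finset.mem_Ioc]; omega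
    · intro r hr
      rw [Finset.mem_Ioc] at hr
      rw [unitRotCls, unitRotCls, rot_rot, smul_smul, ← pow_add]
      have : Fin.ofNat (n + 1) r + Fin.ofNat (n + 1) c = Fin.ofNat (n + 1) (r + c - (n + 1)) := by
        apply Fin.ext
        simp only [Fin.ofNat, Fin.val_add, Nat.add_mod_mod, Nat.mod_add_mod]
        conv_lhs => rw [show r + c = (r + c - (n + 1)) + (n + 1) by omega, Nat.add_mod_right]
      rw [this]
      congr 1
      refine neg_one_pow_congr ?_
      have h1 : (r + c - (n + 1) : ℕ) * n + n * (n + 1) = c * n + r * n := by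
        rw [mul_comm n, ← add_mul, ← add_mul]; congr 1; omega
      have h2 := mul_succ_mod_two n
      omega
  · rw [rotCls, map_smul, h.t_cls, rotCls, rotCls, hv, rot_rot, smul_smul, ← pow_add]
    have : Fin.ofNat (n + 1) (n + 1 + c' - c) + Fin.ofNat (n + 1) c = Fin.ofNat (n + 1) c' := by
      apply Fin.ext
      simp only [Fin.ofNat, Fin.val_add, Nat.add_mod_mod, Nat.mod_add_mod]
      rw [show n + 1 + c' - c + c = c' + (n + 1) by omega, Nat.add_mod_right]
    rw [this]
    congr 1
    refine neg_one_pow_congr ?_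
    have h1 : c' * n + n * (n + 1) = c * n + (n + 1 + c' - c) * n := by
      rw [mul_comm n, ← add_mul, ← add_mul]; congr 1; omega
    have h2 := mul_succ_mod_two n
    omega

/-- Each application of `t` steps down to the next place of `M`, and the intervals of rotations
covered by `ϑ` are adjacent. The count of places below `c` records how many steps remain; after `w +
1` steps all rotations have been used. -/
theorem sum_vartheta_t_pow {w : ℕ} {S : Finset (Fin (n + 1))} {x : Fin (n + 1) → E}
    (h : e.VerySimple S x) (hS : S.card = w + 1) (l : ℕ) (hl : l ≤ w + 1) :
    ∃ c ≤ n + 1, (S.filter fun s : Fin (n + 1) => (s : ℕ) < c).card + l = w + 1 ∧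
      (e.t K n ^ l) (cls (e.KE K) n x) = rotCls (e.KE K) x c ∧
      ∑ i ∈ Finset.range l, e.vartheta K n ((e.t K n ^ i) (cls (e.KE K) n x)) =
        ∑ r ∈ Finset.Ioc c (n + 1), unitRotCls (e.KE K) x r := by
  induction l with
  | zero =>
    -- Starting at the full rotation `n + 1` keeps all of `S` below `c`.
    refine ⟨n + 1, le_rfl, ?_, ?_, by simp⟩
    · rw [Finset.filter_true_of_mem fun s _ => s.isLt, hS]
    · rw [rotCls_period, rotCls, zero_mul, pow_zero, pow_zero, one_smul, Module.End.one_apply]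
      congr 1
      funext a
      simp [rot]
  | succ l ih =>
    obtain ⟨c, hc, hcard, ht, hsum⟩ := ih (by omega)
    have hne : (S.filter fun s : Fin (n + 1) => (s : ℕ) < c).Nonempty := Finset.card_pos.1 (by omega)
    obtain ⟨c', hc'def⟩ : ∃ c', c' = (S.filter fun s : Fin (n + 1) => (s : ℕ) < c).max' hne := ⟨_, rfl⟩
    have hc'mem := (S.filter fun s : Fin (n + 1) => (s : ℕ) < c).max'_mem hne
    rw [← hc'def, Finset.mem_filter] at hc'mem
    have hmax : ∀ s ∈ S, (s : ℕ) < c → s ≤ c' := fun s hs hsc => hc'def ▸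
      (S.filter fun s : Fin (n + 1) => (s : ℕ) < c).le_max' s (Finset.mem_filter.2 ⟨hs, hsc⟩)
    have hcv := ofNat_val hc
    have hc'l := c'.isLt
    have hv := ofNat_val (n := n) (r := n + 1 + c' - c) (by omega)
    rw [if_neg (by omega)] at hv
    have hlast : e.LastAt (rot (Fin.ofNat (n + 1) c) x) (Fin.ofNat (n + 1) (n + 1 + c' - c)) := by
      constructor
      · have : Fin.ofNat (n + 1) (n + 1 + c' - c) + Fin.ofNat (n + 1) c = c' := by
          have h1 := val_add (Fin.ofNat (n + 1) (n + 1 + c' - c)) (Fin.ofNat (n + 1) c)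
          apply Fin.ext
          rw [h1, hv, hcv]
          split_ifs <;> omega
        rw [rot, this]
        exact h.mem_M _ hc'mem.1
      · intro j hj
        refine h.mem_A _ fun hmem => ?_
        rw [Fin.lt_def, hv] at hj
        have h1 := val_add j (Fin.ofNat (n + 1) c)
        have hjl := j.isLt
        rw [hcv] at h1
        have h2 := hmax _ hmem
        rw [Fin.le_def, h1] at h2
        split_ifs at h2 <;> omega
    obtain ⟨h1, h2⟩ := vartheta_t_rotCls K x hc hc'mem.2 hlast
    refine ⟨c', by omega, ?_, ?_, ?_⟩
    · have : (S.filter fun s : Fin (n + 1) => (s : ℕ) < c') = (S.filter fun s : Fin (n + 1) => (s : ℕ) < c).erase c' := by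
        ext a
        simp only [Finset.mem_filter, Finset.mem_erase]
        constructor
        · rintro ⟨ha, hac⟩
          exact ⟨fun hh => by rw [hh] at hac; omega, ha, by omega⟩
        · rintro ⟨hne, ha, hac⟩
          refine ⟨ha, ?_⟩
          have h3 := hmax a ha hac
          exact lt_of_le_of_ne h3 fun hh => hne (Fin.ext hh)
      rw [this, Finset.card_erase_of_mem (Finset.mem_filter.2 hc'mem)]
      have := Finset.card_pos.2 hne
      omega
    · rw [pow_succ', Module.End.mul_apply, ht, h2]
    · rw [Finset.sum_range_succ, hsum, ht, h1, add_comm (Finset.sum _ _)]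
      exact Finset.sum_Ioc_consecutive _ hc'mem.2.le hc

theorem connesB_eq_sum_vartheta {w : ℕ} {z : Cyc (e.KE K) n} (hz : z ∈ e.X K n w) :
    e.connesB K n z = ∑ l ∈ Finset.range (w + 1), e.vartheta K n ((e.t K n ^ l) z) := by
  suffices e.X K n w ≤ LinearMap.eqLocus (e.connesB K n)
    (∑ l ∈ Finset.range (w + 1), e.vartheta K n ∘ₗ (e.t K n ^ l)) by
      have := this hz
      rw [LinearMap.mem_eqLocus] at this
      simpa only [LinearMap.sum_apply, LinearMap.comp_apply] using this
  refine e.X_le fun S x h hS => ?_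
  rw [LinearMap.mem_eqLocus, LinearMap.sum_apply]
  simp only [LinearMap.comp_apply]
  obtain ⟨c, hc, hcard, -, hsum⟩ := sum_vartheta_t_pow K h hS (w + 1) le_rfl
  have hc0 : c = 0 := by
    by_contra h0
    have : 0 ∈ S.filter fun s : Fin (n + 1) => (s : ℕ) < c :=
      Finset.mem_filter.2 ⟨h.zero_mem, Nat.pos_of_ne_zero h0⟩
    have := Finset.card_pos.2 ⟨_, this⟩
    omega
  rw [hsum, connesB_cls, hc0]

end CleftExtension
end

/-! ### Maps induced on homology. -/

section HomologyLemmas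
variable {k V W : Type*} [CommRing k] [AddCommGroup V] [Module k V] [AddCommGroup W] [Module k W]
  {deg : ℤ → Submodule k V} {D : V →ₗ[k] V} {deg' : ℤ → Submodule k W} {D' : W →ₗ[k] W}
  {f : V →ₗ[k] W}

theorem Homology.mk_eq_mk {m : ℤ} (x y : cycles deg D m) :
    (Submodule.Quotient.mk x : Homology deg D m) = Submodule.Quotient.mk y ↔
      (x : V) - y ∈ boundaries deg D m := by
  rw [Submodule.Quotient.eq]
  rfl

theorem homologyMap_mk {m m' : ℤ} (h : InducesOnHomology deg D deg' D' f m m')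
    (x : cycles deg D m) : homologyMap h (Submodule.Quotient.mk x) =
      Submodule.Quotient.mk ⟨f x, h.cycles_map x x.2⟩ := rfl

theorem inducesOnHomology_of_comm (s : ℤ) (hdeg : ∀ m, ∀ x ∈ deg m, f x ∈ deg' (m + s))
    (h : ∀ m, ∀ x ∈ deg m, D' (f x) = f (D x)) {m m' : ℤ} (hm : m' = m + s) :
    InducesOnHomology deg D deg' D' f m m' where
  cycles_map x hx := by
    subst hm
    refine ⟨hdeg m x hx.1, LinearMap.mem_ker.2 ?_⟩
    rw [h m x hx.1, LinearMap.mem_ker.1 hx.2, map_zero]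
  boundaries_map := by
    subst hm
    rintro _ ⟨x, hx, rfl⟩
    refine ⟨f x, ?_, h _ x hx⟩
    have := hdeg _ x hx
    rwa [add_right_comm] at this

theorem inducesOnHomology_of_anticomm (s : ℤ) (hdeg : ∀ m, ∀ x ∈ deg m, f x ∈ deg' (m + s))
    (h : ∀ m, ∀ x ∈ deg m, D' (f x) = - f (D x)) {m m' : ℤ} (hm : m' = m + s) :
    InducesOnHomology deg D deg' D' f m m' where
  cycles_map x hx := by
    subst hm
    refine ⟨hdeg m x hx.1, LinearMap.mem_ker.2 ?_⟩
    rw [h m x hx.1, LinearMap.mem_ker.1 hx.2, map_zero, neg_zero]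
  boundaries_map := by
    subst hm
    rintro _ ⟨x, hx, rfl⟩
    refine ⟨- f x, ?_, by rw [map_neg, h _ x hx, neg_neg]⟩
    have := hdeg _ x hx
    rw [add_right_comm] at this
    exact neg_mem this

/-- A chain map with a chain map that is inverse up to boundaries on cycles is an isomorphism on homology. -/
theorem bijective_homologyMap {m : ℤ} (h : InducesOnHomology deg D deg' D' f m m) (g : W →ₗ[k] V)
    (hg : InducesOnHomology deg' D' deg D g m m)
    (hgf : ∀ x ∈ cycles deg D m, x - g (f x) ∈ boundaries deg D m)
    (hfg : ∀ y ∈ cycles deg' D' m, y - f (g y) ∈ boundaries deg' D' m) :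
    Function.Bijective (homologyMap h) := by
  refine Function.bijective_iff_has_inverse.2 ⟨homologyMap hg, fun x => ?_, fun y => ?_⟩
  · obtain ⟨x, rfl⟩ := Submodule.Quotient.mk_surjective _ x
    rw [homologyMap_mk, homologyMap_mk, Eq.comm, Homology.mk_eq_mk]
    exact hgf x x.2
  · obtain ⟨y, rfl⟩ := Submodule.Quotient.mk_surjective _ y
    rw [homologyMap_mk, homologyMap_mk, Eq.comm, Homology.mk_eq_mk]
    exact hfg y y.2

end HomologyLemmas

/-! ### The abstract model of the relative mixed complex. -/

/-- The operators that relate the relative mixed complex `X ⊆ R` with its model on `V`. -/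
structure BaseModel (k R V : Type*) [CommRing k] [AddCommGroup R] [Module k R] [AddCommGroup V]
    [Module k V] where
  X : Submodule k R
  b : R →ₗ[k] R
  B : R →ₗ[k] R
  th : R →ₗ[k] R
  ι : V →ₗ[k] R
  T : R →ₗ[k] V
  lam : R →ₗ[k] V
  t : V →ₗ[k] V
  δ : V →ₗ[k] V
  δ' : V →ₗ[k] V
  N : V →ₗ[k] V
  b_mem : ∀ z ∈ X, b z ∈ X
  B_mem : ∀ z ∈ X, B z ∈ X
  th_mem : ∀ z, th z ∈ X
  ι_mem : ∀ v, ι v ∈ X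
  b_b : ∀ z, b (b z) = 0
  b_B : ∀ z, b (B z) + B (b z) = 0
  b_th : ∀ z ∈ X, b (th z) + th (b z) = z - ι (T z) + th (ι (lam z))
  T_ι : ∀ v, T (ι v) = t v
  T_th : ∀ z, T (th z) = 0
  T_B : ∀ z, T (B z) = 0
  th_th : ∀ z, th (th z) = 0
  lam_th_ι : ∀ v, lam (th (ι v)) = - t v
  lam_ι : ∀ v, lam (ι v) = δ v - δ' v
  B_eq : ∀ z ∈ X, B z = th (ι (N (T z)))
  b_ι : ∀ v, b (ι v) = ι (δ v)
  t_inj : ∀ v, t v = 0 → v = 0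
  t_N : ∀ v, t (N v) = N v
  N_t : ∀ v, N (t v) = N v

namespace BaseModel

variable {k R V : Type*} [CommRing k] [AddCommGroup R] [Module k R] [AddCommGroup V]
    [Module k V] (M : BaseModel k R V)

/-! ### Relations between the operators -/

theorem b_th_ι (v : V) : M.b (M.th (M.ι v)) = M.ι (v - M.t v) - M.th (M.ι (M.δ' v)) := by
  have h := M.b_th _ (M.ι_mem v)
  rw [M.b_ι, M.T_ι, M.lam_ι] at h
  simp only [map_sub] at h ⊢
  rw [eq_sub_of_add_eq h]
  abel

/-- `T` kills `th` and recovers `t v`; then `lam` recovers `-t u`. This independence lets every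
identity of the form `ι v + th ι u = 0` be split into its components, so no further computation with
tensors is needed. -/
theorem eq_zero_of_add {u v : V} (h : M.ι v + M.th (M.ι u) = 0) : v = 0 ∧ u = 0 := by
  have h1 := congrArg M.T h
  rw [map_add, M.T_ι, M.T_th, add_zero, map_zero] at h1
  have hv := M.t_inj _ h1
  subst hv
  rw [map_zero, zero_add] at h
  have h2 := congrArg M.lam h
  rw [M.lam_th_ι, map_zero, neg_eq_zero] at h2
  exact ⟨rfl, M.t_inj _ h2⟩

theorem th_ι_inj {u v : V} (h : M.th (M.ι u) = M.th (M.ι v)) : u = v := by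
  rw [← sub_eq_zero, ← map_sub, ← map_sub] at h
  exact sub_eq_zero.1 (M.eq_zero_of_add (v := 0) (by rw [map_zero, zero_add, h])).2

theorem δ_δ (v : V) : M.δ (M.δ v) = 0 := by
  refine (M.eq_zero_of_add (u := 0) ?_).1
  rw [map_zero, map_zero, add_zero, ← M.b_ι, ← M.b_ι, M.b_b]

/-- Apply `b` to `b_th_ι` and use `b² = 0`; the two components are the two claims. -/
theorem δ_sub_and (v : V) : M.δ (v - M.t v) - (M.δ' v - M.t (M.δ' v)) = 0 ∧
    M.δ' (M.δ' v) = 0 := by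
  refine M.eq_zero_of_add ?_
  have h := congrArg M.b (M.b_th_ι v)
  rw [M.b_b, map_sub, M.b_ι, M.b_th_ι] at h
  rw [map_sub M.ι (M.δ _), h]
  abel

theorem δ_sub (v : V) : M.δ (v - M.t v) = M.δ' v - M.t (M.δ' v) := sub_eq_zero.1 (M.δ_sub_and v).1

theorem δ'_δ' (v : V) : M.δ' (M.δ' v) = 0 := (M.δ_sub_and v).2

theorem B_ι (v : V) : M.B (M.ι v) = M.th (M.ι (M.N v)) := by
  rw [M.B_eq _ (M.ι_mem v), M.T_ι, M.N_t]

/-- This is `bB + Bb = 0` evaluated on `ι v`, where `B ι = th ι N` and the `ι`-component disappears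
because `t N = N`. -/
theorem δ'_N (v : V) : M.δ' (M.N v) = M.N (M.δ v) := by
  refine M.th_ι_inj ?_
  have h := M.b_B (M.ι v)
  rw [M.b_ι, M.B_ι, M.B_ι, M.b_th_ι, M.t_N, sub_self, map_zero, zero_sub, neg_add_eq_zero] at h
  exact h

/-- The element `b (th (b z))` is computed twice: from the homotopy formula for `b z`, and by
applying `b` to the one for `z`. -/
theorem T_b_and {z : R} (hz : z ∈ M.X) :
    M.T (M.b z) - (M.δ (M.T z) - (M.lam z - M.t (M.lam z))) = 0 ∧
      - (M.lam (M.b z) + M.δ' (M.lam z)) = 0 := by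
  refine M.eq_zero_of_add ?_
  have h1 := M.b_th _ (M.b_mem z hz)
  have h2 := congrArg M.b (M.b_th z hz)
  rw [M.b_b, map_zero, add_zero] at h1
  rw [map_add, M.b_b, zero_add, map_add, map_sub, M.b_ι, M.b_th_ι, h1] at h2
  simp only [map_sub, map_add, map_neg] at h2 ⊢
  rw [← sub_eq_zero] at h2
  rw [← neg_eq_zero, ← h2]
  abel

theorem T_b {z : R} (hz : z ∈ M.X) :
    M.T (M.b z) = M.δ (M.T z) - (M.lam z - M.t (M.lam z)) := sub_eq_zero.1 (M.T_b_and hz).1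

theorem lam_b {z : R} (hz : z ∈ M.X) : M.lam (M.b z) = - M.δ' (M.lam z) :=
  eq_neg_of_add_eq_zero_left (neg_eq_zero.1 (M.T_b_and hz).2)

theorem B_B {z : R} (hz : z ∈ M.X) : M.B (M.B z) = 0 := by
  rw [M.B_eq _ (M.B_mem z hz), M.T_B]
  simp

end BaseModel

/-- The model on `V`, together with the quotient `W` of coinvariants of `V` under `t`. -/
structure Model (k R V W : Type*) [CommRing k] [AddCommGroup R] [Module k R] [AddCommGroup V]
    [Module k V] [AddCommGroup W] [Module k W] extends BaseModel k R V where
  rDeg : ℤ → Submodule k R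
  vDeg : ℤ → Submodule k V
  wDeg : ℤ → Submodule k W
  q : V →ₗ[k] V
  s : V →ₗ[k] V
  tb : V →ₗ[k] W
  Nb : W →ₗ[k] V
  Db : W →ₗ[k] W
  ξ : W →ₗ[k] W
  Φ : W × W →ₗ[k] R
  Θ : (ℕ → R) →ₗ[k] W
  q_t : ∀ v, q (t v) = t (q v)
  N_q : ∀ v, N (q v) = q (N v)
  Nb_tb : ∀ v, Nb (tb v) = N v
  tb_t : ∀ v, tb (t v) = tb v
  tb_q_Nb : ∀ x, tb (q (Nb x)) = x
  N_s : ∀ v, N (s v) = 0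
  s_N : ∀ v, s (N v) = 0
  s_sub : ∀ v, s v - t (s v) = v - q (N v)
  s_sub' : ∀ v, s (v - t v) = v - q (N v)
  Db_tb : ∀ v, Db (tb v) = tb (δ v)
  ξ_eq : ∀ x, ξ x = tb (q (δ' (s (δ (q (Nb x))))))
  Φ_eq : ∀ x y, Φ (x, y) = ι (q (Nb x)) + th (ι (Nb y - s (δ (q (Nb x)))))
  Θ_eq : ∀ z, Θ z = tb (T (z 0))
  rDeg_neg : ∀ m < 0, ∀ z ∈ rDeg m, z = 0
  deg_b : ∀ m, ∀ z ∈ rDeg m, b z ∈ rDeg (m - 1)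
  deg_B : ∀ m, ∀ z ∈ rDeg m, B z ∈ rDeg (m + 1)
  deg_th : ∀ m, ∀ z ∈ rDeg m, th z ∈ rDeg (m + 1)
  deg_ι : ∀ m, ∀ v ∈ vDeg m, ι v ∈ rDeg m
  deg_T : ∀ m, ∀ z ∈ rDeg m, T z ∈ vDeg m
  deg_lam : ∀ m, ∀ z ∈ rDeg m, lam z ∈ vDeg (m - 1)
  deg_δ : ∀ m, ∀ v ∈ vDeg m, δ v ∈ vDeg (m - 1)
  deg_δ' : ∀ m, ∀ v ∈ vDeg m, δ' v ∈ vDeg (m - 1)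
  deg_q : ∀ m, ∀ v ∈ vDeg m, q v ∈ vDeg m
  deg_s : ∀ m, ∀ v ∈ vDeg m, s v ∈ vDeg m
  deg_tb : ∀ m, ∀ v ∈ vDeg m, tb v ∈ wDeg m
  deg_Nb : ∀ m, ∀ x ∈ wDeg m, Nb x ∈ vDeg m

namespace Model

variable {k R V W : Type*} [CommRing k] [AddCommGroup R] [Module k R] [AddCommGroup V]
    [Module k V] [AddCommGroup W] [Module k W] (M : Model k R V W)

/-! ### The differentials of `Φ` and of its inverse -/

theorem Φ_mem (x y : W) : M.Φ (x, y) ∈ M.X := by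
  rw [M.Φ_eq]
  exact add_mem (M.ι_mem _) (M.th_mem _)

theorem Nb_inj {x : W} (h : M.Nb x = 0) : x = 0 := by
  rw [← M.tb_q_Nb x, h, map_zero, map_zero]

theorem tb_sub (v : V) : M.tb (v - M.t v) = 0 := by rw [map_sub, M.tb_t, sub_self]

theorem tb_q_s (v : V) : M.tb (M.q (M.s v)) = 0 := by
  refine M.Nb_inj ?_
  rw [M.Nb_tb, M.N_q, M.N_s, map_zero]

theorem Nb_Db (x : W) : M.Nb (M.Db x) = M.δ' (M.Nb x) := by
  rw [← M.tb_q_Nb x, M.Db_tb, M.Nb_tb, M.Nb_tb, M.δ'_N]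

/-- The differential of `W` in terms of that of `V`. -/
theorem q_Nb_Db (x : W) : M.q (M.Nb (M.Db x)) =
    M.δ (M.q (M.Nb x)) - (M.s (M.δ (M.q (M.Nb x))) - M.t (M.s (M.δ (M.q (M.Nb x))))) := by
  rw [M.s_sub, sub_sub_cancel, ← M.Nb_tb, ← M.Db_tb, M.tb_q_Nb]

theorem s_δ_sub (v : V) :
    M.s (M.δ (v - M.t v)) = M.δ' v - M.q (M.N (M.δ' v)) := by
  rw [M.δ_sub, M.s_sub']

theorem q_Nb_ξ (x : W) : M.Nb (M.ξ x) = M.q (M.N (M.δ' (M.s (M.δ (M.q (M.Nb x)))))) := by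
  rw [M.ξ_eq, M.Nb_tb, M.N_q]

/-- The second component of the inclusion of the model `W × W`. -/
theorem δ'_second (x : W) : M.δ' (M.s (M.δ (M.q (M.Nb x)))) =
    M.Nb (M.ξ x) - M.s (M.δ (M.q (M.Nb (M.Db x)))) := by
  rw [M.q_Nb_Db, map_sub M.δ, M.δ_δ, zero_sub, map_neg, M.s_δ_sub, M.q_Nb_ξ]
  abel

theorem t_Nb (x : W) : M.t (M.Nb x) = M.Nb x := by
  rw [← M.tb_q_Nb x, M.Nb_tb, M.t_N]

/-- `Φ` commutes with the differentials. -/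
theorem b_Φ (x y : W) : M.b (M.Φ (x, y)) = M.Φ (M.Db x, M.ξ x - M.Db y) := by
  rw [M.Φ_eq, M.Φ_eq, map_add, M.b_ι, M.b_th_ι, M.q_Nb_Db x]
  have h := M.δ'_second x
  -- Up to sign, `δ'` carries the second component of `Φ(x, y)` to the second component of `Φ` at
  -- the differential of `(x, y)`. The operator `ξ` is the term that makes this true.
  have h1 : M.δ' (M.Nb y - M.s (M.δ (M.q (M.Nb x)))) =
      - (M.Nb (M.ξ x - M.Db y) - M.s (M.δ (M.q (M.Nb (M.Db x))))) := by
    rw [map_sub, h, map_sub, M.Nb_Db y]; abel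
  rw [h1]
  rw [M.q_Nb_Db x]
  simp only [map_sub, map_neg, M.t_Nb]
  abel

theorem Φ_inj {x y : W} (h : M.Φ (x, y) = 0) : x = 0 ∧ y = 0 := by
  rw [M.Φ_eq] at h
  obtain ⟨h1, h2⟩ := M.eq_zero_of_add h
  have hx : x = 0 := by rw [← M.tb_q_Nb x, h1, map_zero]
  subst hx
  simp only [map_zero, sub_zero] at h2
  exact ⟨rfl, M.Nb_inj h2⟩

/-- Since `Φ` is injective and intertwines the differentials, `b² = 0` passes to the cone. Its
second component contains the commutation of `ξ` with `Db`. -/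
theorem Db_Db_and (x y : W) : M.Db (M.Db x) = 0 ∧
    M.ξ (M.Db x) - M.Db (M.ξ x - M.Db y) = 0 :=
  M.Φ_inj (by rw [← M.b_Φ, ← M.b_Φ, M.b_b])

theorem Db_Db (x : W) : M.Db (M.Db x) = 0 := (M.Db_Db_and x 0).1

theorem Db_ξ (x : W) : M.Db (M.ξ x) = M.ξ (M.Db x) := by
  have := (M.Db_Db_and x 0).2
  rw [map_zero, sub_zero, sub_eq_zero] at this
  exact this.symm

/-- The inverse of `Φ` up to homotopy. -/
def Ω : R →ₗ[k] W × W :=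
  (M.tb ∘ₗ M.T).prod (M.tb ∘ₗ M.q ∘ₗ (M.δ' ∘ₗ M.s ∘ₗ M.T - M.lam))

theorem Ω_apply (z : R) : M.Ω z = (M.tb (M.T z), M.tb (M.q (M.δ' (M.s (M.T z)) - M.lam z))) := rfl

theorem tb_T_b {z : R} (hz : z ∈ M.X) : M.tb (M.T (M.b z)) = M.Db (M.tb (M.T z)) := by
  rw [M.T_b hz, map_sub, M.tb_sub, sub_zero, M.Db_tb]

theorem tb_q_δ'_q_N (v : V) : M.tb (M.q (M.δ' (M.q (M.N v)))) = M.Db (M.tb (M.q v)) := by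
  rw [← M.N_q, M.δ'_N, ← M.Nb_tb, M.tb_q_Nb, M.Db_tb]

/-- `Ω` commutes with the differentials. -/
theorem Ω_b {z : R} (hz : z ∈ M.X) : M.Ω (M.b z) =
    (M.Db (M.Ω z).1, M.ξ (M.Ω z).1 - M.Db (M.Ω z).2) := by
  refine Prod.ext (M.tb_T_b hz) ?_
  simp only [M.Ω_apply]
  rw [M.lam_b hz, M.T_b hz, map_sub M.s, M.s_sub', M.ξ_eq, M.Nb_tb]
  set v := M.T z
  set u := M.lam z
  -- Written this way, `s δ q N v` becomes `s δ v` plus terms in `δ' (s v)`, to which `δ' δ' = 0`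
  -- and `tb_q_δ'_q_N` apply.
  have h1 : M.q (M.N v) = v - (M.s v - M.t (M.s v)) := by rw [M.s_sub]; abel
  rw [h1, map_sub M.δ, map_sub M.s, M.s_δ_sub]
  simp only [map_sub, map_neg, map_zero, M.δ'_δ', ← M.tb_q_δ'_q_N]
  abel

theorem N_tb_q_Nb (x : W) : M.N (M.q (M.Nb x)) = M.Nb x := by
  rw [← M.Nb_tb, M.tb_q_Nb]

theorem t_q_Nb (x : W) : M.t (M.q (M.Nb x)) = M.q (M.Nb x) := by
  rw [← M.q_t, M.t_Nb]

theorem s_q_Nb (x : W) : M.s (M.q (M.Nb x)) = 0 := by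
  rw [← M.N_tb_q_Nb x, ← M.N_q, M.s_N]

/-- The homotopy from `Ω ∘ Φ` to the identity. -/
theorem sub_Ω_Φ (x y : W) : (x, y) - M.Ω (M.Φ (x, y)) =
    (0, M.tb (M.q (M.q (M.Nb (M.Db x)))) - M.Db (M.tb (M.q (M.q (M.Nb x))))) := by
  rw [M.Ω_apply, M.Φ_eq]
  simp only [map_add, map_sub, M.T_ι, M.T_th, add_zero, M.t_q_Nb, M.s_q_Nb, M.lam_ι, M.lam_th_ι,
    M.q_Nb_Db, M.tb_q_Nb, map_zero, zero_sub, M.q_t, M.tb_t, M.tb_q_s, map_neg, sub_zero, sub_self,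
    M.t_Nb, neg_zero]
  refine Prod.ext (by simp) ?_
  rw [← M.tb_q_δ'_q_N, M.N_tb_q_Nb]
  simp only [Prod.snd_sub]
  abel

theorem T_Φ (x y : W) : M.T (M.Φ (x, y)) = M.q (M.Nb x) := by
  rw [M.Φ_eq, map_add, M.T_ι, M.T_th, add_zero, M.t_q_Nb]

/-- `B` depends on its argument only through `N T`, and `N T Φ(x, y) = Nb x`. This is the
chain-level form of the formula for the connecting map. -/
theorem B_Φ {x y : W} : M.B (M.Φ (x, y)) = M.Φ (0, x) := by
  rw [M.B_eq _ (M.Φ_mem x y), M.T_Φ, M.N_tb_q_Nb, M.Φ_eq]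
  simp

/-- The homotopy from `Φ ∘ Ω` to the identity. -/
theorem sub_Φ_Ω {z : R} (hz : z ∈ M.X) : z - M.Φ (M.Ω z) =
    M.b (M.th z + M.th (M.ι (M.s (M.T z)))) + (M.th (M.b z) + M.th (M.ι (M.s (M.T (M.b z))))) := by
  rw [M.Ω_apply, M.Φ_eq, map_add, M.b_th_ι, M.Nb_tb, M.Nb_tb, M.T_b hz]
  have h := M.b_th z hz
  rw [map_sub M.s, M.s_sub']
  set v := M.T z
  set u := M.lam z
  have h1 : M.q (M.N v) = v - (M.s v - M.t (M.s v)) := by rw [M.s_sub]; abel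
  rw [h1, map_sub M.δ, map_sub M.s, M.s_δ_sub]
  rw [eq_sub_of_add_eq h]
  simp only [map_sub, M.N_q]
  abel

end Model
-- The homology of the abstract model.
namespace Model

variable {k R V W : Type*} [CommRing k] [AddCommGroup R] [Module k R] [AddCommGroup V]
    [Module k V] [AddCommGroup W] [Module k W] (M : Model k R V W)

/-! ### The complexes -/

/-- The degree `m` part of the relative complex. -/
def relDeg (m : ℤ) : Submodule k R := M.rDeg m ⊓ M.X

/-- The degree `m` part of the total complex of the mixed complex. -/
def bcDeg (m : ℤ) : Submodule k (ℕ → R) := Submodule.pi Set.univ fun j : ℕ => M.relDeg (m - 2 * j)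

/-- The differential of the total complex of the mixed complex. -/
def bcD : (ℕ → R) →ₗ[k] (ℕ → R) :=
  LinearMap.pi fun j => M.b ∘ₗ LinearMap.proj j + M.B ∘ₗ LinearMap.proj (j + 1)

/-- The inclusion of the column `0`. -/
def mapI : R →ₗ[k] (ℕ → R) := LinearMap.single k (fun _ : ℕ => R) 0

/-- The shift of the columns. -/
def mapS : (ℕ → R) →ₗ[k] (ℕ → R) := LinearMap.pi fun j => LinearMap.proj (j + 1)

/-- The map `z ↦ B z₀`. -/
def mapB : (ℕ → R) →ₗ[k] R := M.B ∘ₗ LinearMap.proj 0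

/-- The degree `m` part of the mapping cone of `ξ`. -/
def tildeDeg (m : ℤ) : Submodule k (W × W) := (M.wDeg m).prod (M.wDeg (m - 1))

/-- The differential of the mapping cone of `ξ`. -/
def tildeD : W × W →ₗ[k] W × W :=
  (M.Db ∘ₗ LinearMap.fst k _ _).prod (M.ξ ∘ₗ LinearMap.fst k _ _ - M.Db ∘ₗ LinearMap.snd k _ _)

theorem bcD_apply (z : ℕ → R) (j : ℕ) : M.bcD z j = M.b (z j) + M.B (z (j + 1)) := rfl

theorem tildeD_apply (x y : W) : M.tildeD (x, y) = (M.Db x, M.ξ x - M.Db y) := rfl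

theorem mem_bcDeg {m : ℤ} {z : ℕ → R} : z ∈ M.bcDeg m ↔ ∀ j : ℕ, z j ∈ M.relDeg (m - 2 * j) := by
  simp [bcDeg, Submodule.mem_pi]

/-! ### Degrees -/

theorem deg_Db {m : ℤ} {x : W} (hx : x ∈ M.wDeg m) : M.Db x ∈ M.wDeg (m - 1) := by
  rw [← M.tb_q_Nb x, M.Db_tb]
  exact M.deg_tb _ _ (M.deg_δ _ _ (M.deg_q _ _ (M.deg_Nb _ _ hx)))

theorem deg_ξ {m : ℤ} {x : W} (hx : x ∈ M.wDeg m) : M.ξ x ∈ M.wDeg (m - 2) := by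
  rw [M.ξ_eq, show m - 2 = m - 1 - 1 by ring]
  exact M.deg_tb _ _ (M.deg_q _ _ (M.deg_δ' _ _ (M.deg_s _ _
    (M.deg_δ _ _ (M.deg_q _ _ (M.deg_Nb _ _ hx))))))

theorem deg_th' {m : ℤ} {z : R} (hz : z ∈ M.rDeg (m - 1)) : M.th z ∈ M.rDeg m := by
  have := M.deg_th _ _ hz
  rwa [sub_add_cancel] at this

theorem deg_Φ {m : ℤ} {x y : W} (hx : x ∈ M.wDeg m) (hy : y ∈ M.wDeg (m - 1)) :
    M.Φ (x, y) ∈ M.relDeg m := by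
  refine ⟨?_, M.Φ_mem x y⟩
  have hu := M.deg_q _ _ (M.deg_Nb _ _ hx)
  rw [M.Φ_eq]
  exact add_mem (M.deg_ι _ _ hu) (M.deg_th' (M.deg_ι _ _ (sub_mem (M.deg_Nb _ _ hy)
    (M.deg_s _ _ (M.deg_δ _ _ hu)))))

theorem deg_rel_b {m : ℤ} {z : R} (hz : z ∈ M.relDeg m) : M.b z ∈ M.relDeg (m - 1) :=
  ⟨M.deg_b _ _ hz.1, M.b_mem _ hz.2⟩

theorem deg_rel_B {m : ℤ} {z : R} (hz : z ∈ M.relDeg m) : M.B z ∈ M.relDeg (m + 1) :=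
  ⟨M.deg_B _ _ hz.1, M.B_mem _ hz.2⟩

theorem isComplex_rel : IsComplex M.relDeg M.b := fun _ z hz => ⟨M.deg_rel_b hz, M.b_b z⟩

theorem bcD_bcD {m : ℤ} {z : ℕ → R} (hz : z ∈ M.bcDeg m) : M.bcD (M.bcD z) = 0 := by
  rw [mem_bcDeg] at hz
  funext j
  rw [bcD_apply, bcD_apply, bcD_apply, map_add, map_add, M.b_b, M.B_B (hz _).2, zero_add, add_zero]
  exact M.b_B _

theorem isComplex_bc : IsComplex M.bcDeg M.bcD := fun m z hz => by
  refine ⟨?_, M.bcD_bcD hz⟩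
  rw [mem_bcDeg] at hz ⊢
  intro j
  rw [bcD_apply]
  have h1 := M.deg_rel_b (hz j)
  have h2 := M.deg_rel_B (hz (j + 1))
  rw [show m - 2 * (j : ℤ) - 1 = m - 1 - 2 * j by ring] at h1
  rw [show m - 2 * ((j + 1 : ℕ) : ℤ) + 1 = m - 1 - 2 * j by push_cast; ring] at h2
  exact add_mem h1 h2

theorem isComplex_bar : IsComplex M.wDeg M.Db := fun _ x hx => ⟨M.deg_Db hx, M.Db_Db x⟩

theorem isComplex_tilde : IsComplex M.tildeDeg M.tildeD := by
  rintro m ⟨x, y⟩ hx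
  obtain ⟨hx, hy⟩ := Submodule.mem_prod.1 hx
  refine ⟨Submodule.mem_prod.2 ⟨M.deg_Db hx, ?_⟩, ?_⟩
  · have h := M.deg_ξ hx
    rw [show m - 2 = m - 1 - 1 by ring] at h
    exact sub_mem h (M.deg_Db hy)
  · rw [tildeD_apply, tildeD_apply, M.Db_Db, (M.Db_Db_and x y).2]
    rfl

/-! ### Maps induced on homology -/

theorem induces_S (n : ℤ) : InducesOnHomology M.bcDeg M.bcD M.bcDeg M.bcD
    (mapS (k := k) (R := R)) n (n - 2) := by
  refine inducesOnHomology_of_comm (-2) ?_ ?_ rfl <;> intro m z hz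
  swap
  · rfl
  rw [mem_bcDeg] at hz ⊢
  intro j
  have := hz (j + 1)
  rwa [show m - 2 * ((j + 1 : ℕ) : ℤ) = m + -2 - 2 * j by push_cast; ring] at this

theorem mem_bcDeg_zero {m : ℤ} {z : ℕ → R} (hz : z ∈ M.bcDeg m) : z 0 ∈ M.relDeg m := by
  have := M.mem_bcDeg.1 hz 0
  simpa using this

theorem induces_B (n : ℤ) : InducesOnHomology M.bcDeg M.bcD M.relDeg M.b M.mapB n (n + 1) := by
  refine inducesOnHomology_of_anticomm 1 ?_ ?_ rfl <;> intro m z hz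
  · exact M.deg_rel_B (M.mem_bcDeg_zero hz)
  rw [mem_bcDeg] at hz
  change M.b (M.B (z 0)) = - M.B (M.bcD z 0)
  rw [bcD_apply, map_add, M.B_B (hz _).2, add_zero, eq_neg_iff_add_eq_zero, M.b_B]

theorem mapI_mem {m : ℤ} {z : R} (hz : z ∈ M.relDeg m) : mapI (k := k) z ∈ M.bcDeg m := by
  rw [mem_bcDeg]
  intro j
  cases j with
  | zero => simpa [mapI] using hz
  | succ j => simp [mapI]

theorem bcD_mapI (z : R) : M.bcD (mapI (k := k) z) = mapI (k := k) (M.b z) := by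
  funext j
  rw [bcD_apply]
  cases j <;> simp [mapI]

theorem induces_I (n : ℤ) : InducesOnHomology M.relDeg M.b M.bcDeg M.bcD
    (mapI (k := k) (R := R)) n n :=
  inducesOnHomology_of_comm 0 (fun m z hz => by rw [add_zero]; exact M.mapI_mem hz)
    (fun m z _ => M.bcD_mapI z) (add_zero n).symm

theorem induces_ξ (n : ℤ) : InducesOnHomology M.wDeg M.Db M.wDeg M.Db M.ξ n (n - 2) :=
  inducesOnHomology_of_comm (-2) (fun _ _ hx => M.deg_ξ hx) (fun _ x _ => M.Db_ξ x) rfl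

theorem induces_i (n : ℤ) : InducesOnHomology M.wDeg M.Db M.tildeDeg M.tildeD
    (LinearMap.inr k W W) n (n + 1) := by
  refine inducesOnHomology_of_anticomm 1 (fun m y hy => ?_) (fun m y _ => ?_) rfl
  · refine Submodule.mem_prod.2 ⟨zero_mem _, ?_⟩
    rw [add_sub_cancel_right]
    exact hy
  · rw [LinearMap.inr_apply, tildeD_apply, LinearMap.inr_apply]
    simp

theorem induces_π (n : ℤ) : InducesOnHomology M.tildeDeg M.tildeD M.wDeg M.Db
    (LinearMap.fst k W W) n n := by
  refine inducesOnHomology_of_comm 0 ?_ ?_ (add_zero n).symm <;> intro m x hx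
  · rw [add_zero]
    exact (Submodule.mem_prod.1 hx).1
  · rfl

theorem Db_Θ {m : ℤ} {z : ℕ → R} (hz : z ∈ M.bcDeg m) : M.Db (M.Θ z) = M.Θ (M.bcD z) := by
  rw [M.Θ_eq, M.Θ_eq, bcD_apply, map_add, M.T_B, add_zero, M.tb_T_b (M.mem_bcDeg_zero hz).2]

theorem deg_Θ {m : ℤ} {z : ℕ → R} (hz : z ∈ M.bcDeg m) : M.Θ z ∈ M.wDeg m := by
  rw [M.Θ_eq]
  exact M.deg_tb _ _ (M.deg_T _ _ (M.mem_bcDeg_zero hz).1)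

theorem induces_Θ (n : ℤ) : InducesOnHomology M.bcDeg M.bcD M.wDeg M.Db M.Θ n n :=
  inducesOnHomology_of_comm 0 (fun m z hz => by rw [add_zero]; exact M.deg_Θ hz)
    (fun m z hz => M.Db_Θ hz) (add_zero n).symm

theorem induces_Φ (n : ℤ) : InducesOnHomology M.tildeDeg M.tildeD M.relDeg M.b M.Φ n n := by
  refine inducesOnHomology_of_comm 0 ?_ ?_ (add_zero n).symm <;> rintro m ⟨x, y⟩ hx
  · rw [add_zero]
    exact M.deg_Φ (Submodule.mem_prod.1 hx).1 (Submodule.mem_prod.1 hx).2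
  · exact M.b_Φ x y

theorem deg_Ω {m : ℤ} {z : R} (hz : z ∈ M.relDeg m) : M.Ω z ∈ M.tildeDeg m := by
  have h := M.deg_T _ _ hz.1
  exact Submodule.mem_prod.2 ⟨M.deg_tb _ _ h, M.deg_tb _ _ (M.deg_q _ _
    (sub_mem (M.deg_δ' _ _ (M.deg_s _ _ h)) (M.deg_lam _ _ hz.1)))⟩

theorem induces_Ω (n : ℤ) : InducesOnHomology M.relDeg M.b M.tildeDeg M.tildeD M.Ω n n := by
  refine inducesOnHomology_of_comm 0 ?_ ?_ (add_zero n).symm <;> intro m z hz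
  · rw [add_zero]
    exact M.deg_Ω hz
  · exact (M.Ω_b hz.2).symm

theorem bijective_Φ (n : ℤ) : Function.Bijective (homologyMap (M.induces_Φ n)) := by
  refine bijective_homologyMap _ M.Ω (M.induces_Ω n) ?_ ?_
  · rintro ⟨x, y⟩ ⟨hx, hD⟩
    obtain ⟨hx, -⟩ := Submodule.mem_prod.1 hx
    have hDx : M.Db x = 0 := congrArg Prod.fst (LinearMap.mem_ker.1 hD)
    rw [M.sub_Ω_Φ, hDx]
    -- On a cycle the term with `Db x` disappears, and the sign of the remaining one is supplied by
    -- the opposite differential on the second summand.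
    refine ⟨(0, M.tb (M.q (M.q (M.Nb x)))), Submodule.mem_prod.2 ⟨zero_mem _, ?_⟩, ?_⟩
    · rw [add_sub_cancel_right]
      exact M.deg_tb _ _ (M.deg_q _ _ (M.deg_q _ _ (M.deg_Nb _ _ hx)))
    · rw [tildeD_apply]
      simp
  · rintro z ⟨hz, hb⟩
    rw [M.sub_Φ_Ω hz.2, LinearMap.mem_ker.1 hb]
    refine ⟨M.th z + M.th (M.ι (M.s (M.T z))), ⟨add_mem (M.deg_th _ _ hz.1) (M.deg_th _ _
      (M.deg_ι _ _ (M.deg_s _ _ (M.deg_T _ _ hz.1)))), add_mem (M.th_mem _) (M.th_mem _)⟩, ?_⟩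
    simp

/-! ### The inverse of `Θ` -/

/-- The chain map `x ↦ (Φ(x, 0), -Φ(ξ x, 0), Φ(ξ² x, 0), …)`. -/
def Ξ : W →ₗ[k] (ℕ → R) :=
  LinearMap.pi fun j => M.Φ ∘ₗ LinearMap.inl k W W ∘ₗ ((-M.ξ) ^ j : Module.End k W)

theorem Ξ_apply (x : W) (j : ℕ) : M.Ξ x j = M.Φ (((-M.ξ) ^ j : Module.End k W) x, 0) := rfl

theorem deg_ξ_pow {m : ℤ} {x : W} (hx : x ∈ M.wDeg m) (j : ℕ) :
    ((-M.ξ) ^ j : Module.End k W) x ∈ M.wDeg (m - 2 * j) := by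
  induction j with
  | zero => simpa using hx
  | succ j ih =>
    rw [pow_succ', Module.End.mul_apply, LinearMap.neg_apply]
    have := M.deg_ξ ih
    rw [show m - 2 * (j : ℤ) - 2 = m - 2 * ((j + 1 : ℕ) : ℤ) by push_cast; ring] at this
    exact neg_mem this

theorem Db_ξ_pow (x : W) (j : ℕ) : M.Db (((-M.ξ) ^ j : Module.End k W) x) =
    ((-M.ξ) ^ j : Module.End k W) (M.Db x) := by
  induction j with
  | zero => rfl
  | succ j ih =>
    rw [pow_succ', Module.End.mul_apply, Module.End.mul_apply, LinearMap.neg_apply,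
      LinearMap.neg_apply, map_neg, M.Db_ξ, ih]

/-- In each column `b` produces a second component `ξ ((-ξ)^j x)`, which cancels against `B` of the
next column by `B_Φ`. The alternating signs are there for this. -/
theorem bcD_Ξ (x : W) : M.bcD (M.Ξ x) = M.Ξ (M.Db x) := by
  funext j
  rw [bcD_apply, Ξ_apply, Ξ_apply, Ξ_apply, M.b_Φ, M.B_Φ, ← map_add, map_zero, sub_zero,
    ← M.Db_ξ_pow, pow_succ', Module.End.mul_apply]
  congr 1
  simp

theorem induces_Ξ (n : ℤ) : InducesOnHomology M.wDeg M.Db M.bcDeg M.bcD M.Ξ n n :=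
  inducesOnHomology_of_comm 0 (fun m x hx => by
    rw [add_zero, mem_bcDeg]
    exact fun j => M.deg_Φ (M.deg_ξ_pow hx j) (zero_mem _)) (fun m x _ => M.bcD_Ξ x)
    (add_zero n).symm

theorem Θ_Ξ (x : W) : M.Θ (M.Ξ x) = x := by
  rw [M.Θ_eq, Ξ_apply, M.T_Φ, pow_zero, Module.End.one_apply, M.tb_q_Nb]

theorem S_Ξ (x : W) : mapS (k := k) (M.Ξ x) = - M.Ξ (M.ξ x) := by
  funext j
  change M.Ξ x (j + 1) = - M.Ξ (M.ξ x) j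
  rw [Ξ_apply, Ξ_apply, pow_succ, Module.End.mul_apply, LinearMap.neg_apply, map_neg, ← map_neg M.Φ,
    Prod.neg_mk, neg_zero]

theorem q_N_of_t {v : V} (h : v - M.t v = 0) : M.N (M.q v) = v := by
  have := M.s_sub' v
  rw [h, map_zero] at this
  rw [M.N_q, ← sub_eq_zero, ← neg_eq_zero, neg_sub, ← this]

/-- Cycles with zero image under `Θ` are boundaries. -/
theorem exists_of_Θ_eq_zero (l : ℕ) : ∀ n : ℤ, n < l → ∀ z ∈ M.bcDeg n, M.bcD z = 0 →
    M.Θ z = 0 → ∃ w ∈ M.bcDeg (n + 1), M.bcD w = z ∧ M.T (w 0) = 0 := by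
  -- `l` bounds the degree; removing column `0` lowers the degree by two, and in negative degrees
  -- everything is zero. The additional claim `T (w 0) = 0` makes `B` vanish on column `0` of the
  -- filling obtained by induction, so that shifting this filling does not disturb the new column
  -- `0`.
  induction l with
  | zero =>
    intro n hn z hz _ _
    refine ⟨0, zero_mem _, ?_, map_zero _⟩
    rw [map_zero]
    funext j
    exact (M.rDeg_neg _ (by push_cast at hn; omega) _ (M.mem_bcDeg.1 hz j).1).symm
  | succ l ih =>
    intro n hn z hz hD hΘ
    have hz0 := M.mem_bcDeg_zero hz
    rw [M.Θ_eq] at hΘ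
    have hT0 := M.deg_T _ _ hz0.1
    -- `Θ z = 0` gives `N (T (z 0)) = 0`, so `s` inverts `1 - t` on `T (z 0)`.
    obtain ⟨v, hv⟩ : ∃ v, v = M.s (M.T (z 0)) := ⟨_, rfl⟩
    have hTv : M.T (z 0) = v - M.t v := by
      rw [hv, M.s_sub, ← M.Nb_tb, hΘ, map_zero, map_zero, sub_zero]
    have hvdeg : v ∈ M.vDeg n := hv ▸ M.deg_s _ _ hT0
    obtain ⟨y, hy⟩ : ∃ y, y = M.δ' v - M.lam (z 0) := ⟨_, rfl⟩
    have hydeg : y ∈ M.vDeg (n - 1) := hy ▸ sub_mem (M.deg_δ' _ _ hvdeg) (M.deg_lam _ _ hz0.1)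
    have hD0 : M.b (z 0) = - M.B (z 1) := eq_neg_of_add_eq_zero_left (congrFun hD 0)
    have hz1 := (M.mem_bcDeg.1 hz 1).2
    -- the column `0` of `z` up to the boundary of the column `0` of `w`
    have hcol : z 0 = M.b (M.th (z 0) + M.th (M.ι v)) + M.th (M.ι y) := by
      have h := M.b_th _ hz0.2
      rw [hD0, M.B_eq _ hz1, map_neg, M.th_th, neg_zero, add_zero] at h
      rw [map_add, h, M.b_th_ι, hTv, hy]
      simp only [map_sub]
      abel
    -- Apply `b` to `hcol`: the `ι`-component of `b (th (ι y))` is `y - t y`, whereas `b (z 0) = -B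
    -- (z 1)` has no `ι`-component.
    have hy0 : y - M.t y = 0 := by
      refine (M.eq_zero_of_add (u := M.N (M.T (z 1)) - M.δ' y) ?_).1
      have h := congrArg M.b hcol
      rw [map_add, M.b_b, zero_add, M.b_th_ι, hD0, M.B_eq _ hz1] at h
      rw [map_sub M.ι (M.N _), map_sub M.th]
      rw [neg_eq_iff_eq_neg] at h
      rw [h]
      abel
    have hNy := M.q_N_of_t hy0
    -- What remains of column `0` is thus `B` of `ι (q y)`, which goes into column `1` of the
    -- filling. Its boundary under `b` has to be subtracted from column `1` of `z`.
    have hBy : M.B (M.ι (M.q y)) = M.th (M.ι y) := by rw [M.B_ι, hNy]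
    -- the remaining columns
    obtain ⟨z', hz'⟩ : ∃ z' : ℕ → R, z' = mapS (k := k) z - mapI (k := k) (M.b (M.ι (M.q y))) :=
      ⟨_, rfl⟩
    have hqy : M.ι (M.q y) ∈ M.relDeg (n - 1) :=
      ⟨M.deg_ι _ _ (M.deg_q _ _ hydeg), M.ι_mem _⟩
    have hz'deg : z' ∈ M.bcDeg (n - 2) := by
      rw [hz']
      refine sub_mem ?_ (M.mapI_mem ?_)
      · rw [mem_bcDeg] at hz ⊢
        intro j
        have := hz (j + 1)
        rwa [show n - 2 * ((j + 1 : ℕ) : ℤ) = n - 2 - 2 * j by push_cast; ring] at this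
      · have := M.deg_rel_b hqy
        rwa [show n - 1 - 1 = n - 2 by ring] at this
    have hDz' : M.bcD z' = 0 := by
      rw [hz', map_sub, M.bcD_mapI, M.b_b, map_zero, sub_zero]
      change mapS (k := k) (M.bcD z) = 0
      rw [hD, map_zero]
    have hz'0 : z' 0 = z 1 - M.b (M.ι (M.q y)) := by
      rw [hz']; simp [mapS, mapI]
    -- Here `-B b ι q y = b B ι q y = b th ι y = b (z 0) = -B (z 1)`, which cancels `B (z 1)`.
    have hBz' : M.B (z' 0) = 0 := by
      have h1 : M.B (M.b (M.ι (M.q y))) = - M.b (M.B (M.ι (M.q y))) :=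
        eq_neg_of_add_eq_zero_right (M.b_B _)
      have h2 := congrArg M.b hcol
      rw [map_add, M.b_b, zero_add, hD0] at h2
      rw [hz'0, map_sub, h1, hBy, ← h2]
      simp
    -- `B (z' 0) = th ι N T (z' 0)`, and `th ι` is injective, so the norm of `Θ z'` vanishes. This
    -- is what lets the induction continue.
    have hΘz' : M.Θ z' = 0 := by
      rw [M.Θ_eq]
      refine M.Nb_inj ?_
      rw [M.Nb_tb]
      rw [M.B_eq _ (M.mem_bcDeg_zero hz'deg).2] at hBz'
      exact M.th_ι_inj (by rw [hBz', map_zero, map_zero])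
    obtain ⟨w', hw'deg, hw', hTw'⟩ := ih (n - 2) (by push_cast at hn ⊢; omega) z' hz'deg hDz' hΘz'
    have hBw' : M.B (w' 0) = 0 := by
      rw [M.B_eq _ (M.mem_bcDeg_zero hw'deg).2, hTw']
      simp
    refine ⟨fun j => Nat.casesOn j (M.th (z 0) + M.th (M.ι v))
      (fun j => w' j + mapI (k := k) (M.ι (M.q y)) j), ?_, ?_, ?_⟩
    · rw [mem_bcDeg]
      intro j
      cases j with
      | zero =>
        simp only [Nat.cast_zero, mul_zero, sub_zero]
        exact ⟨add_mem (M.deg_th _ _ hz0.1) (M.deg_th _ _ (M.deg_ι _ _ hvdeg)),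
          add_mem (M.th_mem _) (M.th_mem _)⟩
      | succ j =>
        have h1 := M.mem_bcDeg.1 hw'deg j
        have h2 := M.mem_bcDeg.1 (M.mapI_mem hqy) j
        rw [show n - 2 + 1 - 2 * (j : ℤ) = n + 1 - 2 * ((j + 1 : ℕ) : ℤ) by push_cast; ring] at h1
        rw [show n - 1 - 2 * (j : ℤ) = n + 1 - 2 * ((j + 1 : ℕ) : ℤ) by push_cast; ring] at h2
        exact add_mem h1 h2
    · funext j
      rw [bcD_apply]
      cases j with
      | zero =>
        have : mapI (k := k) (M.ι (M.q y)) 0 = M.ι (M.q y) := by simp [mapI]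
        simp only [this, map_add M.B, hBw', hBy, zero_add]
        exact hcol.symm
      | succ j =>
        have h1 := congrFun hw' j
        have h2 := congrFun (M.bcD_mapI (M.ι (M.q y))) j
        rw [bcD_apply] at h1 h2
        simp only [map_add]
        have h3 : z (j + 1) = z' j + mapI (k := k) (M.b (M.ι (M.q y))) j := by
          rw [hz']; simp [mapS]
        rw [h3, ← h1, ← h2]
        abel
    · simp [M.T_th]

theorem sub_Ξ_Θ {n : ℤ} {z : ℕ → R} (hz : z ∈ cycles M.bcDeg M.bcD n) :
    z - M.Ξ (M.Θ z) ∈ boundaries M.bcDeg M.bcD n := by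
  have h := ((M.induces_Ξ n).cycles_map _ ((M.induces_Θ n).cycles_map z hz))
  have h2 := sub_mem hz h
  obtain ⟨w, hw, hD, -⟩ := M.exists_of_Θ_eq_zero (n + 1).toNat n
    (lt_of_lt_of_le (lt_add_one n) (Int.self_le_toNat _)) _ h2.1 (LinearMap.mem_ker.1 h2.2)
    (by rw [map_sub, M.Θ_Ξ, sub_self])
  exact ⟨w, hw, hD⟩

theorem bijective_Θ (n : ℤ) : Function.Bijective (homologyMap (M.induces_Θ n)) :=
  bijective_homologyMap _ M.Ξ (M.induces_Ξ n) (fun _ hz => M.sub_Ξ_Θ hz)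
    fun x _ => by rw [M.Θ_Ξ, sub_self]; exact zero_mem _

/-- A cycle `z` is homologous to `Ξ (Θ z)`, and on the image of `Ξ` the shift is `-ξ`. The same
replacement proves `homologyMap_B`, where `B` of the leading column of `Ξ x` is `Φ(0, x)`. -/
theorem homologyMap_Θ_S (n : ℤ) (z : Homology M.bcDeg M.bcD n) :
    homologyMap (M.induces_Θ (n - 2)) (homologyMap (M.induces_S n) z) =
      - homologyMap (M.induces_ξ n) (homologyMap (M.induces_Θ n) z) := by
  obtain ⟨z, rfl⟩ := Submodule.Quotient.mk_surjective _ z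
  rw [homologyMap_mk, homologyMap_mk, homologyMap_mk, homologyMap_mk, ← Submodule.Quotient.mk_neg,
    Homology.mk_eq_mk]
  have h := (M.induces_Θ (n - 2)).boundaries_map _
    ((M.induces_S n).boundaries_map _ (M.sub_Ξ_Θ z.2))
  rw [map_sub, M.S_Ξ, map_sub, map_neg, M.Θ_Ξ] at h
  exact h

theorem homologyMap_B (n : ℤ) (z : Homology M.bcDeg M.bcD n) :
    homologyMap (M.induces_B n) z =
      homologyMap (M.induces_Φ (n + 1)) (homologyMap (M.induces_i n)
        (homologyMap (M.induces_Θ n) z)) := by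
  obtain ⟨z, rfl⟩ := Submodule.Quotient.mk_surjective _ z
  rw [homologyMap_mk, homologyMap_mk, homologyMap_mk, homologyMap_mk, Homology.mk_eq_mk]
  have h := (M.induces_B n).boundaries_map _ (M.sub_Ξ_Θ z.2)
  have h2 : M.mapB (M.Ξ (M.Θ z)) = M.Φ (0, M.Θ z) := by
    change M.B (M.Ξ (M.Θ z) 0) = _
    rw [Ξ_apply, M.B_Φ]
    rfl
  rw [map_sub, h2] at h
  exact h

/-- This holds already on chains: `T Φ(x, y) = q (Nb x)`, whose class in the coinvariants is `x`. -/
theorem homologyMap_Θ_I_Φ (n : ℤ) (y : Homology M.tildeDeg M.tildeD n) :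
    homologyMap (M.induces_Θ n) (homologyMap (M.induces_I n) (homologyMap (M.induces_Φ n) y)) =
      homologyMap (M.induces_π n) y := by
  obtain ⟨y, rfl⟩ := Submodule.Quotient.mk_surjective _ y
  rw [homologyMap_mk, homologyMap_mk, homologyMap_mk, homologyMap_mk]
  congr 1
  refine Subtype.ext ?_
  change M.Θ (mapI (k := k) (M.Φ ((y : W × W).1, (y : W × W).2))) = (y : W × W).1
  have : mapI (k := k) (M.Φ ((y : W × W).1, (y : W × W).2)) 0 =
    M.Φ ((y : W × W).1, (y : W × W).2) := by simp [mapI]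
  rw [M.Θ_eq, this, M.T_Φ, M.tb_q_Nb]

end Model

/-! ### The tensors as an instance of the abstract model. -/

section
variable {k A E : Type*} [CommRing k] [Ring A] [Ring E] [Algebra k A] [Algebra k E]

namespace CleftExtension
variable (e : CleftExtension k A E) {K : Subalgebra k A} {n : ℕ}

/-! ### The decomposition of tensors by the number of entries in `M` -/

variable {e}

theorem eq_zero_of_mem_X {w : ℕ} (hw : n < w) {z : Cyc (e.KE K) n} (hz : z ∈ e.X K n w) : z = 0 := by
  suffices e.X K n w ≤ ⊥ from (Submodule.mem_bot k).1 (this hz)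
  refine e.X_le fun S x _ hS => ?_
  have := S.card_le_univ
  rw [Fintype.card_fin] at this
  omega

theorem VerySimple.patProj_cls {S : Finset (Fin (n + 1))} {x : Fin (n + 1) → E}
    (h : e.VerySimple S x) (S' : Finset (Fin (n + 1))) :
    e.patProj K S' (cls (e.KE K) n x) = if S' = S then cls (e.KE K) n x else 0 := by
  rw [patProj, mapFactors_cls]
  split_ifs with hS
  · subst hS
    congr 1
    funext j
    by_cases hj : j ∈ S'
    · simp only [hj, if_true]; exact e.piM_of_p (h.mem_M j hj)
    · simp only [hj, if_false]; exact e.piA_of_i (h.mem_A j hj)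
  · obtain ⟨j, hj⟩ : ∃ j, ¬ (j ∈ S' ↔ j ∈ S) := by
      by_contra hh
      push Not at hh
      exact hS (Finset.ext hh)
    refine cls_zero_entry _ (j := j) ?_
    by_cases hjS : j ∈ S
    · have : j ∉ S' := fun h' => hj (iff_of_true h' hjS)
      simp only [this, if_false]; exact e.piA_of_p (h.mem_M j hjS)
    · have : j ∈ S' := by by_contra h'; exact hj (iff_of_false h' hjS)
      simp only [this, if_true]; exact e.piM_of_i (h.mem_A j hjS)

variable (K) in
theorem coe_toX (w : ℕ) (z : Cyc (e.KE K) n) : (e.toX K n w z : Cyc (e.KE K) n) =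
    ∑ S ∈ Finset.univ.filter fun S : Finset (Fin (n + 1)) => 0 ∈ S ∧ S.card = w + 1,
      e.patProj K S z := by
  simp only [toX, LinearMap.codRestrict_apply, LinearMap.sum_apply]

theorem toX_of_mem {w : ℕ} (w' : ℕ) {z : Cyc (e.KE K) n} (hz : z ∈ e.X K n w) :
    (e.toX K n w' z : Cyc (e.KE K) n) = if w' = w then z else 0 := by
  suffices e.X K n w ≤ LinearMap.eqLocus ((e.X K n w').subtype ∘ₗ e.toX K n w')
      (if w' = w then LinearMap.id else 0) by
    have h := LinearMap.mem_eqLocus.1 (this hz)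
    split_ifs at h ⊢ <;> exact h
  refine e.X_le fun S x h hS => ?_
  rw [LinearMap.mem_eqLocus, LinearMap.comp_apply, Submodule.subtype_apply, coe_toX]
  simp only [h.patProj_cls]
  rw [Finset.sum_ite_eq']
  have : S ∈ (Finset.univ.filter fun S : Finset (Fin (n + 1)) => 0 ∈ S ∧ S.card = w' + 1) ↔
      w' = w := by
    simp only [Finset.mem_filter, Finset.mem_univ, true_and, h.zero_mem, hS]
    omega
  by_cases hw : w' = w
  · rw [if_pos (this.2 hw), if_pos hw]; rfl
  · rw [if_neg (mt this.1 hw), if_neg hw]; rfl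

theorem toX_coe (w : ℕ) (z : e.X K n w) : e.toX K n w (z : Cyc (e.KE K) n) = z :=
  Subtype.ext (by rw [toX_of_mem w z.2, if_pos rfl])

theorem toX_coe_of_ne {w w' : ℕ} (h : w' ≠ w) (z : e.X K n w) :
    e.toX K n w' (z : Cyc (e.KE K) n) = 0 :=
  Subtype.ext (by rw [toX_of_mem w' z.2, if_neg h]; rfl)

theorem toX_sum (v : ∀ w, e.X K n w) (w : ℕ) :
    e.toX K n w (∑ w' ∈ Finset.range (n + 1), (v w' : Cyc (e.KE K) n)) = v w := by
  rw [map_sum]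
  by_cases hw : w < n + 1
  · rw [Finset.sum_eq_single w (fun w' _ h => toX_coe_of_ne h.symm _)
      (fun h => absurd (Finset.mem_range.2 hw) h), toX_coe]
  · have h0 : v w = 0 := Subtype.ext (eq_zero_of_mem_X (by omega) (v w).2)
    rw [h0, Finset.sum_eq_zero]
    intro w' hw'
    exact toX_coe_of_ne (by rintro rfl; exact hw (Finset.mem_range.1 hw')) _

variable (K) in
-- This is the multilinear expansion of a tensor whose entries are split into their components in
-- `M` and `A`.
theorem sum_patProj (x : Fin (n + 1) → E) :
    ∑ S : Finset (Fin (n + 1)), e.patProj K S (cls (e.KE K) n x) = cls (e.KE K) n x := by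
  have h := (cls (e.KE K) n).map_add_univ (fun j => e.piM (x j)) (fun j => e.piA (x j))
  have h1 : ((fun j => e.piM (x j)) + fun j => e.piA (x j)) = x := by
    funext j; simp [piM_apply, piA_apply]
  rw [h1] at h
  refine Eq.trans (Finset.sum_congr rfl fun S _ => ?_) h.symm
  rw [patProj, mapFactors_cls]
  congr 1
  funext j
  by_cases hj : j ∈ S <;> simp [hj]

variable (K) in
theorem sum_toX_cls {x : Fin (n + 1) → E} (h : e.p (x 0) = 0) :
    ∑ w ∈ Finset.range (n + 1), (e.toX K n w (cls (e.KE K) n x) : Cyc (e.KE K) n) =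
      cls (e.KE K) n x := by
  conv_rhs => rw [← sum_patProj K x]
  rw [← Finset.sum_subset (Finset.subset_univ (Finset.univ.filter
    fun S : Finset (Fin (n + 1)) => 0 ∈ S))]
  -- The patterns are grouped by `S.card - 1`, the number `w` of entries in `M` other than the
  -- zeroth.
  · rw [← Finset.sum_fiberwise_of_maps_to (t := Finset.range (n + 1)) (g := fun S : Finset (Fin (n + 1)) => S.card - 1)]
    · refine Finset.sum_congr rfl fun w _ => ?_
      rw [coe_toX, Finset.filter_filter]
      refine Finset.sum_congr (Finset.filter_congr fun S _ => ?_) fun _ _ => rfl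
      refine and_congr_right fun hS => ?_
      have := Finset.card_pos.2 ⟨0, hS⟩
      omega
    · intro S _
      have := S.card_le_univ
      rw [Fintype.card_fin] at this
      rw [Finset.mem_range]
      omega
  · intro S _ hS
    have h0 : 0 ∉ S := by simpa using hS
    rw [patProj, mapFactors_cls]
    refine cls_zero_entry _ (j := 0) ?_
    simp only [h0, if_false]
    exact e.piA_of_p h

variable (K)

theorem zeroProjA_cls (x : Fin (n + 1) → E) : e.zeroProjA K n (cls (e.KE K) n x) =
    cls (e.KE K) n (Function.update x 0 (e.piA (x 0))) := by
  rw [zeroProjA, mapFactors_cls]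
  congr 1
  funext j
  by_cases h : j = 0
  · subst h; simp
  · simp [h]

theorem zeroProjA_cls_of_p {x : Fin (n + 1) → E} (h : e.p (x 0) = 0) :
    e.zeroProjA K n (cls (e.KE K) n x) = 0 := by
  rw [zeroProjA_cls]
  exact cls_zero_entry _ (j := 0) (by simp [e.piA_of_p h])

theorem toX_zeroProjA (w : ℕ) (z : Cyc (e.KE K) n) : e.toX K n w (e.zeroProjA K n z) = 0 := by
  refine lift_le (P := LinearMap.ker (e.toX K n w ∘ₗ e.zeroProjA K n)) (fun x => ?_) z
  rw [LinearMap.mem_ker, LinearMap.comp_apply, zeroProjA_cls]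
  refine Subtype.ext ?_
  rw [coe_toX]
  refine Finset.sum_eq_zero fun S hS => ?_
  rw [patProj, mapFactors_cls]
  refine cls_zero_entry _ (j := 0) ?_
  simp only [(Finset.mem_filter.1 hS).2.1, if_true, Function.update_self]
  exact e.piM_of_i ⟨e.p (x 0), rfl⟩

theorem sum_toX (z : Cyc (e.KE K) n) :
    ∑ w ∈ Finset.range (n + 1), (e.toX K n w z : Cyc (e.KE K) n) = z - e.zeroProjA K n z := by
  refine lift_le (P := LinearMap.eqLocus (∑ w ∈ Finset.range (n + 1),
    (e.X K n w).subtype ∘ₗ e.toX K n w) (LinearMap.id - e.zeroProjA K n)) (fun x => ?_) z |>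
    fun h => by simpa using LinearMap.mem_eqLocus.1 h
  rw [LinearMap.mem_eqLocus]
  simp only [LinearMap.sum_apply, LinearMap.comp_apply, LinearMap.sub_apply, LinearMap.id_apply,
    Submodule.subtype_apply]
  have h : cls (e.KE K) n x = cls (e.KE K) n (Function.update x 0 (e.piM (x 0))) +
      e.zeroProjA K n (cls (e.KE K) n x) := by
    rw [zeroProjA_cls]
    exact cls_update_add x 0 _ _ (by rw [piM_apply, piA_apply, sub_add_cancel])
  rw [← eq_sub_iff_add_eq.2 h.symm]
  refine Eq.trans (Finset.sum_congr rfl fun w _ => ?_) (sum_toX_cls K (by simp [p_piM]))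
  conv_lhs => rw [h]
  rw [map_add, toX_zeroProjA, add_zero]

theorem zeroProjA_t (z : Cyc (e.KE K) n) : e.zeroProjA K n (e.t K n z) = 0 := by
  refine lift_le (P := LinearMap.ker (e.zeroProjA K n ∘ₗ e.t K n)) (fun x => ?_) z
  rw [LinearMap.mem_ker, LinearMap.comp_apply, t, LinearMap.sum_apply, map_sum]
  refine Finset.sum_eq_zero fun c _ => ?_
  rw [rotTerm_cls, map_smul, zeroProjA_cls_of_p, smul_zero]
  simp [rot, lastM, p_piM]

theorem zeroProjA_lastFace (z : Cyc (e.KE K) (n + 1)) :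
    e.zeroProjA K n (e.lastFace K n z) = 0 := by
  refine lift_le (P := LinearMap.ker (e.zeroProjA K n ∘ₗ e.lastFace K n)) (fun x => ?_) z
  rw [LinearMap.mem_ker, LinearMap.comp_apply, lastFace_cls, map_smul, zeroProjA_cls_of_p, smul_zero]
  rw [face_last_zero, mulM_apply, map_mul, p_piM, zero_mul]

theorem sum_toX_t (z : Cyc (e.KE K) n) :
    ∑ w ∈ Finset.range (n + 1), (e.toX K n w (e.t K n z) : Cyc (e.KE K) n) = e.t K n z := by
  rw [sum_toX, zeroProjA_t, sub_zero]

theorem sum_toX_lastFace (z : Cyc (e.KE K) (n + 1)) :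
    ∑ w ∈ Finset.range (n + 1), (e.toX K n w (e.lastFace K n z) : Cyc (e.KE K) n) =
      e.lastFace K n z := by
  rw [sum_toX, zeroProjA_lastFace, sub_zero]

/-- The cyclic operator commutes with the projections, up to passing to coinvariants. -/
theorem toBar_theta (w : ℕ) (z : Cyc (e.KE K) n) :
    e.toBar K n w (e.theta K n w z) = e.toBar K n w (e.toX K n w (e.t K n z)) := by
  -- On the part starting in `M` the operator `t` preserves `w`, and it becomes the identity on
  -- coinvariants. So `t x + t y` and `x + t y` have the same class.
  have h : e.t K n z = ∑ w' ∈ Finset.range (n + 1),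
      ((e.tX K n w' (e.toX K n w' z) : e.X K n w') : Cyc (e.KE K) n) +
        e.t K n (e.zeroProjA K n z) := by
    rw [← sub_eq_iff_eq_add, ← map_sub, ← sum_toX, map_sum]
    rfl
  have h2 : e.toBar K n w (e.toX K n w z) = e.toBar K n w (e.tX K n w (e.toX K n w z)) :=
    (Submodule.Quotient.eq _).2 ⟨_, rfl⟩
  rw [h, map_add, toX_sum (fun w' => e.tX K n w' (e.toX K n w' z)), map_add, ← h2, ← map_add,
    ← map_add]
  rfl

/-! ### The components of the differentials -/

theorem mul_eq_dot_add_tri (x y : E) : x * y = e.dot x y + e.tri x y := by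
  rw [dot_apply, tri_apply]; abel

theorem hochschild_eq (z : Cyc (e.KE K) (n + 1)) :
    e.hochschild K n z = e.bFull K n z + ∑ j, e.rho K n j z := by
  refine lift_le (P := LinearMap.eqLocus (e.hochschild K n) (e.bFull K n + ∑ j, e.rho K n j))
    (fun x => ?_) z |> fun h => by simpa using LinearMap.mem_eqLocus.1 h
  rw [LinearMap.mem_eqLocus, LinearMap.add_apply, LinearMap.sum_apply, hochschild, bFull, faceSum_cls,
    faceSum_cls, ← Finset.sum_add_distrib]
  refine Finset.sum_congr rfl fun j _ => ?_
  rw [rho, faceMap_cls, ← smul_add]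
  congr 1
  have hf : ∀ op : E →ₗ[k] E →ₗ[k] E, face op j x =
      Function.update (face (LinearMap.mul k E) j x) (slot j) (op (x j) (x (j + 1))) := by
    intro op
    funext a
    by_cases ha : a = slot j
    · subst ha; simp [face_slot]
    · rw [Function.update_of_ne ha, face_other _ _ _ ha, face_other _ _ _ ha]
  rw [hf e.dot, hf e.tri]
  exact cls_update_add _ _ _ _ (by rw [face_slot]; exact mul_eq_dot_add_tri _ _)

variable {K}

theorem rho_of_mem_zero (j : Fin (n + 2)) {z : Cyc (e.KE K) (n + 1)} (hz : z ∈ e.X K (n + 1) 0) :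
    e.rho K n j z = 0 := by
  suffices e.X K (n + 1) 0 ≤ LinearMap.ker (e.rho K n j) from this hz
  refine e.X_le fun S x h hS => ?_
  rw [LinearMap.mem_ker, rho, faceMap_cls, h.face_tri_zero e j, smul_zero]
  rintro ⟨h1, h2⟩
  exact succ_ne j (Finset.card_le_one.1 hS.le _ h2 _ h1)

/-- The zeroth entry lies in `M`, so the product with the `M`-component of the last entry is the
operation `▽`. This is the source of `λ ι = δ - δ'`. -/
theorem lastFace_of_mem_X {w : ℕ} {z : Cyc (e.KE K) (n + 1)} (hz : z ∈ e.X K (n + 1) w) :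
    e.lastFace K n z = e.rho K n (Fin.last (n + 1)) z := by
  suffices e.X K (n + 1) w ≤ LinearMap.eqLocus (e.lastFace K n) (e.rho K n (Fin.last (n + 1)))
    from this hz
  refine e.X_le fun S x h hS => ?_
  rw [LinearMap.mem_eqLocus, lastFace_cls, rho, faceMap_cls, Fin.val_last]
  congr 2
  funext a
  rw [face_apply, face_apply]
  refine if_congr Iff.rfl ?_ rfl
  have h0 : (Fin.last (n + 1) : Fin (n + 2)) + 1 = 0 := by simp
  rw [h0, mulM_apply, tri_apply, e.piM_of_p (h.mem_M 0 h.zero_mem)]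

theorem mem_ker_proj_of_mem_X {w : ℕ} {z : Cyc (e.KE K) n} (hz : z ∈ e.X K n w) :
    z ∈ LinearMap.ker (e.proj K n) := by
  suffices e.X K n w ≤ LinearMap.ker (e.proj K n) from this hz
  exact e.X_le fun S x h _ => cls_mem_ker_proj K (h.mem_M 0 h.zero_mem)

end CleftExtension
end

section
variable {k A E : Type*} [CommRing k] [Ring A] [Ring E] [Algebra k A] [Algebra k E]

namespace CleftExtension
variable (e : CleftExtension k A E) (K : Subalgebra k A)

/-! ### The operators on the total modules -/

/-- The ambient product of all the `X_{v,w}`, indexed by `n = v + w` and `w`. -/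
abbrev XTot : Type _ := ∀ n w : ℕ, e.X K n w

/-- The component in `X_{v,w}`, `n = v + w`. -/
def XComp (n w : ℕ) : e.XTot K →ₗ[k] e.X K n w := LinearMap.proj w ∘ₗ LinearMap.proj n

/-- The inclusion of the tensors that start with an entry in `M`. -/
def totι : e.XTot K →ₗ[k] e.RelTot K :=
  LinearMap.pi fun n => ∑ w ∈ Finset.range (n + 1), (e.X K n w).subtype ∘ₗ e.XComp K n w

/-- The rotation of a tensor to the one that starts with its last entry in `M`. -/
def totT : e.RelTot K →ₗ[k] e.XTot K :=
  LinearMap.pi fun n => LinearMap.pi fun w => e.toX K n w ∘ₗ e.t K n ∘ₗ LinearMap.proj n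

/-- The last face for the multiplication by the component in `M` of the last entry. -/
def totLam : e.RelTot K →ₗ[k] e.XTot K :=
  LinearMap.pi fun n => LinearMap.pi fun w => e.toX K n w ∘ₗ e.lastFace K n ∘ₗ LinearMap.proj (n + 1)

/-- The operator `ϑ` on the product of all degrees. -/
def totTh : e.RelTot K →ₗ[k] e.RelTot K :=
  LinearMap.pi fun n => match n with
    | 0 => 0
    | n + 1 => e.vartheta K n ∘ₗ LinearMap.proj n

/-- The operator `t` on the product of the `X_{v,w}`. -/
def tott : e.XTot K →ₗ[k] e.XTot K :=
  LinearMap.pi fun n => LinearMap.pi fun w => e.tX K n w ∘ₗ e.XComp K n w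

/-- The operator `N` on the product of the `X_{v,w}`. -/
def totN : e.XTot K →ₗ[k] e.XTot K :=
  LinearMap.pi fun n => LinearMap.pi fun w => e.NX K n w ∘ₗ e.XComp K n w

/-- The differential `b + d`. -/
def totδ : e.XTot K →ₗ[k] e.XTot K :=
  LinearMap.pi fun n => LinearMap.pi fun w =>
    e.bX K n w ∘ₗ e.XComp K (n + 1) w + e.dX K n w ∘ₗ e.XComp K (n + 1) (w + 1)

/-- The differential `b + d'`. -/
def totδ' : e.XTot K →ₗ[k] e.XTot K :=
  LinearMap.pi fun n => LinearMap.pi fun w =>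
    e.bX K n w ∘ₗ e.XComp K (n + 1) w + e.dPrimeX K n w ∘ₗ e.XComp K (n + 1) (w + 1)

/-- The degree `m` part of the product of all the `E ⊗ Ē^{⊗ n} ⊗`. -/
def totDeg (m : ℤ) : Submodule k (e.RelTot K) := Submodule.pi {n : ℕ | (n : ℤ) ≠ m} fun _ => ⊥

/-- The degree `m` part of the product of all the `X_{v,w}`. -/
def XDeg (m : ℤ) : Submodule k (e.XTot K) := Submodule.pi {n : ℕ | (n : ℤ) ≠ m} fun _ => ⊥

variable {e K}

theorem mem_totDeg {m : ℤ} {z : e.RelTot K} :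
    z ∈ e.totDeg K m ↔ ∀ n : ℕ, (n : ℤ) ≠ m → z n = 0 := by
  simp only [totDeg, Submodule.mem_pi, Submodule.mem_bot, Set.mem_ofPred_eq]

theorem mem_XDeg {m : ℤ} {v : e.XTot K} :
    v ∈ e.XDeg K m ↔ ∀ n : ℕ, (n : ℤ) ≠ m → v n = 0 := by
  simp only [XDeg, Submodule.mem_pi, Submodule.mem_bot, Set.mem_ofPred_eq]

theorem mem_barDeg {m : ℤ} {x : e.BarTot K} :
    x ∈ e.barDeg K m ↔ ∀ n : ℕ, (n : ℤ) ≠ m → x n = 0 := by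
  simp only [barDeg, Submodule.mem_pi, Submodule.mem_bot, Set.mem_ofPred_eq]

theorem totι_apply (v : e.XTot K) (n : ℕ) :
    e.totι K v n = ∑ w ∈ Finset.range (n + 1), (v n w : Cyc (e.KE K) n) := by
  simp only [totι, LinearMap.pi_apply, LinearMap.sum_apply]
  rfl

theorem totι_mem_ker_proj (v : e.XTot K) (n : ℕ) : e.totι K v n ∈ LinearMap.ker (e.proj K n) := by
  rw [totι_apply]
  exact Submodule.sum_mem _ fun w _ => mem_ker_proj_of_mem_X (v n w).2

theorem totι_totT (z : e.RelTot K) (n : ℕ) : e.totι K (e.totT K z) n = e.t K n (z n) := by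
  rw [totι_apply]
  exact sum_toX_t K (z n)

theorem totι_totLam (z : e.RelTot K) (n : ℕ) :
    e.totι K (e.totLam K z) n = e.lastFace K n (z (n + 1)) := by
  rw [totι_apply]
  exact sum_toX_lastFace K (z (n + 1))

theorem coe_tX_pow {n w : ℕ} (l : ℕ) (z : e.X K n w) :
    (((e.tX K n w ^ l) z : e.X K n w) : Cyc (e.KE K) n) = (e.t K n ^ l) z := by
  induction l with
  | zero => simp
  | succ l ih => rw [pow_succ', pow_succ', Module.End.mul_apply, Module.End.mul_apply, ← ih]; rfl

variable (e K) in
theorem tX_pow_eq_one (n w : ℕ) : e.tX K n w ^ (w + 1) = 1 :=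
  LinearMap.ext fun z => Subtype.ext (by rw [coe_tX_pow]; exact e.t_pow_eq z.2)

theorem commute_tX_NX (n w : ℕ) : Commute (e.tX K n w) (e.NX K n w) :=
  Commute.sum_right _ _ _ fun l _ => Commute.pow_right (Commute.refl _) l

theorem tX_NX {n w : ℕ} (z : e.X K n w) : e.tX K n w (e.NX K n w z) = e.NX K n w z := by
  rw [← Module.End.mul_apply, (commute_tX_NX n w).eq, Module.End.mul_apply, NX_t]

theorem tX_inj {n w : ℕ} {z : e.X K n w} (h : e.tX K n w z = 0) : z = 0 := by
  have h1 := congrArg (fun f => f z) (tX_pow_eq_one e K n w)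
  rw [pow_succ] at h1
  simpa [h] using h1.symm

theorem toX_t_sum (v : e.XTot K) (n w : ℕ) :
    e.toX K n w (e.t K n (e.totι K v n)) = e.tX K n w (v n w) := by
  rw [totι_apply, map_sum]
  exact toX_sum (fun w' => e.tX K n w' (v n w')) w

theorem totLam_totι (v : e.XTot K) : e.totLam K (e.totι K v) = e.totδ K v - e.totδ' K v := by
  funext n w
  have h1 : (e.totδ K v - e.totδ' K v) n w =
      e.rhoX K n w (Fin.last (n + 1)) (v (n + 1) (w + 1)) := by
    change (e.bX K n w (v (n + 1) w) + e.dX K n w (v (n + 1) (w + 1))) -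
      (e.bX K n w (v (n + 1) w) + e.dPrimeX K n w (v (n + 1) (w + 1))) = _
    rw [dX, LinearMap.add_apply]
    abel
  rw [h1]
  change e.toX K n w (e.lastFace K n (e.totι K v (n + 1))) = _
  -- The summand `w = 0` drops out because `▽` needs two entries in `M`; the others move from `w +
  -- 1` to `w`.
  rw [totι_apply, map_sum, Finset.sum_range_succ', lastFace_of_mem_X (v (n + 1) 0).2,
    rho_of_mem_zero _ (v (n + 1) 0).2, add_zero, ← toX_sum (fun w' =>
      e.rhoX K n w' (Fin.last (n + 1)) (v (n + 1) (w' + 1)))]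
  congr 1
  exact Finset.sum_congr rfl fun w' _ => lastFace_of_mem_X (v (n + 1) (w' + 1)).2

theorem coe_dX {n w : ℕ} (z : e.X K (n + 1) (w + 1)) :
    (e.dX K n w z : Cyc (e.KE K) n) = ∑ j, e.rho K n j z := by
  refine Eq.trans ?_ (Fin.sum_univ_castSucc fun j => e.rho K n j (z : Cyc (e.KE K) (n + 1))).symm
  rw [dX, dPrimeX]
  simp only [LinearMap.add_apply, LinearMap.sum_apply, Submodule.coe_add, Submodule.coe_sum]
  rfl

theorem relb_totι (v : e.XTot K) : e.relb K (e.totι K v) = e.totι K (e.totδ K v) := by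
  funext n
  change e.hochschild K n (e.totι K v (n + 1)) = _
  have h1 : ∀ w, ((e.totδ K v n w : e.X K n w) : Cyc (e.KE K) n) =
      e.bFull K n (v (n + 1) w) + ∑ j, e.rho K n j (v (n + 1) (w + 1)) := fun w => by
    rw [← coe_dX]; rfl
  -- The top summand `w = n + 1` of the source contributes nothing under `bFull`, since a tensor
  -- with `n + 1` factors cannot have `n + 2` entries in `M`.
  rw [totι_apply, totι_apply, hochschild_eq, map_sum, Finset.sum_range_succ,
    eq_zero_of_mem_X (Nat.lt_succ_self n) (e.bFull_mem (v (n + 1) (n + 1)).2), add_zero]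
  simp only [h1, Finset.sum_add_distrib]
  congr 1
  rw [Finset.sum_comm]
  refine Finset.sum_congr rfl fun j _ => ?_
  rw [map_sum, Finset.sum_range_succ', rho_of_mem_zero _ (v (n + 1) 0).2, add_zero]

theorem connesB_eq_vartheta (z : e.RelTot K) {n : ℕ} (hz : z n ∈ LinearMap.ker (e.proj K n)) :
    e.connesB K n (z n) = e.vartheta K n (e.totι K (e.totN K (e.totT K z)) n) := by
  rw [← connesB_t K hz, ← totι_totT, totι_apply, totι_apply, map_sum, map_sum]
  refine Finset.sum_congr rfl fun w _ => ?_
  rw [connesB_eq_sum_vartheta K (e.totT K z n w).2, ← map_sum]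
  congr 1
  change _ = ((e.NX K n w (e.totT K z n w) : e.X K n w) : Cyc (e.KE K) n)
  rw [NX, LinearMap.sum_apply, Submodule.coe_sum]
  exact Finset.sum_congr rfl fun l _ => (coe_tX_pow l _).symm

variable (e K)

/-- The operators on the relative mixed complex and on the product of the `X_{v,w}`. -/
def baseModel : BaseModel k (e.RelTot K) (e.XTot K) where
  X := Submodule.pi Set.univ fun n => LinearMap.ker (e.proj K n)
  b := e.relb K
  B := e.relB K
  th := e.totTh K
  ι := e.totι K
  T := e.totT K
  lam := e.totLam K
  t := e.tott K
  δ := e.totδ K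
  δ' := e.totδ' K
  N := e.totN K
  b_mem z hz := Submodule.mem_pi.2 fun n _ =>
    hochschild_mem_ker_proj K (Submodule.mem_pi.1 hz (n + 1) trivial)
  B_mem z hz := Submodule.mem_pi.2 fun n _ => match n with
    | 0 => zero_mem _
    | n + 1 => connesB_mem_ker_proj K (Submodule.mem_pi.1 hz n trivial)
  th_mem z := Submodule.mem_pi.2 fun n _ => match n with
    | 0 => zero_mem _
    | n + 1 => vartheta_mem_ker_proj K (z n)
  ι_mem v := Submodule.mem_pi.2 fun n _ => totι_mem_ker_proj v n
  b_b z := funext fun n => faceSum_mul_sq (e.KE K) (z (n + 2))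
  b_B z := funext fun n => match n with
    | 0 => (add_zero _).trans (hochschild_connesB_zero K (z 0))
    | n + 1 => hochschild_connesB K (z (n + 1))
  b_th z hz := funext fun n => by
    have hz := Submodule.mem_pi.1 hz
    simp only [Pi.add_apply, Pi.sub_apply, totι_totT]
    cases n with
    | zero => exact (add_zero _).trans ((hochschild_vartheta_zero K (hz 0 trivial)).trans
        (add_zero _).symm)
    | succ n =>
      refine (hochschild_vartheta K (hz (n + 1) trivial)).trans ?_
      rw [← totι_totLam]
      rfl
  T_ι v := funext fun n => funext fun w => toX_t_sum v n w
  T_th z := funext fun n => funext fun w => match n with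
    | 0 => by
      change e.toX K 0 w (e.t K 0 0) = 0
      rw [map_zero, map_zero]
    | n + 1 => by
      change e.toX K (n + 1) w (e.t K (n + 1) (e.vartheta K n (z n))) = 0
      rw [t_vartheta, map_zero]
  T_B z := funext fun n => funext fun w => match n with
    | 0 => by
      change e.toX K 0 w (e.t K 0 0) = 0
      rw [map_zero, map_zero]
    | n + 1 => by
      change e.toX K (n + 1) w (e.t K (n + 1) (e.connesB K n (z n))) = 0
      rw [t_connesB, map_zero]
  th_th z := funext fun n => match n with
    | 0 => rfl
    | 1 => map_zero (e.vartheta K 0)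
    | n + 2 => vartheta_vartheta K n (z n)
  lam_th_ι v := funext fun n => funext fun w => by
    change e.toX K n w (e.lastFace K n (e.vartheta K n (e.totι K v n))) = - e.tX K n w (v n w)
    rw [lastFace_vartheta K (totι_mem_ker_proj v n), map_neg, toX_t_sum]
  lam_ι v := totLam_totι v
  B_eq z hz := funext fun n => match n with
    | 0 => rfl
    | n + 1 => connesB_eq_vartheta z (Submodule.mem_pi.1 hz n trivial)
  b_ι v := relb_totι v
  t_inj v h := funext fun n => funext fun w => tX_inj (congrFun (congrFun h n) w)
  t_N v := funext fun n => funext fun w => tX_NX (v n w)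
  N_t v := funext fun n => funext fun w => e.NX_t K n w (v n w)

end CleftExtension
end

/-! ### Averaging over the powers of a cyclic operator. -/

theorem sum_pow_mul_sum_pow {R : Type*} [Ring R] {T : R} {w : ℕ} (hT : T ^ (w + 1) = 1) (l : ℕ) :
    T ^ l * ∑ j ∈ Finset.range (w + 1), T ^ j = ∑ j ∈ Finset.range (w + 1), T ^ j := by
  induction l with
  | zero => rw [pow_zero, one_mul]
  | succ l ih =>
    rw [pow_succ, mul_assoc, Finset.mul_sum]
    have : ∑ j ∈ Finset.range (w + 1), T * T ^ j = ∑ j ∈ Finset.range (w + 1), T ^ j := by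
      simp only [← pow_succ']
      rw [Finset.sum_range_succ, hT, Finset.sum_range_succ' _ w, pow_zero]
    rw [this, ih]

section CyclicAlgebra
variable {k R : Type*} [CommRing k] [Algebra ℚ k] [Ring R] [Algebra k R]

/-- The averaging operator `σ' = ∑_j (w - j) / (w + 1) T^j` inverts `1 - T` up to the mean of the powers
of `T`. -/
theorem one_sub_mul_sum (T : R) (w : ℕ) :
    (1 - T) * ∑ j ∈ Finset.range w, algebraMap ℚ k (((w : ℚ) - j) / (w + 1)) • T ^ j =
      1 - algebraMap ℚ k (1 / ((w : ℚ) + 1)) • ∑ j ∈ Finset.range (w + 1), T ^ j := by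
  have hw : (w : ℚ) + 1 ≠ 0 := by positivity
  set a : ℕ → k := fun j => algebraMap ℚ k (((w : ℚ) - j) / (w + 1)) with ha
  set q : k := algebraMap ℚ k (1 / ((w : ℚ) + 1)) with hq
  have h0 : a 0 = 1 - q := by
    have h : ((w : ℚ) - (0 : ℕ)) / (w + 1) = 1 - 1 / (w + 1) := by
      push_cast
      field_simp
      ring
    simpa only [map_sub, map_one] using congrArg (algebraMap ℚ k) h
  have hs : ∀ j, a (j + 1) = a j - q := fun j => by
    have h : ((w : ℚ) - (j + 1 : ℕ)) / (w + 1) = (w - j) / (w + 1) - 1 / (w + 1) := by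
      push_cast
      field_simp
      ring
    exact (congrArg (algebraMap ℚ k) h).trans (map_sub _ _ _)
  -- The coefficients start at `1 - q`, decrease by `q` and reach zero at `w`, so the product with
  -- `1 - T` telescopes.
  have key : ∀ m, (1 - T) * ∑ j ∈ Finset.range m, a j • T ^ j =
      1 - a m • T ^ m - q • ∑ j ∈ Finset.range (m + 1), T ^ j := fun m => by
    induction m with
    | zero => simp [h0, sub_smul]
    | succ m ih =>
      rw [Finset.sum_range_succ, mul_add, ih, Finset.sum_range_succ _ (m + 1), hs, smul_add,
        mul_smul_comm, sub_mul, one_mul, ← pow_succ', smul_sub, sub_smul]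
      abel
  rw [key w]
  have : a w = 0 := by rw [ha]; simp
  rw [this, zero_smul, sub_zero]

end CyclicAlgebra

section
variable {k A E : Type*} [CommRing k] [Ring A] [Ring E] [Algebra k A] [Algebra k E]

namespace CleftExtension
variable {e : CleftExtension k A E} {K : Subalgebra k A} {n w : ℕ}

/-! ### Coinvariants and the double complex -/

theorem tX_pow_NX (l : ℕ) (z : e.X K n w) : (e.tX K n w ^ l) (e.NX K n w z) = e.NX K n w z := by
  have := sum_pow_mul_sum_pow (R := Module.End k (e.X K n w)) (tX_pow_eq_one e K n w) l
  exact congrArg (fun f => f z) this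

theorem NX_NX (z : e.X K n w) : e.NX K n w (e.NX K n w z) = ((w + 1 : ℕ) : k) • e.NX K n w z := by
  conv_lhs => rw [NX]
  rw [LinearMap.sum_apply]
  change ∑ l ∈ Finset.range (w + 1), (e.tX K n w ^ l) (e.NX K n w z) = _
  simp only [tX_pow_NX, Finset.sum_const, Finset.card_range, Nat.cast_smul_eq_nsmul]

theorem toBar_tX (z : e.X K n w) : e.toBar K n w (e.tX K n w z) = e.toBar K n w z :=
  ((Submodule.Quotient.eq (LinearMap.range (LinearMap.id - e.tX K n w))).2 ⟨z, rfl⟩).symm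

theorem toBar_tX_pow (l : ℕ) (z : e.X K n w) :
    e.toBar K n w ((e.tX K n w ^ l) z) = e.toBar K n w z := by
  induction l with
  | zero => rfl
  | succ l ih => rw [pow_succ', Module.End.mul_apply, toBar_tX, ih]

theorem toBar_NX (z : e.X K n w) :
    e.toBar K n w (e.NX K n w z) = ((w + 1 : ℕ) : k) • e.toBar K n w z := by
  simp only [NX, LinearMap.sum_apply, map_sum, toBar_tX_pow, Finset.sum_const, Finset.card_range,
    Nat.cast_smul_eq_nsmul]

theorem NBar_toBar (z : e.X K n w) : e.NBar K n w (e.toBar K n w z) = e.NX K n w z := rfl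

theorem toBar_surjective (x : e.Xbar K n w) : ∃ z, e.toBar K n w z = x :=
  Submodule.mkQ_surjective _ x

theorem bX_tX_pow (l : ℕ) (z : e.X K (n + 1) w) :
    e.bX K n w ((e.tX K (n + 1) w ^ l) z) = (e.tX K n w ^ l) (e.bX K n w z) := by
  induction l with
  | zero => rfl
  | succ l ih => rw [pow_succ', pow_succ', Module.End.mul_apply, Module.End.mul_apply, bX_t, ih]

theorem bX_NX (z : e.X K (n + 1) w) :
    e.bX K n w (e.NX K (n + 1) w z) = e.NX K n w (e.bX K n w z) := by
  simp only [NX, LinearMap.sum_apply, map_sum, bX_tX_pow]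

/-- The abstract relation `δ' N = N δ`, applied to an element with a single component, isolates the
part that lowers `w` by one. `dX_dX` is extracted from `δ δ = 0` in the same way. -/
theorem dPrimeX_NX (z : e.X K (n + 1) (w + 1)) :
    e.dPrimeX K n w (e.NX K (n + 1) (w + 1) z) = e.NX K n w (e.dX K n w z) := by
  have h := congrFun (congrFun ((e.baseModel K).δ'_N (Pi.single (n + 1) (Pi.single (w + 1) z))) n) w
  change e.bX K n w (e.NX K (n + 1) w ((Pi.single (n + 1) (Pi.single (w + 1) z) : e.XTot K) _ _)) +
    e.dPrimeX K n w (e.NX K (n + 1) (w + 1)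
      ((Pi.single (n + 1) (Pi.single (w + 1) z) : e.XTot K) _ _)) =
    e.NX K n w (e.bX K n w ((Pi.single (n + 1) (Pi.single (w + 1) z) : e.XTot K) _ _) +
      e.dX K n w ((Pi.single (n + 1) (Pi.single (w + 1) z) : e.XTot K) _ _)) at h
  simpa using h

theorem dX_dX (z : e.X K (n + 2) (w + 2)) : e.dX K n w (e.dX K (n + 1) (w + 1) z) = 0 := by
  have h := congrFun (congrFun ((e.baseModel K).δ_δ (Pi.single (n + 2) (Pi.single (w + 2) z))) n) w
  change e.bX K n w (e.bX K (n + 1) w ((Pi.single (n + 2) (Pi.single (w + 2) z) : e.XTot K) _ _) +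
      e.dX K (n + 1) w ((Pi.single (n + 2) (Pi.single (w + 2) z) : e.XTot K) _ _)) +
    e.dX K n w (e.bX K (n + 1) (w + 1) ((Pi.single (n + 2) (Pi.single (w + 2) z) : e.XTot K) _ _) +
      e.dX K (n + 1) (w + 1) ((Pi.single (n + 2) (Pi.single (w + 2) z) : e.XTot K) _ _)) = 0 at h
  simpa using h

theorem dBar_toBar (z : e.X K (n + 1) (w + 1)) :
    e.dBar K n w (e.toBar K (n + 1) (w + 1) z) = e.toBar K n w (e.dX K n w z) := rfl

theorem bBar_toBar (z : e.X K (n + 1) w) :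
    e.bBar K n w (e.toBar K (n + 1) w z) = e.toBar K n w (e.bX K n w z) := rfl

end CleftExtension
end

section
variable {k A E : Type*} [CommRing k] [Algebra ℚ k] [Ring A] [Ring E] [Algebra k A] [Algebra k E]

namespace CleftExtension
variable {e : CleftExtension k A E} {K : Subalgebra k A} {n w : ℕ}

/-! ### The averaging operators on `X_{v,w}` -/

variable (k) in
/-- The scalar `1 / (w + 1)`. -/
def qw (w : ℕ) : k := algebraMap ℚ k (1 / ((w : ℚ) + 1))

variable (e K) in
/-- `σ = σ' - (1 / (w + 1)) N σ'`. -/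
def sX (n w : ℕ) : e.X K n w →ₗ[k] e.X K n w :=
  e.sigma' K n w - qw k w • (e.NX K n w ∘ₗ e.sigma' K n w)

theorem sX_apply (z : e.X K n w) :
    e.sX K n w z = e.sigma' K n w z - qw k w • e.NX K n w (e.sigma' K n w z) := rfl

theorem qw_smul (w : ℕ) {G : Type*} [AddCommGroup G] [Module k G] (x : G) :
    qw k w • ((w + 1 : ℕ) : k) • x = x := by
  have hw : (w : ℚ) + 1 ≠ 0 := by positivity
  have : qw k w * ((w + 1 : ℕ) : k) = 1 := by
    rw [qw, ← map_natCast (algebraMap ℚ k), ← map_mul, ← map_one (algebraMap ℚ k)]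
    congr 1
    push_cast
    field_simp
  rw [smul_smul, this, one_smul]

theorem commute_sigma'_tX : Commute (e.sigma' K n w) (e.tX K n w) :=
  Commute.sum_left _ _ _ fun _ _ => (Commute.pow_left (Commute.refl _) _).smul_left _

theorem sigma'_tX (z : e.X K n w) : e.sigma' K n w (e.tX K n w z) = e.tX K n w (e.sigma' K n w z) :=
  congrArg (fun f => f z) commute_sigma'_tX.eq

theorem sigma'_NX (z : e.X K n w) : ∃ c : k, e.sigma' K n w (e.NX K n w z) = c • e.NX K n w z := by
  refine ⟨∑ j ∈ Finset.range w, algebraMap ℚ k (((w : ℚ) - j) / (w + 1)), ?_⟩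
  simp only [sigma', LinearMap.sum_apply, LinearMap.smul_apply, tX_pow_NX, Finset.sum_smul]

theorem sigma'_sub (z : e.X K n w) : e.sigma' K n w z - e.tX K n w (e.sigma' K n w z) =
    z - qw k w • e.NX K n w z :=
  congrArg (fun f : Module.End k (e.X K n w) => f z) (one_sub_mul_sum (k := k) (e.tX K n w) w)

/-- Subtracting the mean from `σ'` gives an operator annihilated by `N` on both sides that still
satisfies `(1 - t) σ = 1 - N / (w + 1)`. The abstract model needs all three properties. -/
theorem NX_sX (z : e.X K n w) : e.NX K n w (e.sX K n w z) = 0 := by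
  rw [sX_apply, map_sub, map_smul, NX_NX]
  exact sub_eq_zero.2 (qw_smul (k := k) (G := e.X K n w) w _).symm

theorem sX_NX (z : e.X K n w) : e.sX K n w (e.NX K n w z) = 0 := by
  obtain ⟨c, hc⟩ := sigma'_NX z
  rw [sX_apply, hc, map_smul, NX_NX, smul_comm c]
  exact sub_eq_zero.2 (qw_smul (k := k) (G := e.X K n w) w _).symm

theorem sX_sub (z : e.X K n w) : e.sX K n w z - e.tX K n w (e.sX K n w z) =
    z - qw k w • e.NX K n w z := by
  rw [← sigma'_sub, sX_apply, map_sub, map_smul, tX_NX]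
  abel

theorem sX_tX (z : e.X K n w) : e.sX K n w (e.tX K n w z) = e.tX K n w (e.sX K n w z) := by
  rw [sX_apply, sX_apply, sigma'_tX, map_sub, map_smul, tX_NX, NX_t]

/-! ### Coinvariants -/

variable (e K) in
theorem toBar_sigma' (n w : ℕ) :
    ∃ c : k, ∀ z, e.toBar K n w (e.sigma' K n w z) = c • e.toBar K n w z := by
  refine ⟨∑ j ∈ Finset.range w, algebraMap ℚ k (((w : ℚ) - j) / (w + 1)), fun z => ?_⟩
  simp only [sigma', LinearMap.sum_apply, LinearMap.smul_apply, map_sum, map_smul, toBar_tX_pow,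
    Finset.sum_smul]

theorem toBar_NBar (x : e.Xbar K n w) : e.toBar K n w (qw k w • e.NBar K n w x) = x := by
  obtain ⟨z, rfl⟩ := toBar_surjective x
  rw [map_smul, NBar_toBar, toBar_NX, qw_smul]

theorem toBar_sX (z : e.X K n w) : e.toBar K n w (e.sX K n w z) = 0 := by
  rw [← toBar_NBar (e.toBar K n w (e.sX K n w z)), NBar_toBar, NX_sX, smul_zero, map_zero]

theorem sX_NBar (x : e.Xbar K n w) : e.sX K n w (e.NBar K n w x) = 0 := by
  obtain ⟨z, rfl⟩ := toBar_surjective x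
  rw [NBar_toBar, sX_NX]

theorem bX_sigma' (z : e.X K (n + 1) w) :
    e.bX K n w (e.sigma' K (n + 1) w z) = e.sigma' K n w (e.bX K n w z) := by
  simp only [sigma', LinearMap.sum_apply, LinearMap.smul_apply, map_sum, map_smul, bX_tX_pow]

theorem bX_sX (z : e.X K (n + 1) w) :
    e.bX K n w (e.sX K (n + 1) w z) = e.sX K n w (e.bX K n w z) := by
  rw [sX_apply, sX_apply, map_sub, map_smul, bX_NX, bX_sigma']

/-- `σ` commutes with `b` and kills norms. For this reason `b` disappears from `σ δ N̄`, and the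
definitions of `ξ̄` and `Υ` can do with `d` and `d'` alone. -/
theorem sX_bX_NBar (x : e.Xbar K (n + 1) w) (r : k) :
    e.sX K n w (e.bX K n w (r • e.NBar K (n + 1) w x)) = 0 := by
  rw [← bX_sX, map_smul, sX_NBar, smul_zero, map_zero]

/-- In the definition of `ξ̄` the operator `σ'` may be replaced by `σ`. -/
theorem toBar_dPrimeX_sX (z : e.X K (n + 2) (w + 2)) :
    e.toBar K n w (e.dPrimeX K n w (e.sX K (n + 1) (w + 1) (e.dX K (n + 1) (w + 1) z))) =
      e.toBar K n w (e.dPrimeX K n w (e.sigma' K (n + 1) (w + 1) (e.dX K (n + 1) (w + 1) z))) := by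
  obtain ⟨c, hc⟩ := toBar_sigma' e K (n + 1) (w + 1)
  -- The difference involves `d' N = N d`. In the coinvariants `σ'` acts as a scalar, so this term
  -- is a multiple of the class of `d d z`, which is zero.
  rw [sX_apply, map_sub, map_sub, map_smul, map_smul, dPrimeX_NX, toBar_NX, ← dBar_toBar, hc,
    map_smul, dBar_toBar, dX_dX, map_zero, smul_zero, smul_zero, smul_zero, sub_zero]

/-- The composite `N̄ ∘ 𝔭` is the mean `N / (w + 1)`, so the factor in front of `σ'` turns it into
`-σ`. -/
theorem Upsilon_eq (z : e.X K (n + 1) (w + 1)) :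
    e.Upsilon K n w z = - e.sX K n w (e.dX K n w z) := by
  change -e.sigma' K n w (e.dX K n w z) +
    e.NBar K n w (qw k w • e.toBar K n w (e.sigma' K n w (e.dX K n w z))) = _
  rw [map_smul, NBar_toBar, sX_apply, neg_sub]
  abel

end CleftExtension
end

section
variable {k A E : Type*} [CommRing k] [Algebra ℚ k] [Ring A] [Ring E] [Algebra k A] [Algebra k E]

namespace CleftExtension
variable (e : CleftExtension k A E) (K : Subalgebra k A)

/-! ### The model of the relative mixed complex -/

/-- The multiplication by `1 / (w + 1)` on `X_{v,w}`. -/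
def totq : e.XTot K →ₗ[k] e.XTot K :=
  LinearMap.pi fun n => LinearMap.pi fun w => qw k w • e.XComp K n w

/-- The operator `σ` on the product of the `X_{v,w}`. -/
def tots : e.XTot K →ₗ[k] e.XTot K :=
  LinearMap.pi fun n => LinearMap.pi fun w => e.sX K n w ∘ₗ e.XComp K n w

/-- The quotient map on the product of the `X_{v,w}`. -/
def totBar : e.XTot K →ₗ[k] e.BarTot K :=
  LinearMap.pi fun n => LinearMap.pi fun w => e.toBar K n w ∘ₗ e.XComp K n w

/-- The norm map on the product of the `X̄_{v,w}`. -/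
def totNBar : e.BarTot K →ₗ[k] e.XTot K :=
  LinearMap.pi fun n => LinearMap.pi fun w => e.NBar K n w ∘ₗ e.barComp K n w

variable {e K}

/-- The right side uses the full differentials `δ = b + d` and `δ' = b + d'`. The inner `b` drops
out because `σ b N̄ = 0`, the outer one because `σ` vanishes in the coinvariants and `b` descends to
them. Then `σ` may be replaced by `σ'`. -/
theorem barXi_eq (x : e.BarTot K) : e.barXi K x = e.totBar K (e.totq K (e.totδ' K (e.tots K
    (e.totδ K (e.totq K (e.totNBar K x)))))) := by
  funext n w
  have hq : algebraMap ℚ k (1 / ((w : ℚ) + 2 + 1)) = qw k (w + 2) := by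
    rw [qw]; push_cast; rfl
  change algebraMap ℚ k (1 / ((w : ℚ) + 2 + 1)) • qw k w • e.toBar K n w (e.dPrimeX K n w (e.sigma' K (n + 1) (w + 1)
      (e.dX K (n + 1) (w + 1) (e.NBar K (n + 2) (w + 2) (x (n + 2) (w + 2)))))) =
    e.toBar K n w (qw k w • (
      e.bX K n w (e.sX K (n + 1) w
        (e.bX K (n + 1) w (qw k w • e.NBar K (n + 2) w (x (n + 2) w)) +
          e.dX K (n + 1) w (qw k (w + 1) • e.NBar K (n + 2) (w + 1) (x (n + 2) (w + 1))))) +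
      e.dPrimeX K n w (e.sX K (n + 1) (w + 1)
        (e.bX K (n + 1) (w + 1) (qw k (w + 1) • e.NBar K (n + 2) (w + 1) (x (n + 2) (w + 1))) +
          e.dX K (n + 1) (w + 1)
            (qw k (w + 2) • e.NBar K (n + 2) (w + 2) (x (n + 2) (w + 2)))))))
  rw [hq, map_add (e.sX K (n + 1) w), map_add (e.sX K (n + 1) (w + 1)), sX_bX_NBar, sX_bX_NBar,
    zero_add, zero_add, map_smul, map_add, ← bBar_toBar, toBar_sX, map_zero, zero_add,
    toBar_dPrimeX_sX]
  simp only [map_smul]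
  rw [smul_comm]

theorem mapPhi_eq (x y : e.BarTot K) : e.mapPhi K (x, y) = e.totι K (e.totq K (e.totNBar K x)) +
    e.totTh K (e.totι K (e.totNBar K y -
      e.tots K (e.totδ K (e.totq K (e.totNBar K x))))) := by
  funext n
  rw [Pi.add_apply, totι_apply]
  have h1 : ∀ n w, e.psiFst K n w (x, y) = e.totq K (e.totNBar K x) n w := fun n w => rfl
  have h2 : ∀ n w, e.psiSnd K n w (x, y) = (e.totNBar K y -
      e.tots K (e.totδ K (e.totq K (e.totNBar K x)))) n w := fun n w => by
    have hq : algebraMap ℚ k (1 / ((w : ℚ) + 1 + 1)) = qw k (w + 1) := by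
      rw [qw]; push_cast; rfl
    change algebraMap ℚ k (1 / ((w : ℚ) + 1 + 1)) •
        e.Upsilon K n w (e.NBar K (n + 1) (w + 1) (x (n + 1) (w + 1))) + e.NBar K n w (y n w) =
      e.NBar K n w (y n w) -
        e.sX K n w (e.bX K n w (qw k w • e.NBar K (n + 1) w (x (n + 1) w)) +
          e.dX K n w (qw k (w + 1) • e.NBar K (n + 1) (w + 1) (x (n + 1) (w + 1))))
    rw [map_add (e.sX K n w), sX_bX_NBar, zero_add, hq, Upsilon_eq, map_smul, map_smul, smul_neg]
    abel
  have h3 : (∑ w ∈ Finset.range (n + 1), (e.X K n w).subtype ∘ₗ e.psiFst K n w) (x, y) =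
      ∑ w ∈ Finset.range (n + 1), (e.totq K (e.totNBar K x) n w : Cyc (e.KE K) n) := by
    rw [LinearMap.sum_apply]
    exact Finset.sum_congr rfl fun w _ => congrArg Subtype.val (h1 n w)
  rw [← h3]
  cases n with
  | zero => rfl
  | succ n =>
    refine congrArg (_ + ·) (congrArg (e.vartheta K n) ?_)
    change _ = e.totι K (e.totNBar K y - e.tots K (e.totδ K (e.totq K (e.totNBar K x)))) n
    rw [totι_apply, LinearMap.sum_apply]
    exact Finset.sum_congr rfl fun w _ => congrArg Subtype.val (h2 n w)

variable (e K)

/-- The operators on the relative mixed complex, on the product of the `X_{v,w}` and on the product of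
the `X̄_{v,w}`. -/
def model : Model k (e.RelTot K) (e.XTot K) (e.BarTot K) where
  toBaseModel := e.baseModel K
  rDeg := e.totDeg K
  vDeg := e.XDeg K
  wDeg := e.barDeg K
  q := e.totq K
  s := e.tots K
  tb := e.totBar K
  Nb := e.totNBar K
  Db := e.barD K
  ξ := e.barXi K
  Φ := e.mapPhi K
  Θ := e.mapTheta K
  q_t v := funext fun n => funext fun w => (map_smul (e.tX K n w) _ _).symm
  N_q v := funext fun n => funext fun w => map_smul (e.NX K n w) _ _
  Nb_tb v := rfl
  tb_t v := funext fun n => funext fun w => toBar_tX (v n w)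
  tb_q_Nb x := funext fun n => funext fun w => toBar_NBar (x n w)
  N_s v := funext fun n => funext fun w => NX_sX (v n w)
  s_N v := funext fun n => funext fun w => sX_NX (v n w)
  s_sub v := funext fun n => funext fun w => sX_sub (v n w)
  s_sub' v := funext fun n => funext fun w => by
    change e.sX K n w (v n w - e.tX K n w (v n w)) = v n w - qw k w • e.NX K n w (v n w)
    rw [map_sub, sX_tX, sX_sub]
  Db_tb v := rfl
  ξ_eq x := barXi_eq x
  Φ_eq x y := mapPhi_eq x y
  Θ_eq z := funext fun n => funext fun w => toBar_theta K w (z 0 n)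
  rDeg_neg m hm z hz := funext fun n => mem_totDeg.1 hz n (by omega)
  deg_b m z hz := mem_totDeg.2 fun n hn =>
    (congrArg (e.hochschild K n) (mem_totDeg.1 hz (n + 1)
      (by omega))).trans (map_zero _)
  deg_B m z hz := mem_totDeg.2 fun n hn => match n, hn with
    | 0, _ => rfl
    | n + 1, hn => (congrArg (e.connesB K n) (mem_totDeg.1 hz n
        (by omega))).trans (map_zero _)
  deg_th m z hz := mem_totDeg.2 fun n hn => match n, hn with
    | 0, _ => rfl
    | n + 1, hn => (congrArg (e.vartheta K n) (mem_totDeg.1 hz n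
        (by omega))).trans (map_zero _)
  deg_ι m v hv := mem_totDeg.2 fun n hn => by
    change e.totι K v n = 0
    have h : v n = 0 := mem_XDeg.1 hv n hn
    simp [totι_apply, h]
  deg_T m z hz := mem_XDeg.2 fun n hn => funext fun w => by
    change e.toX K n w (e.t K n (z n)) = 0
    have h : z n = 0 := mem_totDeg.1 hz n hn
    rw [h, map_zero, map_zero]
  deg_lam m z hz := mem_XDeg.2 fun n hn => funext fun w => by
    change e.toX K n w (e.lastFace K n (z (n + 1))) = 0
    have h : z (n + 1) = 0 := mem_totDeg.1 hz (n + 1) (by omega)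
    rw [h, map_zero, map_zero]
  deg_δ m v hv := mem_XDeg.2 fun n hn => funext fun w => by
    change e.bX K n w (v (n + 1) w) + e.dX K n w (v (n + 1) (w + 1)) = 0
    have h : v (n + 1) = 0 := mem_XDeg.1 hv (n + 1) (by omega)
    rw [h]
    simp
  deg_δ' m v hv := mem_XDeg.2 fun n hn => funext fun w => by
    change e.bX K n w (v (n + 1) w) + e.dPrimeX K n w (v (n + 1) (w + 1)) = 0
    have h : v (n + 1) = 0 := mem_XDeg.1 hv (n + 1) (by omega)
    rw [h]
    simp
  deg_q m v hv := mem_XDeg.2 fun n hn => funext fun w => by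
    change qw k w • v n w = 0
    have h : v n = 0 := mem_XDeg.1 hv n hn
    rw [h]
    simp
  deg_s m v hv := mem_XDeg.2 fun n hn => funext fun w => by
    change e.sX K n w (v n w) = 0
    have h : v n = 0 := mem_XDeg.1 hv n hn
    rw [h]
    simp
  deg_tb m v hv := mem_barDeg.2 fun n hn => funext fun w => by
    change e.toBar K n w (v n w) = 0
    have h : v n = 0 := mem_XDeg.1 hv n hn
    rw [h]
    simp
  deg_Nb m x hx := mem_XDeg.2 fun n hn => funext fun w => by
    change e.NBar K n w (x n w) = 0
    have h : x n = 0 := mem_barDeg.1 hx n hn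
    rw [h]
    simp

end CleftExtension
end
end RelCyc

theorem mainTheorem9 {k A E : Type*} [CommRing k] [Algebra ℚ k] [Ring A] [Ring E] [Algebra k A]
    [Algebra k E] (e : RelCyc.CleftExtension k A E) (K : Subalgebra k A) :
    RelCyc.IsComplex (e.relDeg K) (e.relb K) ∧
    RelCyc.IsComplex (e.bcDeg K) (e.bcD K) ∧
    RelCyc.IsComplex (e.barDeg K) (e.barD K) ∧
    RelCyc.IsComplex (e.tildeDeg K) (e.tildeD K) ∧
    ∃ (hS : ∀ n, RelCyc.InducesOnHomology (e.bcDeg K) (e.bcD K) (e.bcDeg K) (e.bcD K)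
        (e.mapS K) n (n - 2))
      (hB : ∀ n, RelCyc.InducesOnHomology (e.bcDeg K) (e.bcD K) (e.relDeg K) (e.relb K)
        (e.mapB K) n (n + 1))
      (hI : ∀ n, RelCyc.InducesOnHomology (e.relDeg K) (e.relb K) (e.bcDeg K) (e.bcD K)
        (e.mapI K) n n)
      (hξ : ∀ n, RelCyc.InducesOnHomology (e.barDeg K) (e.barD K) (e.barDeg K) (e.barD K)
        (e.barXi K) n (n - 2))
      (hi : ∀ n, RelCyc.InducesOnHomology (e.barDeg K) (e.barD K) (e.tildeDeg K) (e.tildeD K)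
        (e.mapi K) n (n + 1))
      (hπ : ∀ n, RelCyc.InducesOnHomology (e.tildeDeg K) (e.tildeD K) (e.barDeg K) (e.barD K)
        (e.mappi K) n n)
      (hΘ : ∀ n, RelCyc.InducesOnHomology (e.bcDeg K) (e.bcD K) (e.barDeg K) (e.barD K)
        (e.mapTheta K) n n)
      (hΦ : ∀ n, RelCyc.InducesOnHomology (e.tildeDeg K) (e.tildeD K) (e.relDeg K) (e.relb K)
        (e.mapPhi K) n n),
      (∀ n, Function.Bijective (RelCyc.homologyMap (hΘ n))) ∧
      (∀ n, Function.Bijective (RelCyc.homologyMap (hΦ n))) ∧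
      (∀ n z, RelCyc.homologyMap (hΘ (n - 2)) (RelCyc.homologyMap (hS n) z) =
        -RelCyc.homologyMap (hξ n) (RelCyc.homologyMap (hΘ n) z)) ∧
      (∀ n z, RelCyc.homologyMap (hB n) z =
        RelCyc.homologyMap (hΦ (n + 1))
          (RelCyc.homologyMap (hi n) (RelCyc.homologyMap (hΘ n) z))) ∧
      (∀ n y, RelCyc.homologyMap (hΘ n) (RelCyc.homologyMap (hI n) (RelCyc.homologyMap (hΦ n) y)) =
        RelCyc.homologyMap (hπ n) y) := by
  -- The degrees, differentials and maps built from `model` agree by definition with those of the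
  -- statement.
  exact ⟨(e.model K).isComplex_rel, (e.model K).isComplex_bc, (e.model K).isComplex_bar,
    (e.model K).isComplex_tilde, (e.model K).induces_S, (e.model K).induces_B,
    (e.model K).induces_I, (e.model K).induces_ξ, (e.model K).induces_i, (e.model K).induces_π,
    (e.model K).induces_Θ, (e.model K).induces_Φ, (e.model K).bijective_Θ,
    (e.model K).bijective_Φ, (e.model K).homologyMap_Θ_S, (e.model K).homologyMap_B,
    (e.model K).homologyMap_Θ_I_Φ⟩
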